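/- **Setting.** Let $\mathcal{C}$ be the following $\mathbb{Z}$-linear category, written $\mathrm{Cob}_{/l}$. Its objects are planar $1$-$1$ tangles without crossings, i.e. a *special line* $|$ together with finitely many (non-special) circles, each with a degree shift $\{m\}$, $m\in\mathbb{Z}$. Morphisms are $\mathbb{Z}$-linear combinations of compact oriented (abstract) cobordisms up to homeomorphism relative to the boundary in which the two special lines lie on the same component (the *curtain*), modulo the local relations S (a surface with a sphere component is $0$), T (a torus component equals the factor $2$) and 4TU (for four discs on a surface, $C_{12}+C_{34}=C_{13}+C_{24}$, where $C_{ij}$ is the surface with discs $i,j$ replaced by a tube). A cobordism $C\colon X\{m\}\to Y\{m'\}$ has degree $\chi(C)-1+m'-m$. $H$ denotes the operation of adding a handle to the curtain, of degree $-2$; a *dot* on a disc means that a neck connects it to the curtain. $\mathrm{Mat}(\mathcal{C})$ is the additive closure (columns and matrices), and a complex is a cochain complex graded by $\mathbb{Z}$. For an oriented link diagram $D$ in the plane with $n_+$ positive and $n_-$ negative crossings, marked at a point $p$ and cut open there (so that it becomes a $1$-$1$ tangle), let $Kh(D,p)$ be its Bar-Natan complex in $\mathrm{Mat}(\mathcal{C})$: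 the term in degree $r$ is the column of all smoothings with $r+n_-$ one-smoothings, shifted by $\{r+n_+-n_-\}$, and the differential is the signed sum of the saddles on the edges of the cube of resolutions (with sign $(-1)^{\sum_{i<j}\xi_i}$ on the edge that changes the $j$-th crossing of $\xi$). **Theorem.** 1. (Delooping.) Let $X$ be an object with a non-special circle $c$, and let $X'$ be $X$ with $c$ removed. In $\mathrm{Mat}(\mathcal{C})$ there is an isomorphism $X\cong\begin{pmatrix}X'\{-1\}\\X'\{+1\}\end{pmatrix}$, homogeneous of degree $0$ in both directions. The map $X\to X'\{-1\}$ is the cap on $c$; the map $X\to X'\{+1\}$ is the dotted cap minus $H$ times the cap; the inverse is the dotted cup on $X'\{-1\}$ and the cup on $X'\{+1\}$. 2. More generally, if in every entry of an object $M$ of $\mathrm{Mat}(\mathcal{C})$ at most one non-special circle is chosen, then the block diagonal matrices built from the maps of part 1 (and identities where no circle is chosen) are mutually inverse and of degree $0$. 3. (Extension to complexes.) Let $K$ be a complex in $\mathrm{Mat}(\mathcal{C})$, with a choice as in part 2 in every term. Replacing the terms by their deloopings and the differentials $d$ by the induced maps $(\text{delooping})\circ d\circ(\text{delooping})^{-1}$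 gives a complex, and the deloopings are an isomorphism of complexes from $K$ to it. If the differentials of $K$ have degree $0$, so have the induced ones. 4. Every complex $K$ in $\mathrm{Mat}(\mathcal{C})$ is isomorphic, by maps of degree $0$ in both directions, to a complex in which each entry with $k$ non-special circles and shift $m$ has been replaced by the $2^k$ special lines $|\{m+\sum_c\varepsilon_c\}$, $\varepsilon\in\{\pm1\}^k$. If the differentials of $K$ have degree $0$, so have those of the new complex. 5. The functor from free $\mathbb{Z}[H]$-modules of finite rank with a graded basis, and all $\mathbb{Z}[H]$-linear maps, to $\mathrm{Mat}(\mathcal{C})$, which sends a module with basis elements of shifts $m_i$ to the column of the $|\{m_i\}$ and a matrix of polynomials $\sum_k a_kH^k$ to the matrix of the combinations $\sum_k a_k\cdot(\text{curtain with }k\text{ handles})$, is full and faithful. 6. (Reduction theorem over $\mathbb{Z}$.) For every oriented link diagram $D$ and every marked point $p$ on it, the differentials of $Kh(D,p)$ have degree $0$, and $Kh(D,p)$ is isomorphic as a complex in $\mathrm{Mat}(\mathcal{C})$, by maps of degree $0$ in both directions (hence also up to homotopy), to the image under the functor of part 5 of a complex $F$ of free graded $\mathbb{Z}[H]$-modules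 of finite rank. All matrix entries of the differentials of $F$ are monomials: the entry from a basis element of shift $m$ to one of shift $m'$ is $a H^k$ with $a\in\mathbb{Z}$, where $2k=m'-m$ if $a\neq0$. -/

import Mathlib

open CategoryTheory

namespace BarNatan

open scoped Classical in
/-- Push-forward of an integer weight along a map of finite sets: sum over the fibres. -/
noncomputable def push {A B : Type} [Fintype A] (p : A → B) (w : A → ℤ) (b : B) : ℤ :=
  ∑ a, if p a = b then w a else 0

theorem push_push {A B C : Type} [Fintype A] [Fintype B] (p : A → B) (q : B → C) (w : A → ℤ) :
    push q (push p w) = push (q ∘ p) w := by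
  classical
  funext c
  unfold push
  have : ∀ b, (if q b = c then ∑ a, (if p a = b then w a else 0) else 0)
      = ∑ a, if p a = b then (if q (p a) = c then w a else 0) else 0 := by
    intro b
    split_ifs with h
    · refine Finset.sum_congr rfl fun a _ => ?_
      split_ifs with h1 h2 <;> simp_all
    · symm
      refine Finset.sum_eq_zero fun a _ => ?_
      split_ifs with h1 h2 <;> simp_all
  simp only [this]
  rw [Finset.sum_comm]
  simp

theorem push_sum {A B C : Type} [Fintype A] [Fintype B] (p : A ⊕ B → C) (w : A ⊕ B → ℤ) (c : C) :
    push p w c = push (fun a => p (Sum.inl a)) (fun a => w (Sum.inl a)) c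
      + push (fun b => p (Sum.inr b)) (fun b => w (Sum.inr b)) c := by
  classical
  simp [push, Fintype.sum_sum_type]

theorem push_add {A B : Type} [Fintype A] (p : A → B) (w w' : A → ℤ) (b : B) :
    push p (fun a => w a + w' a) b = push p w b + push p w' b := by
  classical
  simp only [push, ← Finset.sum_add_distrib]
  refine Finset.sum_congr rfl fun a _ => ?_
  split_ifs <;> simp

theorem push_equiv {A A' B : Type} [Fintype A] [Fintype A'] (e : A ≃ A') (p : A' → B)
    (w : A' → ℤ) : push (fun a => p (e a)) (fun a => w (e a)) = push p w := by
  classical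
  funext b
  exact Equiv.sum_comp e fun a' => if p a' = b then w a' else 0

theorem push_injective {A B : Type} [Fintype A] (p : A → B) (hp : Function.Injective p)
    (w : A → ℤ) (a : A) : push p w (p a) = w a := by
  classical
  simp [push, hp.eq_iff]

theorem push_card {A B : Type} [Fintype A] (p : A → B) (b : B) :
    push p (fun _ => 1) b = Nat.card {a // p a = b} := by
  classical
  simp [push, Fintype.card_subtype]

/-- In a finite multigraph with vertex set `A` and edge set `E`, every connected component has
at most one vertex more than it has edges. -/
theorem card_vertices_le {A E : Type} [Fintype A] [Fintype E] (s t : E → A) (R : A → A → Prop)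
    (hR : ∀ a b, R a b ↔ ∃ e, a = s e ∧ b = t e) (K : Quot R) :
    Nat.card {a // Quot.mk R a = K} ≤ Nat.card {e // Quot.mk R (s e) = K} + 1 := by
  classical
  let V := {a // Quot.mk R a = K}
  let G : SimpleGraph V := SimpleGraph.fromRel fun u v => R u.1 v.1
  have reach : ∀ a b : A, Relation.EqvGen R a b → ∀ (ha : Quot.mk R a = K)
      (hb : Quot.mk R b = K), G.Reachable ⟨a, ha⟩ ⟨b, hb⟩ := by
    intro a b h
    induction h with
    | rel x y h =>
      intro ha hb
      by_cases hxy : x = y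
      · subst hxy; exact SimpleGraph.Reachable.refl _
      · refine SimpleGraph.Adj.reachable ?_
        rw [SimpleGraph.fromRel_adj]
        exact ⟨fun h' => hxy (congrArg Subtype.val h'), Or.inl h⟩
    | refl x => intro ha hb; exact SimpleGraph.Reachable.refl _
    | symm x y h ih => intro ha hb; exact (ih hb ha).symm
    | trans x y z h1 h2 ih1 ih2 =>
      intro ha hb
      have hy : Quot.mk R y = K := by
        rw [← ha]; exact (Quot.eqvGen_sound h1).symm
      exact (ih1 ha hy).trans (ih2 hy hb)
  have hne : Nonempty V := by
    induction K using Quot.ind with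
    | mk a => exact ⟨⟨a, rfl⟩⟩
  have hconn : G.Connected :=
    { preconnected := fun u v =>
        reach u.1 v.1 (Quot.eqvGen_exact (u.2.trans v.2.symm)) u.2 v.2
      nonempty := hne }
  have h1 := hconn.card_vert_le_card_edgeSet_add_one
  suffices h2 : Nat.card G.edgeSet ≤ Nat.card {e // Quot.mk R (s e) = K} from
    h1.trans (Nat.add_le_add_right h2 1)
  have hedge : ∀ z : G.edgeSet, ∃ e : {e // Quot.mk R (s e) = K},
      (z : Sym2 V).map Subtype.val = s(s e.1, t e.1) := by
    rintro ⟨z, hz⟩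
    induction z using Sym2.ind with
    | h u v =>
      rw [SimpleGraph.mem_edgeSet, SimpleGraph.fromRel_adj] at hz
      rw [hR, hR] at hz
      rcases hz.2 with ⟨e, h1, h2⟩ | ⟨e, h1, h2⟩
      · exact ⟨⟨e, by rw [← h1]; exact u.2⟩, by simp [h1, h2]⟩
      · exact ⟨⟨e, by rw [← h1]; exact v.2⟩, by simp [h1, h2, Sym2.eq_swap]⟩
  choose φ hφ using hedge
  refine Nat.card_le_card_of_injective φ fun z z' h => ?_
  have := (hφ z).trans ((congrArg (fun e : {e // Quot.mk R (s e) = K} => s(s e.1, t e.1)) h).trans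
    (hφ z').symm)
  exact Subtype.ext (Sym2.map.injective Subtype.val_injective this)


/-- An object of the category of planar `1-1` tangles without crossings and their cobordisms, with a
degree shift: a finite set of connected components, one of which is the special line while the others
are the (non-special) circles. The special line together with no circle is the object called empty
set. Cobordisms are taken abstractly, so no position in the plane is recorded. -/
structure Tangle : Type 1 where
  comps : Type
  [fintype : Fintype comps]
  line : comps
  shift : ℤ

attribute [instance] Tangle.fintype

/-- A compact oriented cobordism from `X` to `Y`, up to homeomorphism relative to the boundary. It has
`n` connected components; `src` and `tgt` tell which component of the surface contains a given
component of `X` or `Y`, and `genus` is the genus of a component. The two special lines lie on the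
same component, the curtain. Closed components are allowed. By the classification of surfaces these
data determine the cobordism. -/
structure Surface (X Y : Tangle) : Type where
  n : ℕ
  src : X.comps → Fin n
  tgt : Y.comps → Fin n
  curtain : src X.line = tgt Y.line
  genus : Fin n → ℕ

namespace Surface

variable {X Y Z W : Tangle}

/-- The surface whose components are indexed by an arbitrary finite set `K`. -/
noncomputable def of (K : Type) [Fintype K] (s : X.comps → K) (t : Y.comps → K)
    (h : s X.line = t Y.line) (g : K → ℕ) : Surface X Y where
  n := Fintype.card K
  src := fun x => Fintype.equivFin K (s x)
  tgt := fun y => Fintype.equivFin K (t y)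
  curtain := congrArg _ h
  genus := fun k => g ((Fintype.equivFin K).symm k)

/-- Homeomorphism relative to the boundary, expressed through the classifying data. -/
def Homeo (f f' : Surface X Y) : Prop :=
  ∃ e : Fin f.n ≃ Fin f'.n, (∀ x, e (f.src x) = f'.src x) ∧ (∀ y, e (f.tgt y) = f'.tgt y) ∧
    ∀ k, f'.genus (e k) = f.genus k

theorem Homeo.refl (f : Surface X Y) : Homeo f f :=
  ⟨Equiv.refl _, fun _ => rfl, fun _ => rfl, fun _ => rfl⟩

theorem Homeo.symm {f f' : Surface X Y} : Homeo f f' → Homeo f' f := by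
  rintro ⟨e, h1, h2, h3⟩
  refine ⟨e.symm, fun x => ?_, fun y => ?_, fun k => ?_⟩
  · rw [← h1, e.symm_apply_apply]
  · rw [← h2, e.symm_apply_apply]
  · rw [← h3, e.apply_symm_apply]

theorem Homeo.trans {f f' f'' : Surface X Y} : Homeo f f' → Homeo f' f'' → Homeo f f'' := by
  rintro ⟨e, h1, h2, h3⟩ ⟨e', h1', h2', h3'⟩
  refine ⟨e.trans e', fun x => ?_, fun y => ?_, fun k => ?_⟩
  · simp [h1, h1']
  · simp [h2, h2']
  · simp [h3, h3']

/-- Homeomorphic surfaces are identified. -/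
instance setoid (X Y : Tangle) : Setoid (Surface X Y) where
  r := Homeo
  iseqv := ⟨Homeo.refl, Homeo.symm, Homeo.trans⟩

theorem of_homeo {K K' : Type} [Fintype K] [Fintype K'] {s : X.comps → K} {t : Y.comps → K}
    {h : s X.line = t Y.line} {g : K → ℕ} {s' : X.comps → K'} {t' : Y.comps → K'}
    {h' : s' X.line = t' Y.line} {g' : K' → ℕ} (e : K ≃ K') (hs : ∀ x, e (s x) = s' x)
    (ht : ∀ y, e (t y) = t' y) (hg : ∀ k, g' (e k) = g k) :
    Homeo (of K s t h g) (of K' s' t' h' g') := by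
  refine ⟨(Fintype.equivFin K).symm.trans (e.trans (Fintype.equivFin K')), fun x => ?_,
    fun y => ?_, fun k => ?_⟩
  · change Fintype.equivFin K' (e ((Fintype.equivFin K).symm (Fintype.equivFin K (s x)))) = _
    rw [Equiv.symm_apply_apply, hs]
    rfl
  · change Fintype.equivFin K' (e ((Fintype.equivFin K).symm (Fintype.equivFin K (t y)))) = _
    rw [Equiv.symm_apply_apply, ht]
    rfl
  · change g' ((Fintype.equivFin K').symm (Fintype.equivFin K' (e ((Fintype.equivFin K).symm k))))
      = g ((Fintype.equivFin K).symm k)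
    rw [Equiv.symm_apply_apply, hg]

theorem homeo_of (f : Surface X Y) : Homeo f (of (Fin f.n) f.src f.tgt f.curtain f.genus) :=
  ⟨Fintype.equivFin _, fun _ => rfl, fun _ => rfl, fun k =>
    congrArg f.genus (Equiv.symm_apply_apply (Fintype.equivFin (Fin f.n)) k)⟩

/-- A component of `f` and one of `g` are adjacent if they meet along a component of the middle. -/
def Glue (f : Surface X Y) (g : Surface Y Z) (a b : Fin f.n ⊕ Fin g.n) : Prop :=
  ∃ y, a = Sum.inl (f.tgt y) ∧ b = Sum.inr (g.src y)

/-- The connected components of the surface glued from `f` and `g`. -/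
abbrev GlueComps (f : Surface X Y) (g : Surface Y Z) : Type := Quot (Glue f g)

noncomputable instance (f : Surface X Y) (g : Surface Y Z) : Fintype (GlueComps f g) :=
  Fintype.ofFinite _

/-- The genus of a component of the glued surface: the sum of the genera of its pieces plus the first
Betti number `E - V + 1` of the graph whose vertices are the pieces and whose edges are the middle
components along which they are glued. -/
noncomputable def glueGenus (f : Surface X Y) (g : Surface Y Z) (K : GlueComps f g) : ℕ :=
  open scoped Classical in
  (∑ a : Fin f.n ⊕ Fin g.n, if Quot.mk (Glue f g) a = K then Sum.elim f.genus g.genus a else 0)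
    + Nat.card {y : Y.comps // Quot.mk (Glue f g) (Sum.inl (f.tgt y)) = K} + 1
    - Nat.card {a : Fin f.n ⊕ Fin g.n // Quot.mk (Glue f g) a = K}

theorem glueGenus_eq (f : Surface X Y) (g : Surface Y Z) (K : GlueComps f g) :
    (glueGenus f g K : ℤ) - 1 =
      push (Quot.mk (Glue f g)) (fun a => ((Sum.elim f.genus g.genus a : ℕ) : ℤ) - 1) K
        + push (fun y => Quot.mk (Glue f g) (Sum.inl (f.tgt y))) (fun _ => 1) K := by
  classical
  have hb := card_vertices_le (fun y : Y.comps => (Sum.inl (f.tgt y) : Fin f.n ⊕ Fin g.n))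
    (fun y => Sum.inr (g.src y)) (Glue f g) (fun _ _ => Iff.rfl) K
  change Nat.card {a : Fin f.n ⊕ Fin g.n // Quot.mk (Glue f g) a = K} ≤
    Nat.card {y : Y.comps // Quot.mk (Glue f g) (Sum.inl (f.tgt y)) = K} + 1 at hb
  have h1 : push (Quot.mk (Glue f g)) (fun a => ((Sum.elim f.genus g.genus a : ℕ) : ℤ) - 1) K
      = push (Quot.mk (Glue f g)) (fun a => ((Sum.elim f.genus g.genus a : ℕ) : ℤ)) K
        - Nat.card {a : Fin f.n ⊕ Fin g.n // Quot.mk (Glue f g) a = K} := by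
    rw [← push_card, eq_sub_iff_add_eq, ← push_add]
    simp
  rw [h1, push_card]
  unfold glueGenus
  rw [Nat.cast_sub (by omega)]
  have h2 : push (Quot.mk (Glue f g)) (fun a => ((Sum.elim f.genus g.genus a : ℕ) : ℤ)) K
    = ((∑ a : Fin f.n ⊕ Fin g.n, if Quot.mk (Glue f g) a = K then Sum.elim f.genus g.genus a
        else 0 : ℕ) : ℤ) := by
    simp [push]
  rw [h2]
  push_cast
  ring

/-- Composition of cobordisms, by gluing along `Y`. -/
noncomputable def comp (f : Surface X Y) (g : Surface Y Z) : Surface X Z :=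
  of (GlueComps f g) (fun x => Quot.mk _ (Sum.inl (f.src x)))
    (fun z => Quot.mk _ (Sum.inr (g.tgt z)))
    (by rw [f.curtain, ← g.curtain]; exact Quot.sound ⟨Y.line, rfl, rfl⟩) (glueGenus f g)

/-- The product cobordism `X × [0, 1]`, which is the identity of `X`. -/
noncomputable def cylinder (X : Tangle) : Surface X X :=
  of X.comps id id rfl fun _ => 0

/-- Recognition of composites. -/
theorem exists_comp_homeo {f : Surface X Y} {g : Surface Y Z} {K : Type} [Fintype K]
    {s : X.comps → K} {t : Z.comps → K} {h : s X.line = t Z.line} (q : Fin f.n ⊕ Fin g.n → K)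
    (r : K → GlueComps f g) (hq : ∀ y, q (Sum.inl (f.tgt y)) = q (Sum.inr (g.src y)))
    (hqr : ∀ k, ∃ a, q a = k) (hr : ∀ a, r (q a) = Quot.mk _ a)
    (hs : ∀ x, q (Sum.inl (f.src x)) = s x) (ht : ∀ z, q (Sum.inr (g.tgt z)) = t z) :
    ∃ γ : K → ℕ, (∀ k, (γ k : ℤ) - 1 =
      push q (fun a => ((Sum.elim f.genus g.genus a : ℕ) : ℤ) - 1) k
        + push (fun y => q (Sum.inl (f.tgt y))) (fun _ => 1) k) ∧
      Homeo (comp f g) (of K s t h γ) := by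
  classical
  let e : GlueComps f g ≃ K :=
    { toFun := Quot.lift q (by rintro a b ⟨y, rfl, rfl⟩; exact hq y)
      invFun := r
      left_inv := by rintro ⟨a⟩; exact hr a
      right_inv := by
        intro k
        obtain ⟨a, rfl⟩ := hqr k
        rw [hr] }
  refine ⟨fun k => glueGenus f g (e.symm k), fun k => ?_,
    of_homeo e (fun x => hs x) (fun z => ht z) fun k => by rw [e.symm_apply_apply]⟩
  obtain ⟨k, rfl⟩ := e.surjective k
  simp only [e.symm_apply_apply]
  rw [glueGenus_eq f g k]
  have h3 := push_push (Quot.mk (Glue f g)) e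
    (fun a => ((Sum.elim f.genus g.genus a : ℕ) : ℤ) - 1)
  have h4 := push_push (fun y => Quot.mk (Glue f g) (Sum.inl (f.tgt y))) e (fun _ => 1)
  rw [show q = e ∘ Quot.mk (Glue f g) from rfl,
    show (fun y => (e ∘ Quot.mk (Glue f g)) (Sum.inl (f.tgt y)))
      = e ∘ (fun y => Quot.mk (Glue f g) (Sum.inl (f.tgt y))) from rfl, ← h3, ← h4,
    push_injective _ e.injective, push_injective _ e.injective]

/-- Recognition of composites. -/
theorem comp_homeo {f : Surface X Y} {g : Surface Y Z} {K : Type} [Fintype K] {s : X.comps → K}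
    {t : Z.comps → K} {h : s X.line = t Z.line} {γ : K → ℕ} (q : Fin f.n ⊕ Fin g.n → K)
    (r : K → GlueComps f g) (hq : ∀ y, q (Sum.inl (f.tgt y)) = q (Sum.inr (g.src y)))
    (hqr : ∀ k, ∃ a, q a = k) (hr : ∀ a, r (q a) = Quot.mk _ a)
    (hs : ∀ x, q (Sum.inl (f.src x)) = s x) (ht : ∀ z, q (Sum.inr (g.tgt z)) = t z)
    (hγ : ∀ k, (γ k : ℤ) - 1 =
      push q (fun a => ((Sum.elim f.genus g.genus a : ℕ) : ℤ) - 1) k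
        + push (fun y => q (Sum.inl (f.tgt y))) (fun _ => 1) k) :
    Homeo (comp f g) (of K s t h γ) := by
  obtain ⟨γ', h1, h2⟩ := exists_comp_homeo (h := h) q r hq hqr hr hs ht
  have : γ' = γ := by
    funext k
    have := h1 k
    rw [← hγ k] at this
    omega
  rwa [← this]

/-- The enumeration of the components of `comp f g`. -/
noncomputable def gEquiv (f : Surface X Y) (g : Surface Y Z) :
    GlueComps f g ≃ Fin (comp f g).n := Fintype.equivFin (GlueComps f g)

/-- The component of `comp f g` containing a given component of `f` or `g`. -/
noncomputable def cls (f : Surface X Y) (g : Surface Y Z) (a : Fin f.n ⊕ Fin g.n) :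
    Fin (comp f g).n := gEquiv f g (Quot.mk _ a)

theorem cls_glue (f : Surface X Y) (g : Surface Y Z) (y : Y.comps) :
    cls f g (Sum.inl (f.tgt y)) = cls f g (Sum.inr (g.src y)) :=
  congrArg (gEquiv f g) (Quot.sound ⟨y, rfl, rfl⟩)

theorem cls_surjective (f : Surface X Y) (g : Surface Y Z) (k : Fin (comp f g).n) :
    ∃ a, cls f g a = k := by
  obtain ⟨a, ha⟩ := Quot.exists_rep ((gEquiv f g).symm k)
  exact ⟨a, by rw [cls, ha]; exact Equiv.apply_symm_apply _ _⟩

/-- Maps out of the components of a composite. -/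
noncomputable def desc (f : Surface X Y) (g : Surface Y Z) {T : Type} (φ : Fin f.n ⊕ Fin g.n → T)
    (hφ : ∀ y, φ (Sum.inl (f.tgt y)) = φ (Sum.inr (g.src y))) (k : Fin (comp f g).n) : T :=
  Quot.lift φ (by rintro a b ⟨y, rfl, rfl⟩; exact hφ y)
    ((gEquiv f g).symm k)

theorem desc_cls (f : Surface X Y) (g : Surface Y Z) {T : Type} (φ : Fin f.n ⊕ Fin g.n → T)
    (hφ : ∀ y, φ (Sum.inl (f.tgt y)) = φ (Sum.inr (g.src y))) (a : Fin f.n ⊕ Fin g.n) :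
    desc f g φ hφ (cls f g a) = φ a := by
  unfold desc cls
  rw [Equiv.symm_apply_apply]

theorem comp_genus (f : Surface X Y) (g : Surface Y Z) :
    (fun k => ((comp f g).genus k : ℤ) - 1) = fun k =>
      push (cls f g) (fun a => ((Sum.elim f.genus g.genus a : ℕ) : ℤ) - 1) k
        + push (fun y => cls f g (Sum.inl (f.tgt y))) (fun _ => 1) k := by
  funext k
  have h1 := glueGenus_eq f g ((gEquiv f g).symm k)
  refine h1.trans ?_
  have h3 : (fun y => cls f g (Sum.inl (f.tgt y))) = gEquiv f g ∘
      fun y => Quot.mk (Glue f g) (Sum.inl (f.tgt y)) := rfl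
  rw [h3, show cls f g = gEquiv f g ∘ Quot.mk (Glue f g) from rfl, ← push_push, ← push_push]
  obtain ⟨k, rfl⟩ := (gEquiv f g).surjective k
  rw [Equiv.symm_apply_apply]
  exact congrArg₂ (· + ·) (push_injective _ (Equiv.injective _) _ _).symm
    (push_injective _ (Equiv.injective _) _ _).symm

/-- Recognition of composites. -/
theorem comp_homeo' {f : Surface X Y} {g : Surface Y Z} {k : Surface X Z}
    (q : Fin f.n ⊕ Fin g.n → Fin k.n)
    (r : Fin k.n → Fin (comp f g).n) (hq : ∀ y, q (Sum.inl (f.tgt y)) = q (Sum.inr (g.src y)))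
    (hqr : ∀ k, ∃ a, q a = k) (hr : ∀ a, r (q a) = cls f g a)
    (hs : ∀ x, q (Sum.inl (f.src x)) = k.src x) (ht : ∀ z, q (Sum.inr (g.tgt z)) = k.tgt z)
    (hγ : (fun c => (k.genus c : ℤ) - 1) = fun c =>
      push q (fun a => ((Sum.elim f.genus g.genus a : ℕ) : ℤ) - 1) c
        + push (fun y => q (Sum.inl (f.tgt y))) (fun _ => 1) c) :
    Homeo (comp f g) k :=
  (comp_homeo (h := k.curtain) q (fun c => (gEquiv f g).symm (r c)) hq hqr
    (fun a => by rw [hr, cls, Equiv.symm_apply_apply]) hs ht (congrFun hγ)).trans (homeo_of k).symm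

/-- Recognition of composites. -/
theorem exists_of_comp_of {K L M : Type} [Fintype K] [Fintype L] [Fintype M] {s₁ : X.comps → K}
    {t₁ : Y.comps → K} {h₁ : s₁ X.line = t₁ Y.line} {g₁ : K → ℕ} {s₂ : Y.comps → L}
    {t₂ : Z.comps → L} {h₂ : s₂ Y.line = t₂ Z.line} {g₂ : L → ℕ} {s : X.comps → M}
    {t : Z.comps → M} {h : s X.line = t Z.line} (q₁ : K → M) (q₂ : L → M)
    (hq : ∀ y, q₁ (t₁ y) = q₂ (s₂ y))
    (hqr : ∀ m, (∃ a, q₁ a = m) ∨ ∃ b, q₂ b = m)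
    (hr : ∀ {T : Type} (φ₁ : K → T) (φ₂ : L → T), (∀ y, φ₁ (t₁ y) = φ₂ (s₂ y)) →
      ∃ r : M → T, (∀ a, r (q₁ a) = φ₁ a) ∧ ∀ b, r (q₂ b) = φ₂ b)
    (hs : ∀ x, q₁ (s₁ x) = s x) (ht : ∀ z, q₂ (t₂ z) = t z) :
    ∃ g : M → ℕ, (∀ m, (g m : ℤ) - 1 = push q₁ (fun a => (g₁ a : ℤ) - 1) m
      + push q₂ (fun b => (g₂ b : ℤ) - 1) m + push (fun y => q₁ (t₁ y)) (fun _ => 1) m) ∧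
      Homeo (comp (of K s₁ t₁ h₁ g₁) (of L s₂ t₂ h₂ g₂)) (of M s t h g) := by
  let eK : K ≃ Fin (of K s₁ t₁ h₁ g₁).n := Fintype.equivFin K
  let eL : L ≃ Fin (of L s₂ t₂ h₂ g₂).n := Fintype.equivFin L
  obtain ⟨r, hr1, hr2⟩ := hr
    (fun a => (Quot.mk _ (Sum.inl (eK a)) : GlueComps (of K s₁ t₁ h₁ g₁) (of L s₂ t₂ h₂ g₂)))
    (fun b => Quot.mk _ (Sum.inr (eL b))) (fun y => Quot.sound ⟨y, rfl, rfl⟩)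
  have key : ∃ g : M → ℕ, _ ∧ Homeo (comp (of K s₁ t₁ h₁ g₁) (of L s₂ t₂ h₂ g₂)) (of M s t h g) :=
    exists_comp_homeo (Sum.elim (fun a => q₁ (eK.symm a)) fun b => q₂ (eL.symm b)) r
      ?_ ?_ ?_ ?_ ?_
  rotate_left
  · intro y
    change q₁ (eK.symm (eK (t₁ y))) = q₂ (eL.symm (eL (s₂ y)))
    rw [Equiv.symm_apply_apply, Equiv.symm_apply_apply, hq]
  · intro m
    rcases hqr m with ⟨a, rfl⟩ | ⟨b, rfl⟩
    · exact ⟨Sum.inl (eK a), congrArg q₁ (Equiv.symm_apply_apply _ _)⟩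
    · exact ⟨Sum.inr (eL b), congrArg q₂ (Equiv.symm_apply_apply _ _)⟩
  · rintro (a | b)
    · refine (hr1 (eK.symm a)).trans ?_
      rw [Equiv.apply_symm_apply]
    · refine (hr2 (eL.symm b)).trans ?_
      rw [Equiv.apply_symm_apply]
  · intro x
    change q₁ (eK.symm (eK (s₁ x))) = s x
    rw [Equiv.symm_apply_apply, hs]
  · intro z
    change q₂ (eL.symm (eL (t₂ z))) = t z
    rw [Equiv.symm_apply_apply, ht]
  · obtain ⟨g, hg, hh⟩ := key
    refine ⟨g, fun m => ?_, hh⟩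
    rw [hg, push_sum]
    have e1 := congrFun (push_equiv eK.symm q₁ fun a => (g₁ a : ℤ) - 1) m
    have e2 := congrFun (push_equiv eL.symm q₂ fun a => (g₂ a : ℤ) - 1) m
    have e3 : (fun y => q₁ (t₁ y)) = fun y => q₁ (eK.symm (eK (t₁ y))) := by
      funext y
      rw [Equiv.symm_apply_apply]
    rw [← e1, ← e2, e3]
    rfl

/-- Recognition of composites. -/
theorem of_comp_of {K L M : Type} [Fintype K] [Fintype L] [Fintype M] {s₁ : X.comps → K}
    {t₁ : Y.comps → K} {h₁ : s₁ X.line = t₁ Y.line} {g₁ : K → ℕ} {s₂ : Y.comps → L}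
    {t₂ : Z.comps → L} {h₂ : s₂ Y.line = t₂ Z.line} {g₂ : L → ℕ} {s : X.comps → M}
    {t : Z.comps → M} {h : s X.line = t Z.line} {g : M → ℕ} (q₁ : K → M) (q₂ : L → M)
    (hq : ∀ y, q₁ (t₁ y) = q₂ (s₂ y))
    (hqr : ∀ m, (∃ a, q₁ a = m) ∨ ∃ b, q₂ b = m)
    (hr : ∀ {T : Type} (φ₁ : K → T) (φ₂ : L → T), (∀ y, φ₁ (t₁ y) = φ₂ (s₂ y)) →
      ∃ r : M → T, (∀ a, r (q₁ a) = φ₁ a) ∧ ∀ b, r (q₂ b) = φ₂ b)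
    (hs : ∀ x, q₁ (s₁ x) = s x) (ht : ∀ z, q₂ (t₂ z) = t z)
    (hg : ∀ m, (g m : ℤ) - 1 = push q₁ (fun a => (g₁ a : ℤ) - 1) m
      + push q₂ (fun b => (g₂ b : ℤ) - 1) m + push (fun y => q₁ (t₁ y)) (fun _ => 1) m) :
    Homeo (comp (of K s₁ t₁ h₁ g₁) (of L s₂ t₂ h₂ g₂)) (of M s t h g) := by
  obtain ⟨g', h1, h2⟩ := exists_of_comp_of (h₁ := h₁) (g₁ := g₁) (h₂ := h₂) (g₂ := g₂) (h := h)
    q₁ q₂ hq hqr hr hs ht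
  have : g' = g := by
    funext m
    have := h1 m
    rw [← hg m] at this
    omega
  rwa [← this]

theorem comp_congr {f f' : Surface X Y} {g g' : Surface Y Z} (hf : Homeo f f')
    (hg : Homeo g g') : Homeo (comp f g) (comp f' g') := by
  obtain ⟨e, he1, he2, he3⟩ := hf
  obtain ⟨e', he1', he2', he3'⟩ := hg
  refine comp_homeo' (fun a => cls f' g' (Sum.map e e' a))
    (desc f' g' (fun a => cls f g (Sum.map e.symm e'.symm a)) ?_) ?_ ?_ ?_ ?_ ?_ ?_
  · intro y
    simp only [Sum.map_inl, Sum.map_inr, ← he2, ← he1', Equiv.symm_apply_apply]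
    exact cls_glue f g y
  · intro y
    simp only [Sum.map_inl, Sum.map_inr, he2, he1']
    exact cls_glue f' g' y
  · intro k
    obtain ⟨a, rfl⟩ := cls_surjective f' g' k
    exact ⟨Sum.map e.symm e'.symm a, by rcases a with a | a <;> simp⟩
  · rintro (a | a) <;> simp [desc_cls]
  · intro x
    simp only [Sum.map_inl, he1]
    rfl
  · intro z
    simp only [Sum.map_inr, he2']
    rfl
  · rw [comp_genus]
    funext k
    simp only [Sum.map_inl, he2]
    congr 1
    rw [← push_equiv (Equiv.sumCongr e e')]
    congr 1
    funext a
    rcases a with a | a <;> simp [he3, he3']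

theorem cylinder_comp (f : Surface X Y) : Homeo (comp (cylinder X) f) f := by
  refine (comp_congr (Homeo.refl _) (homeo_of f)).trans (Homeo.trans ?_ (homeo_of f).symm)
  refine of_comp_of f.src _root_.id (fun _ => rfl) (fun m => Or.inr ⟨m, rfl⟩) ?_ (fun _ => rfl)
    (fun _ => rfl) ?_
  · intro T φ₁ φ₂ h
    exact ⟨φ₂, fun a => (h a).symm, fun b => rfl⟩
  · intro m
    have h1 := push_injective _root_.id Function.injective_id (fun b => (f.genus b : ℤ) - 1) m
    have h2 := push_add f.src (fun _ => ((0 : ℕ) : ℤ) - 1) (fun _ => 1) m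
    have h3 : push f.src (fun _ => ((0 : ℕ) : ℤ) - 1 + 1) m = 0 := by simp [push]
    simp only [_root_.id] at h1 h2 ⊢
    linarith

theorem comp_cylinder (f : Surface X Y) : Homeo (comp f (cylinder Y)) f := by
  refine (comp_congr (homeo_of f) (Homeo.refl _)).trans (Homeo.trans ?_ (homeo_of f).symm)
  refine of_comp_of _root_.id f.tgt (fun _ => rfl) (fun m => Or.inl ⟨m, rfl⟩) ?_ (fun _ => rfl)
    (fun _ => rfl) ?_
  · intro T φ₁ φ₂ h
    exact ⟨φ₁, fun a => rfl, fun b => h b⟩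
  · intro m
    have h1 := push_injective _root_.id Function.injective_id (fun b => (f.genus b : ℤ) - 1) m
    have h2 := push_add f.tgt (fun _ => ((0 : ℕ) : ℤ) - 1) (fun _ => 1) m
    have h3 : push f.tgt (fun _ => ((0 : ℕ) : ℤ) - 1 + 1) m = 0 := by simp [push]
    simp only [_root_.id] at h1 h2 ⊢
    linarith

theorem comp_assoc (f : Surface X Y) (g : Surface Y Z) (h : Surface Z W) :
    Homeo (comp (comp f g) h) (comp f (comp g h)) := by
  let F : Fin f.n → Fin (comp f (comp g h)).n := fun i => cls f (comp g h) (Sum.inl i)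
  let G : Fin g.n → Fin (comp f (comp g h)).n := fun j =>
    cls f (comp g h) (Sum.inr (cls g h (Sum.inl j)))
  let H : Fin h.n → Fin (comp f (comp g h)).n := fun j =>
    cls f (comp g h) (Sum.inr (cls g h (Sum.inr j)))
  have hFG : ∀ y, F (f.tgt y) = G (g.src y) := fun y => cls_glue f (comp g h) y
  have hGH : ∀ z, G (g.tgt z) = H (h.src z) := fun z =>
    congrArg (fun a => cls f (comp g h) (Sum.inr a)) (cls_glue g h z)
  let F' : Fin f.n → Fin (comp (comp f g) h).n := fun i =>
    cls (comp f g) h (Sum.inl (cls f g (Sum.inl i)))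
  let G' : Fin g.n → Fin (comp (comp f g) h).n := fun j =>
    cls (comp f g) h (Sum.inl (cls f g (Sum.inr j)))
  let H' : Fin h.n → Fin (comp (comp f g) h).n := fun j => cls (comp f g) h (Sum.inr j)
  have hFG' : ∀ y, F' (f.tgt y) = G' (g.src y) := fun y =>
    congrArg (fun a => cls (comp f g) h (Sum.inl a)) (cls_glue f g y)
  have hGH' : ∀ z, G' (g.tgt z) = H' (h.src z) := fun z => cls_glue (comp f g) h z
  let q₁ := desc f g (Sum.elim F G) hFG
  let r₁ := desc g h (Sum.elim G' H') hGH'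
  have hq₁ : ∀ a, q₁ (cls f g a) = Sum.elim F G a := fun a => desc_cls _ _ _ _ a
  have hr₁ : ∀ a, r₁ (cls g h a) = Sum.elim G' H' a := fun a => desc_cls _ _ _ _ a
  refine comp_homeo' (Sum.elim q₁ H) (desc f (comp g h) (Sum.elim F' r₁) ?_) ?_ ?_ ?_ ?_ ?_ ?_
  · intro y
    change F' (f.tgt y) = r₁ (cls g h (Sum.inl (g.src y)))
    rw [hr₁]
    exact hFG' y
  · intro z
    change q₁ (cls f g (Sum.inr (g.tgt z))) = H (h.src z)
    rw [hq₁]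
    exact hGH z
  · intro k
    obtain ⟨a, rfl⟩ := cls_surjective f (comp g h) k
    rcases a with a | a
    · exact ⟨Sum.inl (cls f g (Sum.inl a)), hq₁ _⟩
    · obtain ⟨b, rfl⟩ := cls_surjective g h a
      rcases b with b | b
      · exact ⟨Sum.inl (cls f g (Sum.inr b)), hq₁ _⟩
      · exact ⟨Sum.inr b, rfl⟩
  · rintro (a | a)
    · obtain ⟨b, rfl⟩ := cls_surjective f g a
      rw [Sum.elim_inl, hq₁]
      rcases b with b | b
      · exact desc_cls _ _ _ _ _
      · refine (desc_cls _ _ _ _ _).trans ?_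
        rw [Sum.elim_inr, hr₁]
        rfl
    · refine (desc_cls _ _ _ _ _).trans ?_
      rw [Sum.elim_inr, hr₁]
      rfl
  · intro x
    exact hq₁ _
  · intro w
    rfl
  · rw [comp_genus]
    funext k
    have e1 : push (cls f (comp g h)) (fun a =>
        ((Sum.elim f.genus (comp g h).genus a : ℕ) : ℤ) - 1) k
        = push F (fun i => (f.genus i : ℤ) - 1) k
          + push (fun i => cls f (comp g h) (Sum.inr i))
            (fun i => ((comp g h).genus i : ℤ) - 1) k := push_sum _ _ _
    have e2 : push (Sum.elim q₁ H) (fun a =>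
        ((Sum.elim (comp f g).genus h.genus a : ℕ) : ℤ) - 1) k
        = push q₁ (fun i => ((comp f g).genus i : ℤ) - 1) k
          + push H (fun i => (h.genus i : ℤ) - 1) k := push_sum _ _ _
    have e3 : (push (fun i => cls f (comp g h) (Sum.inr i))
            (fun i => ((comp g h).genus i : ℤ) - 1) k)
        = push G (fun i => (g.genus i : ℤ) - 1) k + push H (fun i => (h.genus i : ℤ) - 1) k
          + push (fun z => G (g.tgt z)) (fun _ => 1) k := by
      rw [comp_genus, push_add, push_push, push_push, push_sum]
      rfl
    have e4 : push q₁ (fun i => ((comp f g).genus i : ℤ) - 1) k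
        = push F (fun i => (f.genus i : ℤ) - 1) k + push G (fun i => (g.genus i : ℤ) - 1) k
          + push (fun y => F (f.tgt y)) (fun _ => 1) k := by
      rw [comp_genus, push_add, push_push, push_push, push_sum]
      have : q₁ ∘ cls f g = Sum.elim F G := funext hq₁
      simp only [this]
      congr 2
      funext y
      exact hq₁ _
    have e5 : (fun z => Sum.elim q₁ H (Sum.inl ((comp f g).tgt z))) = fun z => G (g.tgt z) := by
      funext z
      exact hq₁ _
    rw [e1, e2, e3, e4, e5]
    have e6 : (fun y => cls f (comp g h) (Sum.inl (f.tgt y))) = fun y => F (f.tgt y) := rfl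
    rw [e6]
    ring

end Surface

/-- The category of flat `1-1` tangles and cobordisms up to homeomorphism relative to the boundary. -/
noncomputable instance : Category Tangle where
  Hom X Y := Quotient (Surface.setoid X Y)
  id X := Quotient.mk _ (Surface.cylinder X)
  comp := Quotient.map₂ Surface.comp fun _ _ hf _ _ hg => Surface.comp_congr hf hg
  id_comp := by rintro X Y ⟨f⟩; exact Quotient.sound (Surface.cylinder_comp f)
  comp_id := by rintro X Y ⟨f⟩; exact Quotient.sound (Surface.comp_cylinder f)
  assoc := by rintro X Y Z W ⟨f⟩ ⟨g⟩ ⟨h⟩; exact Quotient.sound (Surface.comp_assoc f g h)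

namespace Surface

variable {X Y : Tangle}

/-- The number of boundary circles of a component: one for each circle of the source or target on it,
and one for the curtain, the boundary circle of which consists of the two special lines and two
vertical segments. -/
noncomputable def boundaryCount (f : Surface X Y) (k : Fin f.n) : ℕ :=
  Nat.card {x : X.comps // x ≠ X.line ∧ f.src x = k}
    + Nat.card {y : Y.comps // y ≠ Y.line ∧ f.tgt y = k} + if k = f.src X.line then 1 else 0

/-- Euler characteristic. -/
noncomputable def euler (f : Surface X Y) : ℤ :=
  ∑ k, (2 - 2 * (f.genus k : ℤ) - f.boundaryCount k)

/-- The degree `χ - |B| / 2`, where `|B| = 2` is the number of end points of a `1-1` tangle, corrected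
by the shifts of source and target. -/
noncomputable def degree (f : Surface X Y) : ℤ := f.euler - 1 + (Y.shift - X.shift)

/-- The disjoint union of `f` and a closed connected surface of genus `g`. -/
noncomputable def addClosed (f : Surface X Y) (g : ℕ) : Surface X Y :=
  of (Option (Fin f.n)) (fun x => some (f.src x)) (fun y => some (f.tgt y))
    (congrArg some f.curtain) fun k => k.elim g f.genus

/-- Remove two disjoint discs from the components `i` and `j` of `f` (which may be equal) and join the
two boundary circles by a tube. If `i = j`, the genus goes up by one, otherwise the two components
become one, and their genera are added. -/
noncomputable def tube (f : Surface X Y) (i j : Fin f.n) : Surface X Y :=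
  letI : Fintype (Quot fun a b : Fin f.n => a = i ∧ b = j) := Fintype.ofFinite _
  of (Quot fun a b : Fin f.n => a = i ∧ b = j) (fun x => Quot.mk _ (f.src x))
    (fun y => Quot.mk _ (f.tgt y)) (congrArg _ f.curtain) fun K =>
    open scoped Classical in
    (∑ k, if Quot.mk _ k = K then f.genus k else 0) + if i = j ∧ Quot.mk _ i = K then 1 else 0

/-- The morphism of the `ℤ`-linear cobordism category given by a surface. -/
noncomputable def toFree (f : Surface X Y) :
    (Free.embedding ℤ Tangle).obj X ⟶ (Free.embedding ℤ Tangle).obj Y :=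
  (Free.embedding ℤ Tangle).map (Quotient.mk (setoid X Y) f)

end Surface

/-- The ideal of the `ℤ`-linear cobordism category generated by the relations S (a surface with a
spherical component is zero), T (a torus component is worth a factor two) and 4TU (if four discs are
chosen on a surface, on components `k₁, …, k₄`, then the surfaces with tubes attached satisfy
`C₁₂ + C₃₄ = C₁₃ + C₂₄`). -/
inductive Negligible : ∀ {X Y : Free ℤ Tangle}, (X ⟶ Y) → Prop
  | sphere {X Y : Tangle} (f : Surface X Y) : Negligible (f.addClosed 0).toFree
  | torus {X Y : Tangle} (f : Surface X Y) :
      Negligible ((f.addClosed 1).toFree - (f.toFree + f.toFree))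
  | fourTube {X Y : Tangle} (f : Surface X Y) (k₁ k₂ k₃ k₄ : Fin f.n) :
      Negligible (((f.tube k₁ k₂).toFree + (f.tube k₃ k₄).toFree)
        - ((f.tube k₁ k₃).toFree + (f.tube k₂ k₄).toFree))
  | zero (X Y : Free ℤ Tangle) : Negligible (0 : X ⟶ Y)
  | add {X Y : Free ℤ Tangle} {a b : X ⟶ Y} : Negligible a → Negligible b → Negligible (a + b)
  | neg {X Y : Free ℤ Tangle} {a : X ⟶ Y} : Negligible a → Negligible (-a)
  | comp_left {X Y Z : Free ℤ Tangle} (a : X ⟶ Y) {b : Y ⟶ Z} : Negligible b → Negligible (a ≫ b)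
  | comp_right {X Y Z : Free ℤ Tangle} {a : X ⟶ Y} (b : Y ⟶ Z) :
      Negligible a → Negligible (a ≫ b)

/-- Congruence modulo the local relations. -/
def localRel : HomRel (Free ℤ Tangle) := fun _ _ a b => Negligible (a - b)

instance : Congruence localRel where
  equivalence :=
    { refl := fun a => by
        rw [localRel, sub_self]
        exact Negligible.zero _ _
      symm := fun {a b} h => by
        have := Negligible.neg h
        rwa [neg_sub] at this
      trans := fun {a b c} h h' => by
        have := Negligible.add h h'
        rwa [sub_add_sub_cancel] at this }
  comp_left := fun {_ _ _} a {b c} h => by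
    have := Negligible.comp_left a h
    rwa [Preadditive.comp_sub] at this
  comp_right := fun {_ _ _} {a b} c h => by
    have := Negligible.comp_right c h
    rwa [Preadditive.sub_comp] at this

/-- The `ℤ`-linear cobordism category modulo the relations S, T and 4TU. -/
noncomputable abbrev Cobl : Type 1 := CategoryTheory.Quotient localRel

noncomputable instance : Preadditive Cobl :=
  CategoryTheory.Quotient.preadditive localRel fun _ _ a b c d h h' => by
    have := Negligible.add h h'
    rwa [sub_add_sub_comm] at this

/-- The functor from cobordisms to their classes modulo the local relations. -/
noncomputable def toCobl : Tangle ⥤ Cobl :=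
  Free.embedding ℤ Tangle ⋙ CategoryTheory.Quotient.functor localRel

/-- A flat tangle as an object of `Cobl`. -/
noncomputable abbrev ob (X : Tangle) : Cobl := toCobl.obj X

/-- The flat tangle which an object of `Cobl` consists of. -/
abbrev Cobl.tangle (A : Cobl) : Tangle := A.as

/-- The morphism of `Cobl` represented by a surface. -/
noncomputable def Surface.mor {X Y : Tangle} (f : Surface X Y) : ob X ⟶ ob Y :=
  toCobl.map (Quotient.mk (Surface.setoid X Y) f)

theorem Surface.mor_eq {X Y : Tangle} {f f' : Surface X Y} (h : Surface.Homeo f f') :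
    f.mor = f'.mor :=
  congrArg toCobl.map (Quotient.sound h)

theorem Surface.mor_comp {X Y Z : Tangle} (f : Surface X Y) (g : Surface Y Z) :
    f.mor ≫ g.mor = (Surface.comp f g).mor :=
  (toCobl.map_comp (Quotient.mk (Surface.setoid X Y) f) (Quotient.mk (Surface.setoid Y Z) g)).symm

theorem Surface.mor_cylinder (X : Tangle) : (Surface.cylinder X).mor = 𝟙 (ob X) :=
  toCobl.map_id X

/-- A morphism of `Cobl` is homogeneous of degree `d` if it is a combination of surfaces of degree `d`. -/
def IsHomogeneous (d : ℤ) {A B : Cobl} (a : A ⟶ B) : Prop :=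
  a ∈ AddSubgroup.closure {b : A ⟶ B | ∃ f : Surface A.tangle B.tangle, f.degree = d ∧ f.mor = b}

/-- A matrix of morphisms all of whose entries are homogeneous of degree zero. -/
def DegreeZero {A B : Mat_ Cobl} (a : A ⟶ B) : Prop := ∀ i j, IsHomogeneous 0 (a i j)

/-- The special line without circles, with degree shift `m`. -/
def lineTangle (m : ℤ) : Tangle where
  comps := Unit
  line := ()
  shift := m

/-- The curtain with `k` handles. -/
noncomputable def curtain (m m' : ℤ) (k : ℕ) : Surface (lineTangle m) (lineTangle m') :=
  Surface.of Unit (fun _ => ()) (fun _ => ()) rfl fun _ => k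

theorem curtain_zero (m : ℤ) : (curtain m m 0).mor = 𝟙 (ob (lineTangle m)) :=
  Surface.mor_cylinder _

theorem curtain_comp (m m' m'' : ℤ) (k l : ℕ) :
    (curtain m m' k).mor ≫ (curtain m' m'' l).mor = (curtain m m'' (k + l)).mor := by
  rw [Surface.mor_comp]
  refine Surface.mor_eq (Surface.of_comp_of id id (fun _ => rfl) (fun _ => Or.inl ⟨(), rfl⟩)
    (fun φ₁ φ₂ h => ⟨φ₁, fun _ => rfl, fun b => h b⟩) (fun _ => rfl) (fun _ => rfl) fun m => ?_)
  have h : Fintype.card (lineTangle m').comps = 1 := rfl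
  simp [push, h]
  ring

/-- The combination of curtains given by a polynomial in `H`, where `H` stands for a handle. -/
noncomputable def polyMor (m m' : ℤ) : Polynomial ℤ →+ (ob (lineTangle m) ⟶ ob (lineTangle m')) where
  toFun p := p.sum fun k a => a • (curtain m m' k).mor
  map_zero' := Polynomial.sum_zero_index _
  map_add' p q := Polynomial.sum_add_index p q _ (fun _ => zero_smul _ _) fun _ _ _ => add_smul _ _ _

theorem polyMor_monomial (m m' : ℤ) (k : ℕ) (a : ℤ) :
    polyMor m m' (Polynomial.monomial k a) = a • (curtain m m' k).mor :=
  Polynomial.sum_monomial_index a (fun k a => a • (curtain m m' k).mor) (zero_smul _ _)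

theorem polyMor_mul (m m' m'' : ℤ) (p q : Polynomial ℤ) :
    polyMor m m' p ≫ polyMor m' m'' q = polyMor m m'' (p * q) := by
  induction p using Polynomial.induction_on' with
  | add p p' h h' => rw [map_add, Preadditive.add_comp, h, h', add_mul, map_add]
  | monomial k a =>
    induction q using Polynomial.induction_on' with
    | add q q' h h' => rw [map_add, Preadditive.comp_add, h, h', mul_add, map_add]
    | monomial l b =>
      rw [Polynomial.monomial_mul_monomial, polyMor_monomial, polyMor_monomial, polyMor_monomial,
        Preadditive.zsmul_comp, Preadditive.comp_zsmul, curtain_comp, smul_smul]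

theorem polyMor_one (m : ℤ) : polyMor m m 1 = 𝟙 (ob (lineTangle m)) := by
  rw [← Polynomial.monomial_zero_one, polyMor_monomial, one_smul, curtain_zero]

/-- A free graded `ℤ[H]`-module of finite rank with a homogeneous basis indexed by `ι`; the basis vector
`i` is shifted by `shift i`. The polynomial ring is `Polynomial ℤ`, with variable `H`. -/
structure FreeModule : Type 1 where
  ι : Type
  [fintype : Fintype ι]
  shift : ι → ℤ

attribute [instance] FreeModule.fintype

/-- The underlying `ℤ[H]`-module. -/
abbrev FreeModule.carrier (M : FreeModule) : Type := M.ι → Polynomial ℤ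

noncomputable instance : Category FreeModule where
  Hom M N := M.carrier →ₗ[Polynomial ℤ] N.carrier
  id M := LinearMap.id
  comp f g := g.comp f

noncomputable instance : Preadditive FreeModule where
  homGroup M N := inferInstanceAs (AddCommGroup (M.carrier →ₗ[Polynomial ℤ] N.carrier))
  add_comp _ _ _ f f' g := LinearMap.comp_add f f' g
  comp_add _ _ _ f g g' := LinearMap.add_comp f g' g

open scoped Classical in
/-- The entry, in column `i` and row `j`, of the matrix of a linear map. -/
noncomputable def FreeModule.entry {M N : FreeModule}
    (f : M.carrier →ₗ[Polynomial ℤ] N.carrier) (i : M.ι) (j : N.ι) : Polynomial ℤ :=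
  f (Pi.single i 1) j

open scoped Classical in
theorem FreeModule.entry_id (M : FreeModule) (i j : M.ι) :
    FreeModule.entry (M := M) (N := M) LinearMap.id i j = if i = j then 1 else 0 := by
  change (Pi.single i 1 : M.carrier) j = _
  rw [Pi.single_apply]
  exact if_congr eq_comm rfl rfl

theorem FreeModule.entry_comp {L M N : FreeModule} (f : L.carrier →ₗ[Polynomial ℤ] M.carrier)
    (g : M.carrier →ₗ[Polynomial ℤ] N.carrier) (i : L.ι) (k : N.ι) :
    FreeModule.entry (g.comp f) i k = ∑ j, FreeModule.entry f i j * FreeModule.entry g j k := by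
  classical
  unfold FreeModule.entry
  rw [LinearMap.comp_apply]
  conv_lhs => rw [pi_eq_sum_univ (f (Pi.single i 1)), map_sum]
  rw [Finset.sum_apply]
  refine Finset.sum_congr rfl fun j _ => ?_
  rw [map_smul, Pi.smul_apply, smul_eq_mul]
  congr 2
  refine congrFun (congrArg g (funext fun j' => ?_)) k
  rw [Pi.single_apply]
  exact if_congr eq_comm rfl rfl

/-- The column of special lines which corresponds to a based free module. -/
noncomputable def FreeModule.lines (M : FreeModule) : Mat_ Cobl where
  ι := M.ι
  X i := ob (lineTangle (M.shift i))

/-- Free modules as columns of special lines: the indeterminate `H` acts by adding a handle to the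
curtain. -/
noncomputable def realize : FreeModule ⥤ Mat_ Cobl where
  obj M := M.lines
  map {M N} f := fun i j => polyMor (M.shift i) (N.shift j) (FreeModule.entry f i j)
  map_id M := by
    classical
    funext i j
    refine (congrArg (polyMor _ _) (FreeModule.entry_id M i j)).trans ?_
    split_ifs with h
    · subst h
      exact (polyMor_one _).trans (Mat_.id_apply_self M.lines i).symm
    · exact (map_zero _).trans (Mat_.id_apply_of_ne M.lines i j h).symm
  map_comp {L M N} f g := by
    funext i k
    refine (congrArg (polyMor _ _) (FreeModule.entry_comp f g i k)).trans ?_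
    rw [map_sum]
    exact Finset.sum_congr rfl fun j _ => (polyMor_mul _ _ _ _ _).symm

instance : realize.Additive where
  map_add {M N f g} := by
    funext i j
    exact map_add (polyMor _ _) _ _

section Delooping

variable (X : Tangle) (c : X.comps) (hc : c ≠ X.line)

/-- The tangle `X` without its circle `c`, with an additional degree shift `m`. -/
noncomputable def erase (m : ℤ) : Tangle :=
  letI : Fintype {a // a ≠ c} := Fintype.ofFinite _
  { comps := {a // a ≠ c}
    line := ⟨X.line, hc.symm⟩
    shift := X.shift + m }

/-- The circle `c` is closed by a disc; all the rest is a product. -/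
noncomputable def cap (m : ℤ) : Surface X (erase X c hc m) :=
  Surface.of X.comps id Subtype.val rfl fun _ => 0

/-- The circle `c` is created by a disc; all the rest is a product. -/
noncomputable def cup (m : ℤ) : Surface (erase X c hc m) X :=
  Surface.of X.comps Subtype.val id rfl fun _ => 0

open scoped Classical in
/-- The map which sends the circle `c` to the special line and fixes all other components. -/
noncomputable def collapse (m : ℤ) (a : X.comps) : (erase X c hc m).comps :=
  if h : a = c then (erase X c hc m).line else ⟨a, h⟩

theorem collapse_line (m : ℤ) : collapse X c hc m X.line = (erase X c hc m).line :=
  dif_neg hc.symm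

/-- The dotted cap: the circle `c` is closed by a disc which a neck connects to the curtain; all the
rest is a product. -/
noncomputable def dottedCap (m : ℤ) : Surface X (erase X c hc m) :=
  Surface.of (erase X c hc m).comps (collapse X c hc m) id (collapse_line X c hc m) fun _ => 0

/-- The dotted cup: the circle `c` is created by a disc which a neck connects to the curtain; all the
rest is a product. -/
noncomputable def dottedCup (m : ℤ) : Surface (erase X c hc m) X :=
  Surface.of (erase X c hc m).comps id (collapse X c hc m) (collapse_line X c hc m).symm fun _ => 0

open scoped Classical in
/-- The operator `H`: the product cobordism with a handle added to the curtain. -/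
noncomputable def handle : Surface X X :=
  Surface.of X.comps id id rfl fun k => if k = X.line then 1 else 0

/-- The column of two copies of `X` without its circle `c`, with degree shifts `-1` (row `false`) and
`+1` (row `true`). -/
noncomputable def circleColumn : Mat_ Cobl where
  ι := Bool
  X b := ob (erase X c hc (if b then 1 else -1))

end Delooping

/-- A choice of at most one non-special circle of an object: `none` leaves the object alone. -/
abbrev Choice (A : Cobl) : Type := Option {c : A.tangle.comps // c ≠ A.tangle.line}

/-- The rows of the column which replaces an object after delooping the chosen circle. -/
def Choice.Index {A : Cobl} : Choice A → Type
  | none => Unit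
  | some _ => Bool

noncomputable instance {A : Cobl} : (o : Choice A) → Fintype o.Index
  | none => inferInstanceAs (Fintype Unit)
  | some _ => inferInstanceAs (Fintype Bool)

/-- The column which replaces an object: if a circle is chosen, the object without this circle, once
with shift `-1` (row `false`) and once with shift `+1` (row `true`). -/
noncomputable def Choice.column {A : Cobl} : (o : Choice A) → o.Index → Cobl
  | none, _ => A
  | some c, false => ob (erase A.tangle c.1 c.2 (-1))
  | some c, true => ob (erase A.tangle c.1 c.2 1)

/-- The delooping map: the cap in row `false`, the dotted cap minus `H` times the cap in row
`true`. -/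
noncomputable def Choice.hom {A : Cobl} : (o : Choice A) → (j : o.Index) → (A ⟶ o.column j)
  | none, _ => 𝟙 A
  | some c, false => (cap A.tangle c.1 c.2 (-1)).mor
  | some c, true => (dottedCap A.tangle c.1 c.2 1).mor
      - (cap A.tangle c.1 c.2 1).mor ≫ (handle (erase A.tangle c.1 c.2 1)).mor

/-- The inverse of delooping: the dotted cup on row `false`, the cup on row `true`. -/
noncomputable def Choice.inv {A : Cobl} : (o : Choice A) → (j : o.Index) → (o.column j ⟶ A)
  | none, _ => 𝟙 A
  | some c, false => (dottedCup A.tangle c.1 c.2 (-1)).mor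
  | some c, true => (cup A.tangle c.1 c.2 1).mor

variable (M : Mat_ Cobl)

/-- The column in which the chosen circles of the entries of `M` have been delooped. -/
noncomputable def deloop (o : ∀ i, Choice (M.X i)) : Mat_ Cobl where
  ι := Σ i, (o i).Index
  X j := (o j.1).column j.2

open scoped Classical in
/-- Delooping of chosen circles in a column, a block diagonal matrix. -/
noncomputable def deloopHom (o : ∀ i, Choice (M.X i)) : M ⟶ deloop M o := fun i j =>
  if h : i = j.1 then eqToHom (congrArg M.X h) ≫ (o j.1).hom j.2 else 0

open scoped Classical in
/-- The inverse of the delooping of chosen circles, a block diagonal matrix. -/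
noncomputable def deloopInv (o : ∀ i, Choice (M.X i)) : deloop M o ⟶ M := fun j i =>
  if h : j.1 = i then (o j.1).inv j.2 ≫ eqToHom (congrArg M.X h) else 0

/-- The column in which each entry of `M` with `k` circles has been replaced by the `2 ^ k` special
lines without circles, indexed by the choice of a sign `±1` for each circle and shifted by the sum of
these signs. -/
noncomputable def deloopAll : Mat_ Cobl :=
  letI (i : M.ι) : Fintype ({c : (M.X i).tangle.comps // c ≠ (M.X i).tangle.line} → Bool) :=
    Fintype.ofFinite _
  letI (i : M.ι) : Fintype {c : (M.X i).tangle.comps // c ≠ (M.X i).tangle.line} :=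
    Fintype.ofFinite _
  { ι := Σ i, ({c : (M.X i).tangle.comps // c ≠ (M.X i).tangle.line} → Bool)
    X j := ob (lineTangle ((M.X j.1).tangle.shift + ∑ c, if j.2 c then 1 else -1)) }

section Orbits

variable {A : Type} [Fintype A]

noncomputable instance quotFintype (R : A → A → Prop) : Fintype (Quot R) := Fintype.ofFinite _

/-- If `R'` is the equivalence relation generated by `R` and one further pair, passing to the
quotient by `R'` merges at most two classes. -/
theorem sum_quot_merge (R R' : A → A → Prop) (x y : A) (f : Quot R → Quot R')
    (hf : ∀ a, f (Quot.mk _ a) = Quot.mk _ a) (hxy : Quot.mk R' x = Quot.mk R' y)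
    (hR' : ∀ φ : A → Quot R, (∀ a b, R a b → φ a = φ b) → φ x = φ y → ∀ a b, R' a b → φ a = φ b)
    (φ : Quot R' → ℤ) [Decidable (Quot.mk R x = Quot.mk R y)] :
    ∑ c, φ (f c) = ∑ c, φ c + if Quot.mk R x = Quot.mk R y then 0 else φ (Quot.mk _ x) := by
  classical
  let h : Quot R → Quot R := fun c => if c = Quot.mk R y then Quot.mk R x else c
  have hmk : ∀ a b, R a b → h (Quot.mk R a) = h (Quot.mk R b) := fun a b hab => by
    rw [Quot.sound hab]
  have hx : h (Quot.mk R x) = h (Quot.mk R y) := by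
    simp only [h]
    split_ifs <;> rfl
  let g : Quot R' → Quot R := Quot.lift (fun a => h (Quot.mk R a)) (hR' _ hmk hx)
  have hgf : ∀ c, g (f c) = h c := by
    rintro ⟨a⟩
    rw [hf]
  have hfh : ∀ c, f (h c) = f c := by
    intro c
    simp only [h]
    split_ifs with hc
    · rw [hc, hf, hf, hxy]
    · rfl
  have hfg : ∀ c, f (g c) = c := by
    rintro ⟨a⟩
    change f (h (Quot.mk R a)) = _
    rw [hfh, hf]
  split_ifs with heq
  · have hid : ∀ c, h c = c := by
      intro c
      simp only [h]
      split_ifs with hc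
      · rw [hc, heq]
      · rfl
    let e : Quot R ≃ Quot R' := ⟨f, g, fun c => (hgf c).trans (hid c), hfg⟩
    rw [add_zero]
    exact Equiv.sum_comp e φ
  · have h1 : ∑ c, φ (f c) = φ (f (Quot.mk R y)) + ∑ c ∈ Finset.univ.erase (Quot.mk R y), φ (f c) :=
      (Finset.add_sum_erase _ (fun c => φ (f c)) (Finset.mem_univ _)).symm
    rw [h1, hf, ← hxy, add_comm]
    congr 1
    refine Finset.sum_bij' (fun c _ => f c) (fun c _ => g c) (fun _ _ => Finset.mem_univ _) ?_ ?_
      (fun c _ => hfg c) (fun _ _ => rfl)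
    · intro c _
      refine Finset.mem_erase.2 ⟨?_, Finset.mem_univ _⟩
      induction c using Quot.ind with
      | mk a =>
        change h (Quot.mk R a) ≠ _
        simp only [h]
        split_ifs with hc
        · exact heq
        · exact hc
    · intro c hc
      rw [hgf]
      exact if_neg (Finset.mem_erase.1 hc).1

/-- The number of classes of the equivalence relation generated by `R`. -/
noncomputable def numClasses (R : A → A → Prop) : ℕ := Nat.card (Quot R)

theorem numClasses_merge (R R' : A → A → Prop) (x y : A)
    (hR : ∀ a b, R a b → Quot.mk R' a = Quot.mk R' b) (hxy : Quot.mk R' x = Quot.mk R' y)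
    (hR' : ∀ φ : A → Quot R, (∀ a b, R a b → φ a = φ b) → φ x = φ y → ∀ a b, R' a b → φ a = φ b)
    [Decidable (Quot.mk R x = Quot.mk R y)] :
    numClasses R = numClasses R' + if Quot.mk R x = Quot.mk R y then 0 else 1 := by
  have h := sum_quot_merge R R' x y (Quot.lift _ hR) (fun _ => rfl) hxy hR' (fun _ => 1)
  simp only [Finset.sum_const, Finset.card_univ, nsmul_eq_mul, mul_one] at h
  unfold numClasses
  rw [Nat.card_eq_fintype_card, Nat.card_eq_fintype_card]
  have : ((if Quot.mk R x = Quot.mk R y then (0 : ℕ) else 1 : ℕ) : ℤ)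
    = if Quot.mk R x = Quot.mk R y then 0 else 1 := by split_ifs <;> rfl
  rw [← this] at h
  exact_mod_cast h

/-- The relation whose classes are the orbits of a permutation. -/
def Step (σ : Equiv.Perm A) (a b : A) : Prop := b = σ a

theorem mk_apply {B : Type} (σ : Equiv.Perm B) (a : B) :
    Quot.mk (Step σ) a = Quot.mk (Step σ) (σ a) :=
  Quot.sound (show σ a = σ a from rfl)

theorem mk_pow {B : Type} (σ : Equiv.Perm B) (k : ℕ) (a : B) :
    Quot.mk (Step σ) ((σ ^ k) a) = Quot.mk (Step σ) a := by
  induction k with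
  | zero => rfl
  | succ k ih =>
    rw [← ih, pow_succ', Equiv.Perm.mul_apply]
    exact (mk_apply σ _).symm

theorem exists_pow (σ : Equiv.Perm A) {a b : A} (h : Quot.mk (Step σ) a = Quot.mk (Step σ) b) :
    ∃ k : ℕ, 0 < k ∧ (σ ^ k) a = b := by
  have h1 : σ.SameCycle a b := by
    have := congrArg (Quot.lift (fun c => σ.SameCycle a c) fun c d (hcd : d = σ c) => by
      rw [hcd]; exact propext Equiv.Perm.sameCycle_apply_right.symm) h
    exact this.mp (Equiv.Perm.SameCycle.refl _ _)
  obtain ⟨k, hk, _, h⟩ := h1.exists_pow_eq'' (f := σ)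
  exact ⟨k, hk, h⟩

theorem swap_joins [DecidableEq A] (σ : Equiv.Perm A) (x y : A)
    (h : Quot.mk (Step σ) x ≠ Quot.mk (Step σ) y) :
    Quot.mk (Step (σ * Equiv.swap x y)) x = Quot.mk (Step (σ * Equiv.swap x y)) y := by
  set f := σ * Equiv.swap x y with hf
  have hfx : f x = σ y := by simp [hf]
  by_contra hne
  have key : ∀ k : ℕ, Quot.mk (Step f) ((σ ^ (k + 1)) y) = Quot.mk (Step f) x := by
    intro k
    induction k with
    | zero =>
      rw [zero_add, pow_one, ← hfx]
      exact (mk_apply f x).symm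
    | succ k ih =>
      have h1 : (σ ^ (k + 1)) y ≠ y := fun h' => hne (by rw [← ih, h'])
      have h2 : (σ ^ (k + 1)) y ≠ x := fun h' => h (by rw [← h', mk_pow])
      have h3 : f ((σ ^ (k + 1)) y) = (σ ^ (k + 1 + 1)) y := by
        rw [hf, Equiv.Perm.mul_apply, Equiv.swap_apply_of_ne_of_ne h2 h1, pow_succ' σ (k + 1),
          Equiv.Perm.mul_apply]
      rw [← h3, ← ih]
      exact (mk_apply f _).symm
  obtain ⟨k, hk, h1⟩ := exists_pow σ (a := y) (b := y) rfl
  obtain ⟨k, rfl⟩ := Nat.exists_eq_succ_of_ne_zero hk.ne'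
  have := key k
  rw [h1] at this
  exact hne this.symm

theorem swap_splits [DecidableEq A] (σ : Equiv.Perm A) (x y : A) (hxy : x ≠ y)
    (h : Quot.mk (Step σ) x = Quot.mk (Step σ) y) :
    Quot.mk (Step (σ * Equiv.swap x y)) x ≠ Quot.mk (Step (σ * Equiv.swap x y)) y := by
  set f := σ * Equiv.swap x y with hf
  have hfy : f y = σ x := by simp [hf]
  have hex := exists_pow σ h
  classical
  obtain ⟨hk0, hk⟩ := Nat.find_spec hex
  set k := Nat.find hex with hkdef
  have hmin : ∀ m, 0 < m → m < k → (σ ^ m) x ≠ y := fun m h0 hm h' =>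
    Nat.find_min hex hm ⟨h0, h'⟩
  have hx : ∀ m, 0 < m → m ≤ k → (σ ^ m) x ≠ x := by
    intro m h0 hm h'
    rcases hm.lt_or_eq with hm | rfl
    · refine hmin (k - m) (by omega) (by omega) ?_
      have : (σ ^ (k - m)) ((σ ^ m) x) = y := by
        rw [← Equiv.Perm.mul_apply, ← pow_add, Nat.sub_add_cancel hm.le, hk]
      rwa [h'] at this
    · exact hxy (h'.symm.trans hk)
  intro hsame
  obtain ⟨m, hm0, hm⟩ := exists_pow f hsame.symm
  have key : ∀ m : ℕ, ∃ i, 0 < i ∧ i ≤ k ∧ (f ^ m) y = (σ ^ i) x := by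
    intro m
    induction m with
    | zero => exact ⟨k, hk0, le_rfl, hk.symm⟩
    | succ m ih =>
      obtain ⟨i, h0, h1, h2⟩ := ih
      rw [pow_succ', Equiv.Perm.mul_apply, h2]
      rcases h1.lt_or_eq with h1 | rfl
      · refine ⟨i + 1, by omega, by omega, ?_⟩
        rw [hf, Equiv.Perm.mul_apply, Equiv.swap_apply_of_ne_of_ne (hx i h0 h1.le) (hmin i h0 h1),
          pow_succ' σ i, Equiv.Perm.mul_apply]
      · exact ⟨1, by omega, by omega, by rw [hk, hfy, pow_one]⟩
  obtain ⟨i, h0, h1, h2⟩ := key m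
  exact hx i h0 h1 (h2.symm.trans hm)

/-- `σ * swap _ _ * ⋯ * swap _ _`. -/
def mulSwaps [DecidableEq A] (σ : Equiv.Perm A) : List (A × A) → Equiv.Perm A
  | [] => σ
  | p :: l => mulSwaps σ l * Equiv.swap p.1 p.2

theorem mulSwaps_mk {B : Type} [DecidableEq B] (σ : Equiv.Perm B) (l : List (B × B))
    (R : B → B → Prop)
    (hσ : ∀ a, Quot.mk R a = Quot.mk R (σ a)) (hl : ∀ p ∈ l, Quot.mk R p.1 = Quot.mk R p.2)
    (a : B) : Quot.mk R a = Quot.mk R (mulSwaps σ l a) := by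
  induction l generalizing a with
  | nil => exact hσ a
  | cons p l ih =>
    have ih' := ih (fun q hq => hl q (List.mem_cons_of_mem _ hq))
    have hp := hl p (List.mem_cons_self)
    rw [mulSwaps, Equiv.Perm.mul_apply, ← ih']
    by_cases h1 : a = p.1
    · rw [h1, Equiv.swap_apply_left, hp]
    · by_cases h2 : a = p.2
      · rw [h2, Equiv.swap_apply_right, hp]
      · rw [Equiv.swap_apply_of_ne_of_ne h1 h2]

/-- Non-negativity of the genus, for a product of transpositions. -/
theorem genus_nonneg_list [DecidableEq A] (σ : Equiv.Perm A) (l : List (A × A)) :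
    numClasses (Step σ) + numClasses (Step (mulSwaps σ l))
      ≤ l.length + 2 * numClasses fun a b => b = σ a ∨ (a, b) ∈ l := by
  classical
  induction l with
  | nil =>
    have : (fun a b => b = σ a ∨ (a, b) ∈ ([] : List (A × A))) = Step σ := by
      funext a b
      simp [Step]
    rw [this, mulSwaps]
    simp only [List.length_nil]
    omega
  | cons p l ih =>
    obtain ⟨x, y⟩ := p
    set O : A → A → Prop := fun a b => b = σ a ∨ (a, b) ∈ l with hO
    set O' : A → A → Prop := fun a b => b = σ a ∨ (a, b) ∈ (x, y) :: l with hO'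
    set φ := mulSwaps σ l with hφ
    have hφ' : mulSwaps σ ((x, y) :: l) = φ * Equiv.swap x y := rfl
    rw [hφ']
    have hOm := numClasses_merge O O' x y
      (fun a b hab => Quot.sound (hab.imp id (List.mem_cons_of_mem _)))
      (Quot.sound (Or.inr List.mem_cons_self)) (by
        rintro ψ h1 h2 a b (h | h)
        · exact h1 a b (Or.inl h)
        · rcases List.mem_cons.1 h with h | h
          · rw [Prod.mk.injEq] at h
            rw [h.1, h.2, h2]
          · exact h1 a b (Or.inr h))
    let J : A → A → Prop := fun a b => b = φ a ∨ (a = x ∧ b = y)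
    have hJ1 := numClasses_merge (Step φ) J x y (fun a b hab => Quot.sound (Or.inl hab))
      (Quot.sound (Or.inr ⟨rfl, rfl⟩)) (by
        rintro ψ h1 h2 a b (h | ⟨rfl, rfl⟩)
        · exact h1 a b h
        · exact h2)
    have hJxy : Quot.mk J x = Quot.mk J y := Quot.sound (Or.inr ⟨rfl, rfl⟩)
    have hJφ : ∀ a, Quot.mk J (φ a) = Quot.mk J a := fun a =>
      (Quot.sound (show J a (φ a) from Or.inl rfl)).symm
    have hJsw : ∀ a, Quot.mk J (Equiv.swap x y a) = Quot.mk J a := by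
      intro a
      by_cases h1 : a = x
      · rw [h1, Equiv.swap_apply_left, hJxy]
      · by_cases h2 : a = y
        · rw [h2, Equiv.swap_apply_right, hJxy]
        · rw [Equiv.swap_apply_of_ne_of_ne h1 h2]
    have hJ2 := numClasses_merge (Step (φ * Equiv.swap x y)) J x y
      (fun a b hab => by
        rw [hab, Equiv.Perm.mul_apply, hJφ, hJsw])
      hJxy (by
        rintro ψ h1 h2 a b (h | ⟨rfl, rfl⟩)
        · have hsw : ψ (Equiv.swap x y a) = ψ a := by
            by_cases h1 : a = x
            · rw [h1, Equiv.swap_apply_left, h2]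
            · by_cases h2' : a = y
              · rw [h2', Equiv.swap_apply_right, h2]
              · rw [Equiv.swap_apply_of_ne_of_ne h1 h2']
          rw [← hsw, h]
          refine h1 _ _ ?_
          rw [Step, Equiv.Perm.mul_apply, Equiv.swap_apply_self]
        · exact h2)
    have hOφ : ∀ a b, Step φ a b → Quot.mk O a = Quot.mk O b := by
      rintro a b rfl
      exact mulSwaps_mk σ l O (fun a => Quot.sound (Or.inl rfl))
        (fun p hp => Quot.sound (Or.inr hp)) a
    rw [List.length_cons]
    by_cases hOxy : Quot.mk O x = Quot.mk O y
    · rw [if_pos hOxy] at hOm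
      have : (if Quot.mk (Step (φ * Equiv.swap x y)) x = Quot.mk (Step (φ * Equiv.swap x y)) y
        then 0 else 1) ≤ 1 := by split_ifs <;> omega
      omega
    · have h1 : Quot.mk (Step φ) x ≠ Quot.mk (Step φ) y := fun h =>
        hOxy (congrArg (Quot.lift _ hOφ) h)
      have h2 := swap_joins φ x y h1
      rw [if_neg hOxy] at hOm
      rw [if_neg h1] at hJ1
      rw [if_pos h2] at hJ2
      omega

theorem exists_swaps [DecidableEq A] (α : Equiv.Perm A) (hα : ∀ a, α (α a) = a) :
    ∃ l : List (A × A), (∀ p ∈ l, p.2 = α p.1 ∧ α p.1 ≠ p.1) ∧ (∀ σ, mulSwaps σ l = σ * α) ∧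
      2 * l.length = α.support.card := by
  induction h : α.support.card using Nat.strong_induction_on generalizing α with
  | _ N ih =>
    by_cases h1 : α = 1
    · subst h1
      exact ⟨[], by simp, fun σ => by simp [mulSwaps], by simpa using h⟩
    · obtain ⟨x, hx⟩ : ∃ x, α x ≠ x := by
        by_contra! h'
        exact h1 (Equiv.ext h')
      let β := α * Equiv.swap x (α x)
      have hβx : β x = x := by simp [β, hα]
      have hβy : β (α x) = α x := by simp [β]
      have hβ : ∀ a, a ≠ x → a ≠ α x → β a = α a := fun a h1 h2 => by
        simp [β, Equiv.swap_apply_of_ne_of_ne h1 h2]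
      have hinv : ∀ a, β (β a) = a := by
        intro a
        by_cases h1 : a = x
        · rw [h1, hβx, hβx]
        · by_cases h2 : a = α x
          · rw [h2, hβy, hβy]
          · rw [hβ a h1 h2, hβ, hα]
            · intro h
              exact h2 (by rw [← h, hα])
            · intro h
              exact h1 (α.injective h)
      have hsupp : α.support = insert x (insert (α x) β.support) := by
        ext a
        simp only [Finset.mem_insert, Equiv.Perm.mem_support]
        by_cases h1 : a = x
        · simp [h1, hx]
        · by_cases h2 : a = α x
          · simp [h2, hα, Ne.symm hx]
          · rw [hβ a h1 h2]
            simp [h1, h2]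
      have hcard : α.support.card = β.support.card + 2 := by
        rw [hsupp, Finset.card_insert_of_notMem, Finset.card_insert_of_notMem]
        · simp [hβy]
        · simp [hβx, Ne.symm hx]
      obtain ⟨l, hl1, hl2, hl3⟩ := ih β.support.card (by omega) β hinv rfl
      have hmul : β * Equiv.swap x (α x) = α := by
        simp [β, mul_assoc]
      refine ⟨(x, α x) :: l, ?_, ?_, ?_⟩
      · intro p hp
        rcases List.mem_cons.1 hp with rfl | hp
        · exact ⟨rfl, hx⟩
        · obtain ⟨h2, h3⟩ := hl1 p hp
          have h4 : p.1 ≠ x := fun h => h3 (by rw [h, hβx])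
          have h5 : p.1 ≠ α x := fun h => h3 (by rw [h, hβy])
          rw [hβ _ h4 h5] at h2 h3
          exact ⟨h2, h3⟩
      · intro σ
        rw [mulSwaps, hl2, mul_assoc, hmul]
      · rw [List.length_cons]
        omega

/-- Non-negativity of the genus of a combinatorial map. -/
theorem genus_nonneg [DecidableEq A] (σ α : Equiv.Perm A) (hα : ∀ a, α (α a) = a)
    (hfix : ∀ a, α a ≠ a) :
    2 * numClasses (Step σ) + 2 * numClasses (Step (σ * α))
      ≤ Fintype.card A + 4 * numClasses fun a b => b = σ a ∨ b = α a := by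
  obtain ⟨l, hl1, hl2, hl3⟩ := exists_swaps α hα
  have h1 := genus_nonneg_list σ l
  have hsupp : α.support = Finset.univ := by
    ext a
    simp [hfix]
  rw [hsupp, Finset.card_univ] at hl3
  have h2 : (numClasses fun a b => b = σ a ∨ (a, b) ∈ l)
      = numClasses fun a b => b = σ a ∨ b = α a := by
    set R : A → A → Prop := fun a b => b = σ a ∨ (a, b) ∈ l with hR
    set R' : A → A → Prop := fun a b => b = σ a ∨ b = α a with hR'
    have e1 : ∀ a b, R a b → Quot.mk R' a = Quot.mk R' b := by
      rintro a b (h | h)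
      · exact Quot.sound (Or.inl h)
      · exact Quot.sound (Or.inr (hl1 _ h).1)
    have hα' : ∀ a, Quot.mk R a = Quot.mk R (α a) := by
      intro a
      have := mulSwaps_mk 1 l R (fun a => rfl) (fun p hp => Quot.sound (Or.inr hp)) a
      rwa [hl2, one_mul] at this
    have e2 : ∀ a b, R' a b → Quot.mk R a = Quot.mk R b := by
      rintro a b (h | rfl)
      · exact Quot.sound (Or.inl h)
      · exact hα' a
    refine Nat.card_congr ⟨Quot.lift _ e1, Quot.lift _ e2, ?_, ?_⟩
    · rintro ⟨a⟩
      rfl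
    · rintro ⟨a⟩
      rfl
  rw [hl2, h2] at h1
  omega

end Orbits

/-- The next dart at the same crossing, in counterclockwise order. -/
def rot (n : ℕ) : Equiv.Perm (Fin n × Fin 4) where
  toFun d := (d.1, d.2 + 1)
  invFun d := (d.1, d.2 - 1)
  left_inv d := by simp
  right_inv d := by simp

/-- Whether the strand through dart `i` of a crossing runs into the crossing there. The lower strand
runs from dart `0` to dart `2`; the upper strand runs from dart `3` to dart `1` at a positive
crossing and from dart `1` to dart `3` at a negative one. -/
def Incoming (positive : Bool) (i : Fin 4) : Prop :=
  i = 0 ∨ i = if positive then 3 else 1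

/-- An oriented link diagram in the plane, given by its planar diagram code. There are `n` crossings
and `loops` further components without any crossing. Each crossing has four darts, numbered
counterclockwise from the one at which the lower strand enters. The involution `edge` has no fixed
point and pairs the darts to the edges of the diagram, each edge running from an outgoing to an
incoming dart. The code is planar: the combinatorial map with `n` vertices, `2 * n` edges and the
orbits of `rot ∘ edge` as its faces has genus zero, that is, `V - E + F` is twice the number of
connected components. -/
structure LinkDiagram where
  n : ℕ
  loops : ℕ
  positive : Fin n → Bool
  edge : Equiv.Perm (Fin n × Fin 4)
  edge_edge : ∀ d, edge (edge d) = d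
  oriented : ∀ d, Incoming (positive (edge d).1) (edge d).2 ↔ ¬ Incoming (positive d.1) d.2
  planar : n + Nat.card (Quot fun d e => e = rot n (edge d))
    = 2 * n + 2 * Nat.card (Quot fun d e => e = rot n d ∨ e = edge d)

namespace LinkDiagram

variable (D : LinkDiagram)

abbrev Dart : Type := Fin D.n × Fin 4

abbrev Point : Type := D.Dart ⊕ Fin D.loops

abbrev State : Type := Fin D.n → Bool

/-- The dart to which dart `i` is connected in the smoothing `b` of its crossing. In the `0`-smoothing
(`b = false`) one enters on the lower strand and turns right. -/
def partner (b : Bool) (i : Fin 4) : Fin 4 := if b then ![3, 2, 1, 0] i else ![1, 0, 3, 2] i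

theorem partner_partner (b : Bool) (i : Fin 4) : partner b (partner b i) = i := by
  revert b i
  decide

/-- Generating relation for the connected components of the smoothing `s`: the two ends of an edge are
connected, and so are the two ends of an arc at a crossing. -/
def Adj (s : D.State) (p q : D.Point) : Prop :=
  ∃ d : D.Dart, p = Sum.inl d ∧ (q = Sum.inl (D.edge d) ∨ q = Sum.inl (d.1, partner (s d.1) d.2))

/-- The smoothing `s` of the diagram, as a flat tangle of shift `m`: the link is marked at the point
`p` and cut open there, so that the component of `p` becomes the special line. -/
noncomputable def smoothing (p : D.Point) (s : D.State) (m : ℤ) : Tangle where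
  comps := Quot (D.Adj s)
  line := Quot.mk _ p
  shift := m

/-- The generating relation for the components of the union of two smoothings. -/
def Join (s s' : D.State) (p q : D.Point) : Prop := D.Adj s p q ∨ D.Adj s' p q

/-- The component of the union which contains a component of the first one. -/
def joinL (s s' : D.State) : Quot (D.Adj s) → Quot (D.Join s s') := Quot.map id fun _ _ => Or.inl

/-- The component of the union which contains a component of the second one. -/
def joinR (s s' : D.State) : Quot (D.Adj s') → Quot (D.Join s s') := Quot.map id fun _ _ => Or.inr

/-- For smoothings which differ at one crossing, the saddle at this crossing, with products elsewhere:
every component of this surface has genus zero, and two boundary components lie on the same component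
if they are connected in the union of the two smoothings. -/
noncomputable def saddle (p : D.Point) (s s' : D.State) (m m' : ℤ) :
    Surface (D.smoothing p s m) (D.smoothing p s' m') :=
  Surface.of (Quot (D.Join s s')) (D.joinL s s') (D.joinR s s') rfl fun _ => 0

/-- The number of negative crossings. -/
def neg : ℕ := (Finset.univ.filter fun j => D.positive j = false).card

/-- The number of positive crossings. -/
def pos : ℕ := (Finset.univ.filter fun j => D.positive j = true).card

variable {D}

/-- The height of a vertex of the cube: the number of `1`-smoothings. -/
def State.height (s : D.State) : ℕ := (Finset.univ.filter fun j => s j = true).card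

/-- The sign of the edge of the cube which leaves `s` in direction `j`. -/
def sign (s : D.State) (j : Fin D.n) : ℤ :=
  (-1) ^ (Finset.univ.filter fun i => i < j ∧ s i = true).card

variable (D)

/-- The term of degree `r` of the complex: the column of all smoothings of height `r + n₋`, with shift
`r + n₊ - n₋`. -/
noncomputable def chain (p : D.Point) (r : ℤ) : Mat_ Cobl where
  ι := {s : D.State // (s.height : ℤ) = r + D.neg}
  X s := ob (D.smoothing p s.1 (r + D.pos - D.neg))

/-- The signed saddle on the edge of the cube from `s` in direction `j`, if this edge ends in the second state. -/
noncomputable def cubeEdge (p : D.Point) (s s' : D.State) (m m' : ℤ) (j : Fin D.n) :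
    ob (D.smoothing p s m) ⟶ ob (D.smoothing p s' m') :=
  if s j = false ∧ s' = Function.update s j true then sign s j • (D.saddle p s s' m m').mor else 0

/-- The differential of the complex, the signed sum of the edges of the cube. -/
noncomputable def diff (p : D.Point) (r : ℤ) : D.chain p r ⟶ D.chain p (r + 1) := fun s s' =>
  ∑ j, D.cubeEdge p s.1 s'.1 (r + D.pos - D.neg) (r + 1 + D.pos - D.neg) j

theorem edge_ne (d : D.Dart) : D.edge d ≠ d := by
  intro h
  have := D.oriented d
  rw [h] at this
  exact iff_not_self this

/-- The faces of a planar diagram have a checkerboard colouring, in terms of darts. -/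
theorem exists_colouring : ∃ o : D.Dart → Bool, (∀ d, o (rot D.n d) = !o d) ∧
    ∀ d, o (D.edge d) = !o d := by
  classical
  let σ : Equiv.Perm (D.Dart × Bool) :=
    { toFun := fun d => (rot D.n d.1, !d.2)
      invFun := fun d => ((rot D.n).symm d.1, !d.2)
      left_inv := fun d => by simp
      right_inv := fun d => by simp }
  let α : Equiv.Perm (D.Dart × Bool) :=
    { toFun := fun d => (D.edge d.1, !d.2)
      invFun := fun d => (D.edge d.1, !d.2)
      left_inv := fun d => by simp [D.edge_edge]
      right_inv := fun d => by simp [D.edge_edge] }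
  have hg := genus_nonneg σ α (fun a => by simp [α, D.edge_edge])
    (fun a h => D.edge_ne a.1 (congrArg Prod.fst h))
  set O : D.Dart → D.Dart → Prop := fun d e => e = rot D.n d ∨ e = D.edge d with hO
  set O' : D.Dart × Bool → D.Dart × Bool → Prop := fun a b => b = σ a ∨ b = α a with hO'
  have hcard : Fintype.card (D.Dart × Bool) = 8 * D.n := by
    simp [Fintype.card_prod]
    ring
  have hσ : 2 * D.n ≤ numClasses (Step σ) := by
    let f : Quot (Step σ) → Fin D.n × Bool := Quot.lift
      (fun a => (a.1.1, xor (decide (a.1.2 = 1 ∨ a.1.2 = 3)) a.2)) (by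
        rintro ⟨⟨x, i⟩, t⟩ b rfl
        refine Prod.ext rfl ?_
        change (decide (i = 1 ∨ i = 3) ^^ t) = (decide (i + 1 = 1 ∨ i + 1 = 3) ^^ !t)
        clear x
        revert i t
        decide)
    have hf : Function.Surjective f := by
      rintro ⟨x, t⟩
      exact ⟨Quot.mk _ ((x, 0), t), by simp [f]⟩
    have := Nat.card_le_card_of_surjective f hf
    simp only [Nat.card_eq_fintype_card, Fintype.card_prod, Fintype.card_fin, Fintype.card_bool]
      at this
    unfold numClasses
    rw [Nat.card_eq_fintype_card]
    omega
  have hF : 2 * Nat.card (Quot fun d e => e = rot D.n (D.edge d)) ≤ numClasses (Step (σ * α)) := by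
    let f : Quot (Step (σ * α)) → Quot (fun d e => e = rot D.n (D.edge d)) × Bool := Quot.lift
      (fun a => (Quot.mk _ a.1, a.2)) (by
        rintro ⟨d, t⟩ b rfl
        refine Prod.ext (Quot.sound rfl) ?_
        simp [σ, α])
    have hf : Function.Surjective f := by
      rintro ⟨⟨d⟩, t⟩
      exact ⟨Quot.mk _ (d, t), rfl⟩
    have := Nat.card_le_card_of_surjective f hf
    rw [Nat.card_prod] at this
    simp only [Nat.card_eq_fintype_card (α := Bool), Fintype.card_bool] at this
    unfold numClasses
    omega
  have hpl : D.n + Nat.card (Quot fun d e => e = rot D.n (D.edge d))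
      = 2 * D.n + 2 * Nat.card (Quot O) := D.planar
  have hO'card : 2 * Nat.card (Quot O) ≤ numClasses O' := by
    rw [hcard] at hg
    have : (fun a b => b = σ a ∨ b = α a) = O' := rfl
    omega
  let rep : Quot O → D.Dart := Quot.out
  let Ψ : Quot O × Bool → Quot O' := fun K => Quot.mk _ (rep K.1, K.2)
  let τ : Quot O' → Quot O' := Quot.map (fun a => (a.1, !a.2)) (by
    rintro ⟨d, t⟩ b (rfl | rfl)
    · left; simp [σ]
    · right; simp [α])
  have hτ : ∀ d t, τ (Quot.mk _ (d, t)) = Quot.mk _ (d, !t) := fun d t => rfl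
  have hlift : ∀ d e, Relation.EqvGen O d e →
      ∀ t, ∃ t', (Quot.mk O' (d, t) : Quot O') = Quot.mk O' (e, t') := by
    intro d e h
    induction h with
    | rel d e h =>
      intro t
      rcases h with rfl | rfl
      · exact ⟨!t, Quot.sound (Or.inl rfl)⟩
      · exact ⟨!t, Quot.sound (Or.inr rfl)⟩
    | refl d => intro t; exact ⟨t, rfl⟩
    | symm d e _ ih =>
      intro t
      obtain ⟨t', h⟩ := ih t
      by_cases htt : t' = t
      · exact ⟨t, by rw [h, htt]⟩
      · refine ⟨!t, ?_⟩
        have h2 := congrArg τ h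
        rw [hτ, hτ] at h2
        rw [h2]
        rw [Bool.eq_not_of_ne htt, Bool.not_not]
    | trans d e f _ _ ih1 ih2 =>
      intro t
      obtain ⟨t', h⟩ := ih1 t
      obtain ⟨t'', h'⟩ := ih2 t'
      exact ⟨t'', h.trans h'⟩
  have hsurj : Function.Surjective Ψ := by
    rintro ⟨⟨d, t⟩⟩
    obtain ⟨t', h⟩ := hlift d (rep (Quot.mk O d))
      (Quot.eqvGen_exact (Quot.out_eq (Quot.mk O d)).symm) t
    exact ⟨(Quot.mk O d, t'), h.symm⟩
  have hbij : Function.Bijective Ψ := by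
    rw [Fintype.bijective_iff_surjective_and_card]
    refine ⟨hsurj, le_antisymm ?_ (Fintype.card_le_of_surjective Ψ hsurj)⟩
    rw [Fintype.card_prod, Fintype.card_bool, ← Nat.card_eq_fintype_card,
      ← Nat.card_eq_fintype_card]
    unfold numClasses at hO'card
    omega
  let e := Equiv.ofBijective Ψ hbij
  have hΨτ : ∀ a, (e.symm (τ a)).2 = !(e.symm a).2 := by
    intro a
    obtain ⟨K, rfl⟩ := e.surjective a
    have : τ (e K) = e (K.1, !K.2) := rfl
    rw [this, e.symm_apply_apply, e.symm_apply_apply]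
  refine ⟨fun d => (e.symm (Quot.mk _ (d, false))).2, fun d => ?_, fun d => ?_⟩
  · rw [← hΨτ, hτ]
    exact congrArg (fun a => (e.symm a).2) (Quot.sound (show O' (d, true) (rot D.n d, false) from Or.inl rfl)).symm
  · rw [← hΨτ, hτ]
    exact congrArg (fun a => (e.symm a).2) (Quot.sound (show O' (d, true) (D.edge d, false) from Or.inr rfl)).symm

end LinkDiagram

namespace LinkDiagram

variable (D : LinkDiagram)

/-- The arc through a dart at its crossing in a smoothing. -/
def arc (s : D.State) (d : D.Dart) : D.Dart := (d.1, partner (s d.1) d.2)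

theorem arc_arc (s : D.State) (d : D.Dart) : D.arc s (D.arc s d) = d := by
  simp [arc, partner_partner]

theorem colour_arc {o : D.Dart → Bool} (ho : ∀ d, o (rot D.n d) = !o d) (s : D.State) (d : D.Dart) :
    o (D.arc s d) = !o d := by
  have h : ∀ (b : Bool) (i : Fin 4), partner b i = i + 1 ∨ i = partner b i + 1 := by decide
  rcases h (s d.1) d.2 with h | h
  · rw [← ho]
    exact congrArg o (Prod.ext rfl h)
  · have h2 := ho (D.arc s d)
    have h3 : rot D.n (D.arc s d) = d := Prod.ext rfl h.symm
    rw [h3] at h2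
    rw [h2, Bool.not_not]

/-- The permutation of the positively coloured darts whose cycles are the circles of a
smoothing. -/
def turn {o : D.Dart → Bool} (ho : ∀ d, o (rot D.n d) = !o d) (he : ∀ d, o (D.edge d) = !o d)
    (s : D.State) : Equiv.Perm D.Dart where
  toFun d := if o d then D.edge (D.arc s d) else d
  invFun d := if o d then D.arc s (D.edge d) else d
  left_inv d := by
    by_cases h : o d = true
    · simp [h, he, D.colour_arc ho, D.edge_edge, arc_arc]
    · simp [h]
  right_inv d := by
    by_cases h : o d = true
    · simp [h, he, D.colour_arc ho, D.edge_edge, arc_arc]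
    · simp [h]

theorem mk_turn_iff {o : D.Dart → Bool} (ho : ∀ d, o (rot D.n d) = !o d)
    (he : ∀ d, o (D.edge d) = !o d) (s : D.State) (a b : D.Dart) (ha : o a = true)
    (hb : o b = true) :
    (Quot.mk (D.Adj s) (Sum.inl a) = Quot.mk _ (Sum.inl b)) ↔
      Quot.mk (Step (D.turn ho he s)) a = Quot.mk _ b := by
  constructor
  · intro h
    let F : D.Point → Quot (Step (D.turn ho he s)) ⊕ Fin D.loops := fun p =>
      p.elim (fun d => Sum.inl (Quot.mk _ (if o d then d else D.arc s d))) Sum.inr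
    have key : ∀ d, o d = true →
        Quot.mk (Step (D.turn ho he s)) d = Quot.mk _ (D.arc s (D.edge d)) := by
      intro d hd
      refine (Quot.sound ?_).symm
      change d = if o (D.arc s (D.edge d)) then D.edge (D.arc s (D.arc s (D.edge d)))
        else D.arc s (D.edge d)
      rw [D.colour_arc ho, he, Bool.not_not, if_pos hd, arc_arc, D.edge_edge]
    have hF : ∀ p q, D.Adj s p q → F p = F q := by
      rintro p q ⟨d, rfl, rfl | rfl⟩
      · refine congrArg Sum.inl ?_
        by_cases hd : o d = true
        · simp only [hd, he, if_true, Bool.not_true]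
          exact key d hd
        · have hd' : o d = false := by simpa using hd
          simp only [hd', he, Bool.not_false, if_true]
          have := key (D.edge d) (by rw [he, hd']; rfl)
          rw [D.edge_edge] at this
          exact this.symm
      · refine congrArg Sum.inl (congrArg _ ?_)
        have h1 := D.colour_arc ho s d
        have h2 := D.arc_arc s d
        change _ = if o (D.arc s d) then D.arc s d else D.arc s (D.arc s d)
        rw [h1, h2]
        by_cases hd : o d = true <;> simp [hd]
    have := congrArg (Quot.lift F hF) h
    have h2 : F (Sum.inl a) = F (Sum.inl b) := this
    simpa [F, ha, hb] using h2
  · intro h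
    have hadj : ∀ d, Quot.mk (D.Adj s) (Sum.inl d) = Quot.mk _ (Sum.inl (D.turn ho he s d)) := by
      intro d
      change _ = Quot.mk _ (Sum.inl (if o d then D.edge (D.arc s d) else d))
      split_ifs
      · exact (Quot.sound ⟨d, rfl, Or.inr rfl⟩ :
          Quot.mk (D.Adj s) (Sum.inl d) = Quot.mk _ (Sum.inl (D.arc s d))).trans
          (Quot.sound ⟨_, rfl, Or.inl rfl⟩)
      · rfl
    exact congrArg (Quot.lift (fun d => Quot.mk (D.Adj s) (Sum.inl d))
      (by rintro d e rfl; exact hadj d)) h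

theorem fin_four : ∀ i : Fin 4, i = 0 ∨ i = 1 ∨ i = 2 ∨ i = 3 := by decide

/-- Changing one smoothing of a planar diagram either merges or splits. -/
theorem merge_or_split (s : D.State) (j : Fin D.n) (hj : s j = false) :
    (Quot.mk (D.Adj (Function.update s j true)) (Sum.inl (j, 0)) = Quot.mk _ (Sum.inl (j, 2))) ↔
      ¬ (Quot.mk (D.Adj s) (Sum.inl (j, 0)) = Quot.mk _ (Sum.inl (j, 2))) := by
  obtain ⟨o, ho, he, h0⟩ : ∃ o : D.Dart → Bool, (∀ d, o (rot D.n d) = !o d) ∧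
      (∀ d, o (D.edge d) = !o d) ∧ o (j, 0) = true := by
    obtain ⟨o, ho, he⟩ := D.exists_colouring
    cases h : o (j, 0)
    · exact ⟨fun d => !o d, fun d => by simp [ho], fun d => by simp [he], by simp [h]⟩
    · exact ⟨o, ho, he, h⟩
  have h1 : o (j, 1) = false := by
    have := ho (j, 0)
    rw [h0] at this
    exact this
  have h2 : o (j, 2) = true := by
    have := ho (j, 1)
    rw [h1] at this
    exact this
  have h3 : o (j, 3) = false := by
    have := ho (j, 2)
    rw [h2] at this
    exact this
  rw [D.mk_turn_iff ho he _ _ _ h0 h2, D.mk_turn_iff ho he _ _ _ h0 h2]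
  have hturn : D.turn ho he (Function.update s j true)
      = D.turn ho he s * Equiv.swap (j, 0) (j, 2) := by
    ext1 d
    rw [Equiv.Perm.mul_apply]
    by_cases hd : o d = true
    · by_cases hdj : d.1 = j
      · obtain ⟨x, i⟩ := d
        subst hdj
        have hi : i = 0 ∨ i = 2 := by
          revert hd
          have := fin_four i
          rcases this with rfl | rfl | rfl | rfl <;> simp [h1, h3]
        rcases hi with rfl | rfl
        · rw [Equiv.swap_apply_left]
          simp [turn, h0, h2, arc, partner, hj]
        · rw [Equiv.swap_apply_right]
          simp [turn, h0, h2, arc, partner, hj]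
      · rw [Equiv.swap_apply_of_ne_of_ne (fun h => hdj (by rw [h])) (fun h => hdj (by rw [h]))]
        simp [turn, arc, Function.update_of_ne hdj]
    · rw [Equiv.swap_apply_of_ne_of_ne (fun h => hd (by rw [h, h0])) (fun h => hd (by rw [h, h2]))]
      simp [turn, hd]
  rw [hturn]
  have hne : ((j, 0) : D.Dart) ≠ (j, 2) := by simp
  constructor
  · intro h h'
    exact swap_splits _ _ _ hne h' h
  · intro h
    exact swap_joins _ _ _ h

/-- The class of the crossing `j` after merging two states which differ at `j`. -/
theorem sum_saddle (s : D.State) (j : Fin D.n) (hj : s j = false) (s' : D.State)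
    (hs' : s' = Function.update s j true) (φ : Quot (D.Join s s') → ℤ) :
    2 * ∑ c, φ c = ∑ c, φ (D.joinL s s' c) + ∑ c, φ (D.joinR s s' c)
      - φ (Quot.mk _ (Sum.inl (j, 0))) := by
  classical
  have hs'j : s' j = true := by rw [hs', Function.update_self]
  have hs'x : ∀ x, x ≠ j → s' x = s x := fun x hx => by rw [hs', Function.update_of_ne hx]
  have adj0 : ∀ i, D.Adj s (Sum.inl (j, i)) (Sum.inl (j, partner false i)) := fun i =>
    ⟨(j, i), rfl, Or.inr (by rw [hj])⟩
  have adj1 : ∀ i, D.Adj s' (Sum.inl (j, i)) (Sum.inl (j, partner true i)) := fun i =>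
    ⟨(j, i), rfl, Or.inr (by rw [hs'j])⟩
  have hxy : Quot.mk (D.Join s s') (Sum.inl (j, 0)) = Quot.mk (D.Join s s') (Sum.inl (j, 2)) :=
    (Quot.sound (Or.inl (adj0 0)) : Quot.mk (D.Join s s') _ = Quot.mk (D.Join s s') (Sum.inl (j, 1))).trans
      (Quot.sound (Or.inr (adj1 1)))
  have e1 := sum_quot_merge (D.Adj s) (D.Join s s') (Sum.inl (j, 0)) (Sum.inl (j, 2))
    (D.joinL s s') (fun _ => rfl) hxy (by
      intro ψ h1 h2 a b hab
      rcases hab with hab | ⟨⟨x, i⟩, rfl, rfl | rfl⟩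
      · exact h1 a b hab
      · exact h1 _ _ ⟨_, rfl, Or.inl rfl⟩
      · by_cases hx : x = j
        · subst hx
          have a0 : ψ (Sum.inl (x, 0)) = ψ (Sum.inl (x, 1)) := h1 _ _ (adj0 0)
          have a2 : ψ (Sum.inl (x, 2)) = ψ (Sum.inl (x, 3)) := h1 _ _ (adj0 2)
          simp only [hs'j]
          have := fin_four i
          rcases this with rfl | rfl | rfl | rfl
          · exact h2.trans a2
          · exact a0.symm.trans h2
          · exact h2.symm.trans a0
          · exact a2.symm.trans h2.symm
        · refine h1 _ _ ⟨(x, i), rfl, Or.inr ?_⟩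
          simp only [hs'x x hx]) φ
  have e2 := sum_quot_merge (D.Adj s') (D.Join s s') (Sum.inl (j, 0)) (Sum.inl (j, 2))
    (D.joinR s s') (fun _ => rfl) hxy (by
      intro ψ h1 h2 a b hab
      rcases hab with ⟨⟨x, i⟩, rfl, rfl | rfl⟩ | hab
      · exact h1 _ _ ⟨_, rfl, Or.inl rfl⟩
      · by_cases hx : x = j
        · subst hx
          have a0 : ψ (Sum.inl (x, 0)) = ψ (Sum.inl (x, 3)) := h1 _ _ (adj1 0)
          have a2 : ψ (Sum.inl (x, 2)) = ψ (Sum.inl (x, 1)) := h1 _ _ (adj1 2)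
          simp only [hj]
          have := fin_four i
          rcases this with rfl | rfl | rfl | rfl
          · exact h2.trans a2
          · exact a2.symm.trans h2.symm
          · exact h2.symm.trans a0
          · exact a0.symm.trans h2
        · refine h1 _ _ ⟨(x, i), rfl, Or.inr ?_⟩
          simp only [hs'x x hx]
      · exact h1 a b hab) φ
  have hms := D.merge_or_split s j hj
  rw [← hs'] at hms
  by_cases h : Quot.mk (D.Adj s) (Sum.inl (j, 0)) = Quot.mk _ (Sum.inl (j, 2))
  · rw [if_pos h] at e1
    rw [if_neg (fun h' => hms.1 h' h)] at e2
    linarith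
  · rw [if_neg h] at e1
    rw [if_pos (hms.2 h)] at e2
    linarith

/-- The two saddles of a face of the cube, composed. -/
theorem saddle_comp (p : D.Point) (s s' s'' : D.State) (j k : Fin D.n) (hjk : j ≠ k)
    (hj : s j = false) (hk : s k = false) (hs' : s' = Function.update s j true)
    (hs'' : s'' = Function.update s' k true) (m m' m'' : ℤ) :
    ∃ γ : Quot (D.Join s s'') → ℕ,
      (∀ K, 2 * ((γ K : ℤ) - 1) =
        - push (D.joinL s s'') (fun _ => 1) K - push (D.joinR s s'') (fun _ => 1) K
        + (push (fun _ : Unit => Quot.mk (D.Join s s'') (Sum.inl (j, 0))) (fun _ => 1) K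
          + push (fun _ : Unit => Quot.mk (D.Join s s'') (Sum.inl (k, 0))) (fun _ => 1) K)) ∧
      (D.saddle p s s' m m').mor ≫ (D.saddle p s' s'' m' m'').mor
      = (Surface.of (X := D.smoothing p s m) (Y := D.smoothing p s'' m'')
          (Quot (D.Join s s'')) (D.joinL s s'') (D.joinR s s'') rfl γ).mor := by
  classical
  have hk' : s' k = false := by rw [hs', Function.update_of_ne (Ne.symm hjk), hk]
  have hmid : ∀ a b, D.Adj s' a b → D.Join s s'' a b := by
    rintro a b ⟨⟨x, i⟩, rfl, rfl | rfl⟩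
    · exact Or.inl ⟨_, rfl, Or.inl rfl⟩
    · by_cases hx : x = j
      · refine Or.inr ⟨_, rfl, Or.inr ?_⟩
        simp only [hs'', hx, Function.update_of_ne hjk]
      · refine Or.inl ⟨_, rfl, Or.inr ?_⟩
        simp only [hs', Function.update_of_ne hx]
  let q₁ : Quot (D.Join s s') → Quot (D.Join s s'') :=
    Quot.map id fun a b h => h.elim Or.inl (hmid a b)
  let q₂ : Quot (D.Join s' s'') → Quot (D.Join s s'') :=
    Quot.map id fun a b h => h.elim (hmid a b) Or.inr
  obtain ⟨γ, hγ, hh⟩ := Surface.exists_of_comp_of (X := D.smoothing p s m)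
    (Y := D.smoothing p s' m') (Z := D.smoothing p s'' m'')
    (K := Quot (D.Join s s')) (L := Quot (D.Join s' s'')) (M := Quot (D.Join s s''))
    (s₁ := D.joinL s s') (t₁ := D.joinR s s') (h₁ := rfl) (g₁ := fun _ => 0)
    (s₂ := D.joinL s' s'') (t₂ := D.joinR s' s'') (h₂ := rfl) (g₂ := fun _ => 0)
    (s := D.joinL s s'') (t := D.joinR s s'') (h := rfl)
    q₁ q₂ (by rintro ⟨a⟩; rfl) (by rintro ⟨a⟩; exact Or.inl ⟨Quot.mk _ a, rfl⟩)
    (by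
      intro T φ₁ φ₂ h
      refine ⟨Quot.lift (fun a => φ₁ (Quot.mk _ a)) ?_, ?_, ?_⟩
      · intro a b hab
        rcases hab with hab | hab
        · exact congrArg φ₁ (Quot.sound (Or.inl hab))
        · have ha : φ₁ (Quot.mk _ a) = φ₂ (Quot.mk _ a) := h (Quot.mk _ a)
          have hb : φ₁ (Quot.mk _ b) = φ₂ (Quot.mk _ b) := h (Quot.mk _ b)
          rw [ha, hb]
          exact congrArg φ₂ (Quot.sound (Or.inr hab))
      · rintro ⟨a⟩
        rfl
      · rintro ⟨a⟩
        exact h (Quot.mk _ a))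
    (by rintro ⟨a⟩; rfl) (by rintro ⟨a⟩; rfl)
  refine ⟨γ, fun K => ?_, (Surface.mor_comp _ _).trans (Surface.mor_eq hh)⟩
  have e1 := D.sum_saddle s j hj s' hs' (fun c => if q₁ c = K then 1 else 0)
  have e2 := D.sum_saddle s' k hk' s'' hs'' (fun c => if q₂ c = K then 1 else 0)
  have f1 : push q₁ (fun _ => ((0 : ℕ) : ℤ) - 1) K = - ∑ c, if q₁ c = K then 1 else 0 := by
    rw [← Finset.sum_neg_distrib]
    refine Finset.sum_congr rfl fun c _ => ?_
    split_ifs <;> simp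
  have f2 : push q₂ (fun _ => ((0 : ℕ) : ℤ) - 1) K = - ∑ c, if q₂ c = K then 1 else 0 := by
    rw [← Finset.sum_neg_distrib]
    refine Finset.sum_congr rfl fun c _ => ?_
    split_ifs <;> simp
  have g1 : ∑ c : Quot (D.Adj s), (if q₁ (D.joinL s s' c) = K then (1 : ℤ) else 0)
      = push (D.joinL s s'') (fun _ => 1) K := by
    refine Finset.sum_congr rfl ?_
    rintro ⟨a⟩ _
    rfl
  have g2 : ∑ c : Quot (D.Adj s''), (if q₂ (D.joinR s' s'' c) = K then (1 : ℤ) else 0)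
      = push (D.joinR s s'') (fun _ => 1) K := by
    refine Finset.sum_congr rfl ?_
    rintro ⟨a⟩ _
    rfl
  have g3 : ∑ c : Quot (D.Adj s'), (if q₂ (D.joinL s' s'' c) = K then (1 : ℤ) else 0)
      = ∑ c : Quot (D.Adj s'), (if q₁ (D.joinR s s' c) = K then (1 : ℤ) else 0) := by
    refine Finset.sum_congr rfl ?_
    rintro ⟨a⟩ _
    rfl
  have g4 : push (fun y : Quot (D.Adj s') => q₁ (D.joinR s s' y)) (fun _ => 1) K
      = ∑ c : Quot (D.Adj s'), (if q₁ (D.joinR s s' c) = K then (1 : ℤ) else 0) := rfl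
  have g5 : push (fun _ : Unit => (Quot.mk (D.Join s s'') (Sum.inl (j, 0)))) (fun _ => 1) K
      = if q₁ (Quot.mk _ (Sum.inl (j, 0))) = K then 1 else 0 := by
    simp [push]
    rfl
  have g6 : push (fun _ : Unit => (Quot.mk (D.Join s s'') (Sum.inl (k, 0)))) (fun _ => 1) K
      = if q₂ (Quot.mk _ (Sum.inl (k, 0))) = K then 1 else 0 := by
    simp [push]
    rfl
  have h := hγ K
  rw [f1, f2] at h
  have h' := h.trans (congrArg _ g4)
  rw [g5, g6, ← g1, ← g2]
  rw [g3] at e2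
  linarith

/-- The faces of the cube commute. -/
theorem saddle_comm (p : D.Point) (s s₁ s₂ s'' : D.State) (j k : Fin D.n) (hjk : j ≠ k)
    (hj : s j = false) (hk : s k = false) (h₁ : s₁ = Function.update s j true)
    (h₂ : s₂ = Function.update s k true) (h₁' : s'' = Function.update s₁ k true)
    (h₂' : s'' = Function.update s₂ j true) (m m' m'' : ℤ) :
    (D.saddle p s s₁ m m').mor ≫ (D.saddle p s₁ s'' m' m'').mor
      = (D.saddle p s s₂ m m').mor ≫ (D.saddle p s₂ s'' m' m'').mor := by
  obtain ⟨γ, hγ, e⟩ := D.saddle_comp p s s₁ s'' j k hjk hj hk h₁ h₁' m m' m''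
  obtain ⟨γ', hγ', e'⟩ := D.saddle_comp p s s₂ s'' k j hjk.symm hk hj h₂ h₂' m m' m''
  have : γ = γ' := by
    funext K
    have a := hγ K
    have b := hγ' K
    have : (γ K : ℤ) = γ' K := by linarith
    exact_mod_cast this
  rw [e, e', this]

end LinkDiagram

namespace LinkDiagram

variable {D : LinkDiagram}

theorem sign_update (s : D.State) (j k : Fin D.n) (hj : s j = false) :
    sign (Function.update s j true) k = if j < k then - sign s k else sign s k := by
  unfold sign
  split_ifs with h
  · have : (Finset.univ.filter fun i => i < k ∧ Function.update s j true i = true)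
        = insert j (Finset.univ.filter fun i => i < k ∧ s i = true) := by
      ext i
      by_cases hi : i = j
      · subst hi; simp [h]
      · simp [hi]
    rw [this, Finset.card_insert_of_notMem (by simp [hj]), pow_succ]
    ring
  · congr 2
    ext i
    by_cases hi : i = j
    · subst hi; simp [h]
    · simp [hi]

theorem sign_anti (s : D.State) (j k : Fin D.n) (hjk : j ≠ k) (hj : s j = false)
    (hk : s k = false) : sign s j * sign (Function.update s j true) k
      = - (sign s k * sign (Function.update s k true) j) := by
  rw [sign_update s j k hj, sign_update s k j hk]
  rcases lt_or_gt_of_ne hjk with h | h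
  · rw [if_pos h, if_neg (not_lt.2 h.le)]
    ring
  · rw [if_neg (not_lt.2 h.le), if_pos h]
    ring

theorem height_update (s : D.State) (j : Fin D.n) (hj : s j = false) :
    State.height (Function.update s j true) = State.height s + 1 := by
  unfold State.height
  have : (Finset.univ.filter fun i => Function.update s j true i = true)
        = insert j (Finset.univ.filter fun i => s i = true) := by
    ext i
    by_cases hi : i = j
    · subst hi; simp
    · simp [hi]
  rw [this, Finset.card_insert_of_notMem (by simp [hj])]

variable (D)

theorem cubeEdge_comp (p : D.Point) (s s'' : D.State) (m m' m'' : ℤ) (P : D.State → Prop)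
    [Fintype {s' // P s'}] (hP : ∀ j, s j = false → P (Function.update s j true)) :
    ∑ s' : {s' // P s'}, (∑ j, D.cubeEdge p s s'.1 m m' j) ≫
      (∑ k, D.cubeEdge p s'.1 s'' m' m'' k) = 0 := by
  classical
  let T : Fin D.n → Fin D.n → (ob (D.smoothing p s m) ⟶ ob (D.smoothing p s'' m'')) :=
    fun j k => if s j = false ∧ Function.update s j true k = false ∧
      s'' = Function.update (Function.update s j true) k true then
      (sign s j * sign (Function.update s j true) k) •
        ((D.saddle p s (Function.update s j true) m m').mor ≫
          (D.saddle p (Function.update s j true) s'' m' m'').mor) else 0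
  have h0 : ∀ s₁ s₂ m₁ m₂ j, ¬ (s₁ j = false ∧ s₂ = Function.update s₁ j true) →
      D.cubeEdge p s₁ s₂ m₁ m₂ j = 0 := fun _ _ _ _ _ h => if_neg h
  have h1 : ∑ s' : {s' // P s'}, (∑ j, D.cubeEdge p s s'.1 m m' j) ≫
      (∑ k, D.cubeEdge p s'.1 s'' m' m'' k) = ∑ j, ∑ k, T j k := by
    have hin : ∀ j k, ∑ s' : {s' // P s'}, D.cubeEdge p s s'.1 m m' j ≫
        D.cubeEdge p s'.1 s'' m' m'' k = T j k := by
      intro j k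
      by_cases hj : s j = false
      · refine (Finset.sum_eq_single ⟨Function.update s j true, hP j hj⟩ ?_ ?_).trans ?_
        · intro b _ hb
          rw [h0 _ _ _ _ _ (fun h => hb (Subtype.ext h.2)), Limits.zero_comp]
        · intro h
          exact absurd (Finset.mem_univ _) h
        · have e : D.cubeEdge p s (Function.update s j true) m m' j = _ := if_pos ⟨hj, rfl⟩
          rw [e]
          by_cases hk : Function.update s j true k = false ∧
              s'' = Function.update (Function.update s j true) k true
          · have e' : D.cubeEdge p (Function.update s j true) s'' m' m'' k = _ := if_pos hk
            have e'' : T j k = _ := if_pos ⟨hj, hk⟩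
            rw [e', e'', Preadditive.zsmul_comp, Preadditive.comp_zsmul, smul_smul]
          · rw [h0 _ _ _ _ _ hk, Limits.comp_zero]
            exact (if_neg (fun h => hk h.2)).symm
      · refine (Finset.sum_eq_zero fun b _ => ?_).trans (if_neg (fun h => hj h.1)).symm
        rw [h0 _ _ _ _ _ (fun h => hj h.1), Limits.zero_comp]
    have he : ∀ s' : {s' // P s'}, (∑ j, D.cubeEdge p s s'.1 m m' j) ≫
        (∑ k, D.cubeEdge p s'.1 s'' m' m'' k) = ∑ j, ∑ k, D.cubeEdge p s s'.1 m m' j ≫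
        D.cubeEdge p s'.1 s'' m' m'' k := fun s' => by
      rw [Preadditive.sum_comp]
      exact Finset.sum_congr rfl fun j _ => Preadditive.comp_sum _ _ _
    rw [Finset.sum_congr rfl fun s' _ => he s', Finset.sum_comm]
    refine Finset.sum_congr rfl fun j _ => ?_
    rw [Finset.sum_comm]
    exact Finset.sum_congr rfl fun k _ => hin j k
  have h2 : ∀ j k, T j k + T k j = 0 := by
    intro j k
    by_cases hjk : j = k
    · subst hjk
      have : T j j = 0 := if_neg (fun h => by simpa using h.2.1)
      rw [this, add_zero]
    by_cases h : s j = false ∧ s k = false ∧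
      s'' = Function.update (Function.update s j true) k true
    · have hc : s'' = Function.update (Function.update s k true) j true := by
        rw [h.2.2, Function.update_comm hjk]
      have a : T j k = _ := if_pos ⟨h.1, by rw [Function.update_of_ne (Ne.symm hjk)]; exact h.2.1,
        h.2.2⟩
      have b : T k j = _ := if_pos ⟨h.2.1, by rw [Function.update_of_ne hjk]; exact h.1, hc⟩
      rw [a, b, sign_anti s j k hjk h.1 h.2.1,
        D.saddle_comm p s _ _ s'' j k hjk h.1 h.2.1 rfl rfl h.2.2 hc m m' m'', neg_smul,
        neg_add_cancel]
    · have a : T j k = 0 := if_neg fun h' => h ⟨h'.1, by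
        have := h'.2.1
        rwa [Function.update_of_ne (Ne.symm hjk)] at this, h'.2.2⟩
      have b : T k j = 0 := if_neg fun h' => h ⟨by
        have := h'.2.1
        rwa [Function.update_of_ne hjk] at this, h'.1, by
        rw [h'.2.2, Function.update_comm hjk]⟩
      rw [a, b, add_zero]
  rw [h1, ← Finset.sum_product' (f := T)]
  refine Finset.sum_involution (fun x _ => (x.2, x.1)) ?_ ?_ ?_ ?_
  · intro x _
    exact h2 x.1 x.2
  · rintro ⟨j, k⟩ _ hne h
    have hjk : k = j := congrArg Prod.fst h
    subst hjk
    exact hne (if_neg (fun h => by simpa using h.2.1))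
  · intro x _
    simp
  · intro x _
    rfl

theorem diff_comp (p : D.Point) (r : ℤ) : D.diff p r ≫ D.diff p (r + 1) = 0 := by
  funext s s''
  refine D.cubeEdge_comp p s.1 s''.1 _ _ _ (fun s' => (s'.height : ℤ) = r + 1 + D.neg)
    fun j hj => ?_
  rw [height_update _ _ hj]
  have := s.2
  push_cast
  omega

/-- The complex of the diagram marked at `p`, in columns over `Cobl`. -/
noncomputable def Kh (p : D.Point) : CochainComplex (Mat_ Cobl) ℤ :=
  CochainComplex.of (D.chain p) (D.diff p) (D.diff_comp p)

end LinkDiagram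
end BarNatan

open BarNatan

namespace BarNatan

/-! Two facts carry the theorem: an object splits at each of its circles, and the morphisms between
bare special lines are exactly the polynomials in `H`.

Splitting. Cut the cylinder over a circle `c` into two discs and apply 4TU with one disc on each
half and two on the curtain. The four tubed surfaces are the identity, the cut surface with a handle
on the curtain, and the two surfaces in which one half is joined to the curtain. This is
`neck_cutting`; it writes the identity as a sum of two maps which factor through the object without
`c`. The composites in the other order are a sphere, a filled hole or a handle, so S makes the two
factorisations orthogonal (`circle_isSplitting`). Degrees come from the Euler characteristic, which
is additive under gluing (`degree_comp`). The rest is formal: splittings compose, they assemble to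
block diagonal matrices, and a complex may be conjugated by isomorphisms of its terms. Iteration
removes all circles (`exists_isSplitting_lines`).

Fullness. A surface between special lines is the curtain together with closed components. With two
discs on a closed component and two on the curtain, 4TU and S trade the closed component for handles
(`mor_addClosed_succ`), so only the curtains with `k` handles are needed.

Faithfulness. A nonzero polynomial in `H` must be detected modulo the relations. For rational `t ≠
0`, colour the components of a surface by the roots `±t` and weigh a component of genus `g` and
colour `r` by `r ^ (g - 1)`: the state sum of a semisimple Frobenius algebra whose handle operator
has eigenvalues `±t`. Since genus minus one is additive up to one for each glued circle, gluing
becomes matrix multiplication. S holds because `t⁻¹ + (-t)⁻¹ = 0`, T because a torus has two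
colourings of weight one, and 4TU because a tube between colours `r` and `r'` contributes `(r + r')
/ 2`. The curtain with `k` handles has an entry `t ^ k`, so a polynomial that becomes zero vanishes
at every nonzero rational (`polyMor_injective`).

Link diagrams. By planarity each edge of the cube merges or splits, so its saddle has degree `-1`
before shifts, and the shift of the terms compensates this. After delooping everything, the
differentials are matrices of degree zero between special lines; fullness lifts them to `ℤ[H]`,
faithfulness gives `d² = 0`, and since a handle has degree `-2`, each entry can involve only one
power of `H`. -/

theorem sum_push {A B : Type} [Fintype A] [Fintype B] (p : A → B) (w : A → ℤ) :
    ∑ b, push p w b = ∑ a, w a := by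
  classical
  unfold push
  rw [Finset.sum_comm]
  simp

/-! ### Degrees of surfaces and homogeneous morphisms. -/

namespace Surface

variable {X Y Z : Tangle}

/-- Weighting circles by one and the line by zero turns the fibre counts into a push-forward, whose
total is the number of circles. -/
theorem sum_card_fibre_ne {n : ℕ} (s : X.comps → Fin n) :
    ∑ k, (Nat.card {x : X.comps // x ≠ X.line ∧ s x = k} : ℤ) = Fintype.card X.comps - 1 := by
  classical
  have h : ∀ k, (Nat.card {x : X.comps // x ≠ X.line ∧ s x = k} : ℤ)
      = push s (fun x => if x ≠ X.line then 1 else 0) k := by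
    intro k
    rw [Nat.card_eq_fintype_card, Fintype.card_subtype, Finset.card_filter]
    push_cast
    refine Finset.sum_congr rfl fun x _ => ?_
    by_cases h1 : x = X.line <;> by_cases h2 : s x = k <;> simp [h1, h2]
  rw [Finset.sum_congr rfl fun k _ => h k, sum_push]
  have h2 : ∀ x : X.comps, (if x ≠ X.line then (1 : ℤ) else 0)
      = 1 - if x = X.line then 1 else 0 := by
    intro x
    split_ifs <;> simp_all
  rw [Finset.sum_congr rfl fun x _ => h2 x, Finset.sum_sub_distrib]
  simp

/-- There are `|X| + |Y| - 1` boundary circles, because the two lines share the boundary circle of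
the curtain; the `-1` in `degree` cancels against this. Only genus minus one is left, the quantity
for which `comp_genus` gives a gluing formula. -/
theorem degree_eq (f : Surface X Y) : f.degree = -2 * ∑ k, ((f.genus k : ℤ) - 1)
    - Fintype.card X.comps - Fintype.card Y.comps + (Y.shift - X.shift) := by
  classical
  have h1 := sum_card_fibre_ne f.src
  have h2 := sum_card_fibre_ne f.tgt
  have h3 : ∑ k, ((if k = f.src X.line then (1 : ℕ) else 0 : ℕ) : ℤ) = 1 := by simp
  have h4 : f.euler = -2 * ∑ k, ((f.genus k : ℤ) - 1)
      - ∑ k, (Nat.card {x : X.comps // x ≠ X.line ∧ f.src x = k} : ℤ)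
      - ∑ k, (Nat.card {y : Y.comps // y ≠ Y.line ∧ f.tgt y = k} : ℤ)
      - ∑ k, ((if k = f.src X.line then (1 : ℕ) else 0 : ℕ) : ℤ) := by
    rw [Finset.mul_sum, ← Finset.sum_sub_distrib, ← Finset.sum_sub_distrib,
      ← Finset.sum_sub_distrib]
    refine Finset.sum_congr rfl fun k _ => ?_
    unfold boundaryCount
    push_cast
    ring
  rw [degree, h4, h1, h2, h3]
  ring

theorem degree_of (K : Type) [Fintype K] (s : X.comps → K) (t : Y.comps → K)
    (h : s X.line = t Y.line) (g : K → ℕ) : (of K s t h g).degree = -2 * ∑ k, ((g k : ℤ) - 1)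
      - Fintype.card X.comps - Fintype.card Y.comps + (Y.shift - X.shift) := by
  rw [degree_eq]
  congr 4
  exact Equiv.sum_comp (Fintype.equivFin K).symm fun k => (g k : ℤ) - 1

/-- Each middle component raises the total of genus minus one by one, hence lowers the degree by
two; this matches its being counted once as a target of `f` and once as a source of `g`. The shifts
telescope. -/
theorem degree_comp (f : Surface X Y) (g : Surface Y Z) :
    (comp f g).degree = f.degree + g.degree := by
  have h : ∑ k, (((comp f g).genus k : ℤ) - 1)
      = ∑ k, ((f.genus k : ℤ) - 1) + ∑ k, ((g.genus k : ℤ) - 1) + Fintype.card Y.comps := by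
    rw [comp_genus, Finset.sum_add_distrib, sum_push, sum_push, Fintype.sum_sum_type]
    simp
  rw [degree_eq, degree_eq, degree_eq, h]
  ring

theorem degree_cylinder (X : Tangle) : (cylinder X).degree = 0 := by
  rw [cylinder, degree_of]
  simp
  ring

end Surface

namespace IsHomogeneous

variable {A B C : Cobl} {d e : ℤ}

theorem mor {X Y : Tangle} {f : Surface X Y} (h : f.degree = d) : IsHomogeneous d f.mor :=
  AddSubgroup.subset_closure ⟨f, h, rfl⟩

theorem zero : IsHomogeneous d (0 : A ⟶ B) := AddSubgroup.zero_mem _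

theorem add {a b : A ⟶ B} (ha : IsHomogeneous d a) (hb : IsHomogeneous d b) :
    IsHomogeneous d (a + b) := AddSubgroup.add_mem _ ha hb

theorem sub {a b : A ⟶ B} (ha : IsHomogeneous d a) (hb : IsHomogeneous d b) :
    IsHomogeneous d (a - b) := AddSubgroup.sub_mem _ ha hb

theorem zsmul {a : A ⟶ B} (n : ℤ) (ha : IsHomogeneous d a) : IsHomogeneous d (n • a) :=
  AddSubgroup.zsmul_mem _ ha n

theorem sum {ι : Type*} {s : Finset ι} {a : ι → (A ⟶ B)} (h : ∀ i ∈ s, IsHomogeneous d (a i)) :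
    IsHomogeneous d (∑ i ∈ s, a i) := AddSubgroup.sum_mem _ h

theorem id (A : Cobl) : IsHomogeneous 0 (𝟙 A) := by
  -- An object of the quotient category is a wrapped tangle, so `A` and `ob A.tangle` agree by
  -- definition.
  have h : 𝟙 A = (Surface.cylinder A.tangle).mor := (Surface.mor_cylinder A.tangle).symm
  rw [h]
  exact mor (Surface.degree_cylinder _)

theorem comp {a : A ⟶ B} {b : B ⟶ C} (ha : IsHomogeneous d a) (hb : IsHomogeneous e b) :
    IsHomogeneous (d + e) (a ≫ b) := by
  induction ha using AddSubgroup.closure_induction with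
  | mem a ha =>
    induction hb using AddSubgroup.closure_induction with
    | mem b hb =>
      obtain ⟨f, hf, rfl⟩ := ha
      obtain ⟨g, hg, rfl⟩ := hb
      have h : IsHomogeneous (d + e) (Surface.comp f g).mor :=
        mor (by rw [Surface.degree_comp, hf, hg])
      rwa [← Surface.mor_comp] at h
    | zero => rw [Limits.comp_zero]; exact zero
    | add b c _ _ h h' => rw [Preadditive.comp_add]; exact h.add h'
    | neg b _ h => rw [Preadditive.comp_neg]; exact AddSubgroup.neg_mem _ h
  | zero => rw [Limits.zero_comp]; exact zero
  | add b c _ _ h h' => rw [Preadditive.add_comp]; exact h.add h'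
  | neg b _ h => rw [Preadditive.neg_comp]; exact AddSubgroup.neg_mem _ h

end IsHomogeneous

namespace DegreeZero

variable {A B C : Mat_ Cobl}

theorem comp {a : A ⟶ B} {b : B ⟶ C} (ha : DegreeZero a) (hb : DegreeZero b) :
    DegreeZero (a ≫ b) := by
  intro i k
  rw [Mat_.comp_apply]
  exact IsHomogeneous.sum fun j _ => add_zero (0 : ℤ) ▸ (ha i j).comp (hb j k)

end DegreeZero

/-! ### The state sum model with roots `±t`, and independence of the powers of `H`. -/

theorem zpow_push {G₀ A : Type} [CommGroupWithZero G₀] {x : G₀} (hx : x ≠ 0) (s : Finset A)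
    (w : A → ℤ) : x ^ (∑ a ∈ s, w a) = ∏ a ∈ s, x ^ w a := by
  classical
  induction s using Finset.induction_on with
  | empty => simp
  | insert a s ha ih => rw [Finset.sum_insert ha, Finset.prod_insert ha, zpow_add₀ hx, ih]

/-- Multiplicative counterpart of summing over fibres: factors with the same image collect their
exponents. Nonvanishing is needed because genus zero contributes the exponent `-1`. -/
theorem prod_zpow_push {A B G₀ : Type} [Fintype A] [Fintype B] [CommGroupWithZero G₀]
    (p : A → B) (w : A → ℤ) {x : B → G₀} (hx : ∀ b, x b ≠ 0) :
    ∏ b, x b ^ push p w b = ∏ a, x (p a) ^ w a := by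
  classical
  have h : ∀ b, x b ^ push p w b = ∏ a, if p a = b then x b ^ w a else 1 := by
    intro b
    rw [push, zpow_push (hx b)]
    refine Finset.prod_congr rfl fun a _ => ?_
    split_ifs <;> simp
  rw [Finset.prod_congr rfl fun b _ => h b, Finset.prod_comm]
  simp

/-- The two square roots of `t ^ 2`. -/
def root (t : ℚ) (b : Bool) : ℚ := if b then t else -t

theorem root_ne_zero {t : ℚ} (ht : t ≠ 0) (b : Bool) : root t b ≠ 0 := by
  cases b <;> simpa [root]

open scoped Classical in
/-- The sum over all colourings by `root t` of a surface with components `K` which extend given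
colourings of its boundary; a component of genus `w + 1` and colour `r` contributes `r ^ w`, and
an outgoing boundary component of colour `r` contributes `r`. -/
noncomputable def stateSum {A B K : Type} [Fintype B] [Fintype K] (t : ℚ) (s : A → K) (u : B → K)
    (w : K → ℤ) : Matrix (A → Bool) (B → Bool) ℚ := fun a b =>
  (∏ y, root t (b y)) *
    ∑ κ : K → Bool, if κ ∘ s = a ∧ κ ∘ u = b then ∏ k, root t (κ k) ^ w k else 0

section

variable {A B C K L M : Type} [Fintype A] [Fintype B] [Fintype C] [Fintype K] [Fintype L]
  [Fintype M] {t : ℚ}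

theorem stateSum_apply [DecidableEq A] [DecidableEq B] [DecidableEq K] (s : A → K) (u : B → K)
    (w : K → ℤ) (a : A → Bool) (b : B → Bool) : stateSum t s u w a b = (∏ y, root t (b y)) *
      ∑ κ : K → Bool, if κ ∘ s = a ∧ κ ∘ u = b then ∏ k, root t (κ k) ^ w k else 0 := by
  unfold stateSum
  congr!

theorem stateSum_equiv (e : K ≃ L) {s : A → K} {u : B → K} {w : K → ℤ} {s' : A → L} {u' : B → L}
    {w' : L → ℤ} (hs : ∀ x, e (s x) = s' x) (hu : ∀ y, e (u y) = u' y)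
    (hw : ∀ k, w' (e k) = w k) : stateSum t s u w = stateSum t s' u' w' := by
  classical
  funext a b
  rw [stateSum_apply, stateSum_apply]
  congr 1
  refine (Fintype.sum_equiv (e.arrowCongr (Equiv.refl Bool)).symm _ _ fun κ => ?_).symm
  have h1 : κ ∘ s' = ((e.arrowCongr (Equiv.refl Bool)).symm κ) ∘ s := by
    funext x
    simp [Equiv.arrowCongr, hs]
  have h2 : κ ∘ u' = ((e.arrowCongr (Equiv.refl Bool)).symm κ) ∘ u := by
    funext x
    simp [Equiv.arrowCongr, hu]
  rw [h1, h2]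
  congr 1
  refine (Fintype.prod_equiv e _ _ fun k => ?_).symm
  simp [Equiv.arrowCongr, hw]

/-- The gluing law. A colouring of the glued surface is a pair of colourings of the pieces that
agree on the middle circles; `hsurj` and `hr` express this universal property of `M`. In `w` each
middle circle counts once more, and the missing factor is the weight which the first matrix gives to
its outgoing circles. -/
theorem stateSum_mul [DecidableEq B] (ht : t ≠ 0) {s₁ : A → K} {u₁ : B → K} {w₁ : K → ℤ} {s₂ : B → L}
    {u₂ : C → L} {w₂ : L → ℤ} (q : K ⊕ L → M) (w : M → ℤ)
    (hq : ∀ y, q (Sum.inl (u₁ y)) = q (Sum.inr (s₂ y))) (hsurj : ∀ m, ∃ a, q a = m)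
    (hr : ∀ φ : K ⊕ L → Bool, (∀ y, φ (Sum.inl (u₁ y)) = φ (Sum.inr (s₂ y))) →
      ∃ r : M → Bool, ∀ a, r (q a) = φ a)
    (hw : w = fun m => push q (Sum.elim w₁ w₂) m + push (fun y => q (Sum.inl (u₁ y))) (fun _ => 1) m) :
    stateSum t s₁ u₁ w₁ * stateSum t s₂ u₂ w₂
      = stateSum t (fun x => q (Sum.inl (s₁ x))) (fun z => q (Sum.inr (u₂ z))) w := by
  classical
  funext a c
  rw [Matrix.mul_apply]
  have hinj : ∀ r r' : M → Bool, (∀ a, r (q a) = r' (q a)) → r = r' := by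
    intro r r' h
    funext m
    obtain ⟨a, rfl⟩ := hsurj m
    exact h a
  have hprod : ∀ κ : M → Bool, ∏ m, root t (κ m) ^ w m
      = (∏ k, root t (κ (q (Sum.inl k))) ^ w₁ k) * (∏ l, root t (κ (q (Sum.inr l))) ^ w₂ l)
        * ∏ y, root t (κ (q (Sum.inl (u₁ y)))) := by
    intro κ
    have hne : ∀ m, root t (κ m) ≠ 0 := fun m => root_ne_zero ht _
    have e : ∀ m, root t (κ m) ^ w m = root t (κ m) ^ push q (Sum.elim w₁ w₂) m
        * root t (κ m) ^ push (fun y => q (Sum.inl (u₁ y))) (fun _ => 1) m := fun m => by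
      rw [hw, zpow_add₀ (hne m)]
    rw [Finset.prod_congr rfl fun m _ => e m, Finset.prod_mul_distrib,
      prod_zpow_push q _ hne, prod_zpow_push _ _ hne, Fintype.prod_sum_type]
    simp
  simp only [stateSum_apply]
  -- The colouring `κ` of the first piece determines the middle colouring as `κ ∘ u₁`. Isolating
  -- this condition lets the sum over `b` collapse in `hM`.
  have hL : ∀ b : B → Bool,
      ((∏ y, root t (b y)) *
          ∑ κ : K → Bool, if κ ∘ s₁ = a ∧ κ ∘ u₁ = b then ∏ k, root t (κ k) ^ w₁ k else 0)
        * ((∏ y, root t (c y)) *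
          ∑ κ : L → Bool, if κ ∘ s₂ = b ∧ κ ∘ u₂ = c then ∏ k, root t (κ k) ^ w₂ k else 0)
      = (∏ y, root t (c y)) * ∑ κ : K → Bool, ∑ κ' : L → Bool,
        if b = κ ∘ u₁ then if κ ∘ s₁ = a ∧ κ' ∘ s₂ = κ ∘ u₁ ∧ κ' ∘ u₂ = c then
          (∏ k, root t (κ k) ^ w₁ k) * (∏ k, root t (κ' k) ^ w₂ k) * ∏ y, root t (κ (u₁ y))
          else 0 else 0 := by
    intro b
    rw [mul_mul_mul_comm, Finset.sum_mul_sum, mul_comm (∏ y, root t (b y)), mul_assoc,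
      Finset.mul_sum]
    congr 1
    refine Finset.sum_congr rfl fun κ _ => ?_
    rw [Finset.mul_sum]
    refine Finset.sum_congr rfl fun κ' _ => ?_
    by_cases h : b = κ ∘ u₁
    · subst h
      by_cases h1 : κ ∘ s₁ = a <;> by_cases h2 : κ' ∘ s₂ = κ ∘ u₁ <;> by_cases h3 : κ' ∘ u₂ = c <;>
        simp [h1, h2, h3, mul_comm]
    · rw [if_neg h, if_neg (fun h' => h h'.2.symm)]
      simp
  rw [Finset.sum_congr rfl fun b _ => hL b, ← Finset.mul_sum]
  congr 1
  rw [Finset.sum_comm]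
  have hM : ∀ κ : K → Bool, ∑ b : B → Bool, ∑ κ' : L → Bool,
      (if b = κ ∘ u₁ then if κ ∘ s₁ = a ∧ κ' ∘ s₂ = κ ∘ u₁ ∧ κ' ∘ u₂ = c then
          (∏ k, root t (κ k) ^ w₁ k) * (∏ k, root t (κ' k) ^ w₂ k) * ∏ y, root t (κ (u₁ y))
          else 0 else 0)
      = ∑ κ' : L → Bool, if κ ∘ s₁ = a ∧ κ' ∘ s₂ = κ ∘ u₁ ∧ κ' ∘ u₂ = c then
          (∏ k, root t (κ k) ^ w₁ k) * (∏ k, root t (κ' k) ^ w₂ k) * ∏ y, root t (κ (u₁ y))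
          else 0 := by
    intro κ
    rw [Finset.sum_comm]
    simp
  rw [Finset.sum_congr rfl fun κ _ => hM κ, ← Fintype.sum_prod_type', ← Finset.sum_filter,
    ← Finset.sum_filter]
  symm
  -- Restriction to the two pieces matches the colourings of `M` with the compatible pairs.
  refine Finset.sum_bij (fun κ _ => ((fun k => κ (q (Sum.inl k))), fun l => κ (q (Sum.inr l))))
    ?_ ?_ ?_ ?_
  · intro κ hκ
    obtain ⟨h1, h2⟩ := (Finset.mem_filter.1 hκ).2
    refine Finset.mem_filter.2 ⟨Finset.mem_univ _, h1, ?_, h2⟩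
    funext y
    exact congrArg κ (hq y).symm
  · intro κ _ κ' _ h
    rw [Prod.mk.injEq] at h
    refine hinj _ _ fun a => ?_
    rcases a with a | a
    · exact congrFun h.1 a
    · exact congrFun h.2 a
  · rintro ⟨κ, κ'⟩ h
    obtain ⟨h1, h2, h3⟩ := (Finset.mem_filter.1 h).2
    obtain ⟨r, hr⟩ := hr (Sum.elim κ κ') fun y => (congrFun h2 y).symm
    refine ⟨r, Finset.mem_filter.2 ⟨Finset.mem_univ _, ?_, ?_⟩, ?_⟩
    · rw [← h1]
      funext x
      exact hr _
    · rw [← h3]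
      funext x
      exact hr _
    · exact Prod.ext (funext fun k => hr _) (funext fun k => hr _)
  · intro κ _
    exact hprod κ

/-- Each cylinder has weight `r⁻¹` and one outgoing circle of weight `r`, so these cancel; the
colours at its two ends must agree. -/
theorem stateSum_one [DecidableEq A] (ht : t ≠ 0) : stateSum t (id : A → A) id (fun _ => -1) = 1 := by
  funext a b
  rw [stateSum_apply, Matrix.one_apply]
  have h : ∀ κ : A → Bool, (if κ ∘ id = a ∧ κ ∘ id = b then ∏ k, root t (κ k) ^ (-1 : ℤ) else 0)
      = if κ = b then if a = b then ∏ k, (root t (b k))⁻¹ else 0 else 0 := by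
    intro κ
    rw [Function.comp_id]
    by_cases h : κ = b
    · subst h
      simp [eq_comm]
    · simp [h]
  rw [Finset.sum_congr rfl fun κ _ => h κ, Finset.sum_ite_eq' Finset.univ b,
    if_pos (Finset.mem_univ _), mul_ite, mul_zero, Finset.prod_inv_distrib, mul_inv_cancel₀]
  exact Finset.prod_ne_zero_iff.2 fun _ _ => root_ne_zero ht _
end

-- This is `sum_quot_merge` started at equality and enlarged by the single pair `(i, j)`: only the
-- class of `i` can have two points, and it does so exactly when `i ≠ j`.
open scoped Classical in
theorem push_quot_pair {A : Type} [Fintype A] (i j : A) (K : Quot fun a b : A => a = i ∧ b = j) :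
    push (Quot.mk fun a b : A => a = i ∧ b = j) (fun _ => 1) K
      = 1 + if i = j then 0 else if Quot.mk _ i = K then 1 else 0 := by
  have hij : Quot.mk (fun a b : A => a = i ∧ b = j) i = Quot.mk _ j := Quot.sound ⟨rfl, rfl⟩
  have h := sum_quot_merge (fun a b : A => a = b) (fun a b => a = i ∧ b = j) i j
    (Quot.lift (Quot.mk _) fun a b h => congrArg _ h) (fun _ => rfl) hij
    (by
      rintro φ - h a b ⟨rfl, rfl⟩
      exact h) (fun c => if c = K then 1 else 0)
  let e : A ≃ Quot fun a b : A => a = b :=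
    ⟨Quot.mk _, Quot.lift id fun _ _ h => h, fun _ => rfl, by rintro ⟨a⟩; rfl⟩
  have h1 : (Quot.mk (fun a b : A => a = b) i = Quot.mk _ j) ↔ i = j := e.apply_eq_iff_eq
  rw [← Equiv.sum_comp e] at h
  simp only [Finset.sum_ite_eq', Finset.mem_univ, if_true, h1] at h
  exact h

namespace Surface

variable {X Y Z : Tangle}

/-- The genera of a surface with a tube attached. -/
noncomputable def tubeGenus (f : Surface X Y) (i j : Fin f.n)
    (K : Quot fun a b : Fin f.n => a = i ∧ b = j) : ℕ :=
  open scoped Classical in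
  (∑ k, if Quot.mk _ k = K then f.genus k else 0) + if i = j ∧ Quot.mk _ i = K then 1 else 0

theorem tube_eq (f : Surface X Y) (i j : Fin f.n) : f.tube i j =
    of (Quot fun a b : Fin f.n => a = i ∧ b = j) (fun x => Quot.mk _ (f.src x))
      (fun y => Quot.mk _ (f.tgt y)) (congrArg _ f.curtain) (f.tubeGenus i j) := rfl

/-- A tube raises genus minus one by one in both cases: either the genus of one component grows, or
two summands `-1` become one. In this form the distinction between `i = j` and `i ≠ j` disappears.
-/
theorem tubeGenus_eq (f : Surface X Y) (i j : Fin f.n)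
    (K : Quot fun a b : Fin f.n => a = i ∧ b = j) : (f.tubeGenus i j K : ℤ) - 1
      = push (Quot.mk _) (fun k => (f.genus k : ℤ) - 1) K
        + push (fun _ : Unit => Quot.mk _ i) (fun _ => 1) K := by
  classical
  have h1 := push_quot_pair i j K
  have h2 : push (Quot.mk fun a b : Fin f.n => a = i ∧ b = j)
      (fun k => (f.genus k : ℤ) - 1 + 1) K = _ := push_add _ _ _ K
  have h3 : push (Quot.mk fun a b : Fin f.n => a = i ∧ b = j)
      (fun k => (f.genus k : ℤ) - 1 + 1) K
      = ((∑ k, if Quot.mk _ k = K then f.genus k else 0 : ℕ) : ℤ) := by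
    simp [push]
  have h4 : push (fun _ : Unit => Quot.mk (fun a b : Fin f.n => a = i ∧ b = j) i) (fun _ => 1) K
      = if Quot.mk _ i = K then 1 else 0 := by
    simp [push]
  have h5 : (f.tubeGenus i j K : ℤ) = ((∑ k, if Quot.mk _ k = K then f.genus k else 0 : ℕ) : ℤ)
      + if i = j ∧ Quot.mk _ i = K then 1 else 0 := by
    unfold tubeGenus
    push_cast
    congr!
  rw [h5, ← h3, h2, h1, h4]
  split_ifs <;> first | ring1 | tauto

/-- The matrix of a surface in the state sum model. -/
noncomputable def matrix (t : ℚ) (f : Surface X Y) :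
    Matrix (X.comps → Bool) (Y.comps → Bool) ℚ :=
  stateSum t f.src f.tgt fun k => (f.genus k : ℤ) - 1

variable {t : ℚ}

theorem matrix_homeo {f f' : Surface X Y} (h : Homeo f f') : f.matrix t = f'.matrix t := by
  obtain ⟨e, h1, h2, h3⟩ := h
  exact stateSum_equiv e h1 h2 fun k => by rw [h3]

theorem matrix_of (K : Type) [Fintype K] (s : X.comps → K) (u : Y.comps → K)
    (h : s X.line = u Y.line) (g : K → ℕ) :
    (of K s u h g).matrix t = stateSum t s u fun k => (g k : ℤ) - 1 := by
  symm
  refine stateSum_equiv (Fintype.equivFin K) (fun _ => rfl) (fun _ => rfl) fun k => ?_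
  change (g ((Fintype.equivFin K).symm (Fintype.equivFin K k)) : ℤ) - 1 = _
  rw [Equiv.symm_apply_apply]

theorem matrix_cylinder [DecidableEq X.comps] (ht : t ≠ 0) : (cylinder X).matrix t = 1 := by
  rw [cylinder, matrix_of, ← stateSum_one ht]
  rfl

theorem matrix_comp [DecidableEq Y.comps] (ht : t ≠ 0) (f : Surface X Y) (g : Surface Y Z) :
    (comp f g).matrix t = f.matrix t * g.matrix t := by
  refine (stateSum_mul ht (cls f g) _ (cls_glue f g) (cls_surjective f g)
    (fun φ h => ⟨desc f g φ h, desc_cls f g φ h⟩) ?_).symm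
  rw [comp_genus]
  congr! 3
  funext a
  rcases a with a | a <;> rfl

/-- No boundary constrains the colour of a closed component, so the sum over its two colours factors
out. -/
theorem matrix_addClosed (f : Surface X Y) (g : ℕ) : (f.addClosed g).matrix t
    = (root t true ^ ((g : ℤ) - 1) + root t false ^ ((g : ℤ) - 1)) • f.matrix t := by
  classical
  rw [addClosed, matrix_of]
  funext a b
  rw [Matrix.smul_apply, matrix, stateSum_apply, stateSum_apply, smul_eq_mul, mul_left_comm]
  congr 1
  rw [← (Equiv.piOptionEquivProd (β := fun _ : Option (Fin f.n) => Bool)).symm.sum_comp,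
    Fintype.sum_prod_type, Fintype.sum_bool, add_mul, Finset.mul_sum, Finset.mul_sum]
  congr 1 <;>
  · refine Finset.sum_congr rfl fun κ _ => ?_
    rw [Fintype.prod_option, mul_ite, mul_zero]
    rfl

-- Colourings of the tubed surface are the colourings of `f` with equal colours at `i` and `j`, and
-- by `tubeGenus_eq` the tube multiplies their weight by that common root.
open scoped Classical in
theorem matrix_tube (ht : t ≠ 0) (f : Surface X Y) (i j : Fin f.n) (a : X.comps → Bool)
    (b : Y.comps → Bool) : (f.tube i j).matrix t a b = (∏ y, root t (b y)) *
      ∑ κ : Fin f.n → Bool, if κ ∘ f.src = a ∧ κ ∘ f.tgt = b then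
        (∏ k, root t (κ k) ^ ((f.genus k : ℤ) - 1)) * (if κ i = κ j then root t (κ i) else 0)
      else 0 := by
  rw [tube_eq, matrix_of, stateSum_apply]
  congr 1
  have h : ∀ κ : Fin f.n → Bool, (if κ ∘ f.src = a ∧ κ ∘ f.tgt = b then
        (∏ k, root t (κ k) ^ ((f.genus k : ℤ) - 1)) * (if κ i = κ j then root t (κ i) else 0)
      else 0) = if κ i = κ j ∧ κ ∘ f.src = a ∧ κ ∘ f.tgt = b then
        (∏ k, root t (κ k) ^ ((f.genus k : ℤ) - 1)) * root t (κ i) else 0 := by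
    intro κ
    by_cases h : κ i = κ j <;> simp [h]
  rw [Finset.sum_congr rfl fun κ _ => h κ, ← Finset.sum_filter, ← Finset.sum_filter]
  have hij : Quot.mk (fun a b : Fin f.n => a = i ∧ b = j) i = Quot.mk _ j := Quot.sound ⟨rfl, rfl⟩
  refine Finset.sum_bij (fun κ _ k => κ (Quot.mk _ k)) ?_ ?_ ?_ ?_
  · intro κ hκ
    exact Finset.mem_filter.2 ⟨Finset.mem_univ _, congrArg κ hij, (Finset.mem_filter.1 hκ).2⟩
  · intro κ _ κ' _ h
    funext K
    induction K using Quot.ind with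
    | mk k => exact congrFun h k
  · intro κ hκ
    obtain ⟨h1, h2⟩ := (Finset.mem_filter.1 hκ).2
    exact ⟨Quot.lift κ (by rintro a b ⟨rfl, rfl⟩; exact h1),
      Finset.mem_filter.2 ⟨Finset.mem_univ _, h2⟩, rfl⟩
  · intro κ _
    have hne : ∀ K, root t (κ K) ≠ 0 := fun K => root_ne_zero ht _
    simp only [tubeGenus_eq, zpow_add₀ (hne _)]
    rw [Finset.prod_mul_distrib, prod_zpow_push _ _ hne, prod_zpow_push _ _ hne]
    simp

/-- As the two roots are opposite, the factor of a tube is half the sum of the roots at its ends: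
the root itself if they agree, zero otherwise. Both sides therefore weigh a colouring by half the
sum of the four roots. -/
theorem matrix_fourTube (ht : t ≠ 0) (f : Surface X Y) (k₁ k₂ k₃ k₄ : Fin f.n) :
    (f.tube k₁ k₂).matrix t + (f.tube k₃ k₄).matrix t
      = (f.tube k₁ k₃).matrix t + (f.tube k₂ k₄).matrix t := by
  classical
  funext a b
  rw [Matrix.add_apply, Matrix.add_apply, matrix_tube ht, matrix_tube ht, matrix_tube ht,
    matrix_tube ht, ← mul_add, ← mul_add, ← Finset.sum_add_distrib, ← Finset.sum_add_distrib]
  congr 1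
  refine Finset.sum_congr rfl fun κ _ => ?_
  by_cases h : κ ∘ f.src = a ∧ κ ∘ f.tgt = b
  · rw [if_pos h, if_pos h, if_pos h, if_pos h, ← mul_add, ← mul_add]
    congr 1
    cases κ k₁ <;> cases κ k₂ <;> cases κ k₃ <;> cases κ k₄ <;> simp [root]
  · simp only [if_neg h]

end Surface

open scoped Classical in
/-- The linear map between spaces spanned by colourings given by a matrix. -/
noncomputable def stateMap (X Y : Tangle) : Matrix (X.comps → Bool) (Y.comps → Bool) ℚ →+
    (ModuleCat.of ℚ ((X.comps → Bool) → ℚ) ⟶ ModuleCat.of ℚ ((Y.comps → Bool) → ℚ)) where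
  toFun M := ModuleCat.ofHom (Matrix.vecMulLinear M)
  map_zero' := by
    ext1
    exact LinearMap.ext fun v => Matrix.vecMul_zero v
  map_add' M N := by
    ext1
    exact LinearMap.ext fun v => Matrix.vecMul_add M N v

open scoped Classical in
theorem stateMap_one (X : Tangle) : stateMap X X 1 = 𝟙 _ := by
  ext1
  exact LinearMap.ext fun v => Matrix.vecMul_one v

open scoped Classical in
theorem stateMap_mul {X Y Z : Tangle} (M : Matrix (X.comps → Bool) (Y.comps → Bool) ℚ)
    (N : Matrix (Y.comps → Bool) (Z.comps → Bool) ℚ) :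
    stateMap X Z (M * N) = stateMap X Y M ≫ stateMap Y Z N := by
  ext1
  exact LinearMap.ext fun v => (Matrix.vecMul_vecMul v M N).symm

open scoped Classical in
theorem stateMap_single {X Y : Tangle} (M : Matrix (X.comps → Bool) (Y.comps → Bool) ℚ)
    (a : X.comps → Bool) (b : Y.comps → Bool) :
    (stateMap X Y M).hom (Pi.single a (1 : ℚ) : (X.comps → Bool) → ℚ) b = M a b :=
  congrFun (Matrix.single_one_vecMul a M) b

/-- The state sum model as a functor: the space of a flat tangle has the colourings of its
components as a basis. -/
noncomputable def stateFunctor (t : ℚ) (ht : t ≠ 0) : Tangle ⥤ ModuleCat.{0} ℚ where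
  obj X := ModuleCat.of ℚ ((X.comps → Bool) → ℚ)
  map {X Y} f := stateMap X Y (Quotient.lift (s := Surface.setoid X Y) (Surface.matrix t)
    (fun _ _ h => Surface.matrix_homeo h) f)
  map_id X := by
    classical
    refine Eq.trans ?_ (stateMap_one X)
    exact congrArg (stateMap X X) (Surface.matrix_cylinder ht)
  map_comp {X Y Z} f g := by
    classical
    induction f using Quotient.ind with
    | _ f =>
    induction g using Quotient.ind with
    | _ g =>
    refine Eq.trans ?_ (stateMap_mul _ _)
    exact congrArg (stateMap X Z) (Surface.matrix_comp ht f g)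

/-- The `ℤ`-linear extension of the state sum model. -/
noncomputable abbrev linearStateFunctor (t : ℚ) (ht : t ≠ 0) : Free ℤ Tangle ⥤ ModuleCat.{0} ℚ :=
  Free.lift ℤ (stateFunctor t ht)

theorem linearStateFunctor_toFree (t : ℚ) (ht : t ≠ 0) {X Y : Tangle} (f : Surface X Y) :
    (linearStateFunctor t ht).map f.toFree = stateMap X Y (f.matrix t) :=
  (Free.lift_map_single ℤ (stateFunctor t ht) (Quotient.mk (Surface.setoid X Y) f) 1).trans
    (one_smul _ _)

/-- A closed component of genus `g` has the value `t ^ (g - 1) + (-t) ^ (g - 1)`, which is `0` for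
the sphere and `2` for the torus; 4TU is `matrix_fourTube`. The other constructors only say that the
kernel of an additive functor is an ideal. -/
theorem linearStateFunctor_negligible (t : ℚ) (ht : t ≠ 0) {X Y : Free ℤ Tangle} {a : X ⟶ Y}
    (h : Negligible a) : (linearStateFunctor t ht).map a = 0 := by
  induction h with
  | @sphere X Y f =>
    have h : root t true ^ (((0 : ℕ) : ℤ) - 1) + root t false ^ (((0 : ℕ) : ℤ) - 1) = 0 := by
      simp [root, zpow_neg]
    rw [linearStateFunctor_toFree, Surface.matrix_addClosed, h, zero_smul, map_zero]
    rfl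
  | @torus X Y f =>
    have h : root t true ^ (((1 : ℕ) : ℤ) - 1) + root t false ^ (((1 : ℕ) : ℤ) - 1) = 1 + 1 := by
      simp
    rw [Functor.map_sub, Functor.map_add, linearStateFunctor_toFree, linearStateFunctor_toFree,
      Surface.matrix_addClosed, h, add_smul, one_smul, map_add]
    exact sub_self _
  | @fourTube X Y f k₁ k₂ k₃ k₄ =>
    rw [Functor.map_sub, Functor.map_add, Functor.map_add, linearStateFunctor_toFree,
      linearStateFunctor_toFree, linearStateFunctor_toFree, linearStateFunctor_toFree]
    refine sub_eq_zero_of_eq ?_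
    exact (map_add (stateMap X Y) _ _).symm.trans ((congrArg (stateMap X Y)
      (Surface.matrix_fourTube ht f k₁ k₂ k₃ k₄)).trans (map_add (stateMap X Y) _ _))
  | zero X Y => exact Functor.map_zero _ _ _
  | add _ _ h h' => rw [Functor.map_add, h, h', add_zero]
  | neg _ h => rw [Functor.map_neg, h, neg_zero]
  | comp_left a _ h => rw [Functor.map_comp, h, Limits.comp_zero]
  | comp_right b _ h => rw [Functor.map_comp, h, Limits.zero_comp]

/-- The state sum model on cobordisms modulo the local relations. -/
noncomputable def coblStateFunctor (t : ℚ) (ht : t ≠ 0) : Cobl ⥤ ModuleCat.{0} ℚ :=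
  CategoryTheory.Quotient.lift localRel (linearStateFunctor t ht) fun X Y a b h => by
    rw [← sub_eq_zero, ← Functor.map_sub]
    exact linearStateFunctor_negligible t ht h

instance (t : ℚ) (ht : t ≠ 0) : (coblStateFunctor t ht).Additive where
  map_add {X Y a b} := by
    induction a using Quot.ind with
    | _ a =>
    induction b using Quot.ind with
    | _ b => exact (linearStateFunctor t ht).map_add

theorem coblStateFunctor_mor (t : ℚ) (ht : t ≠ 0) {X Y : Tangle} (f : Surface X Y) :
    (coblStateFunctor t ht).map f.mor = stateMap X Y (f.matrix t) :=
  linearStateFunctor_toFree t ht f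

/-- The boundary fixes the colour of the curtain; its weight `t ^ (k - 1)` is completed to `t ^ k`
by the outgoing line. -/
theorem matrix_curtain {t : ℚ} (ht : t ≠ 0) (m m' : ℤ) (k : ℕ) :
    (curtain m m' k).matrix t (fun _ => true) (fun _ => true) = t ^ k := by
  classical
  rw [curtain, Surface.matrix_of, stateSum_apply,
    Finset.sum_eq_single (fun _ => true : Unit → Bool), if_pos ⟨rfl, rfl⟩]
  · have h : Fintype.card (lineTangle m').comps = 1 := rfl
    simp only [root, if_true, Finset.prod_const, Finset.card_univ, h, pow_one,
      Fintype.card_unit]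
    rw [zpow_sub₀ ht, zpow_natCast, zpow_one, mul_div_cancel₀ _ ht]
  · intro κ _ hκ
    exact if_neg fun h => hκ h.1
  · intro h
    exact absurd (Finset.mem_univ _) h

/-- For each `t ≠ 0` the model evaluates the combination given by `p` to `p(t)` at the colour
`true`. If the combination is zero, `p` has infinitely many rational roots. -/
theorem polyMor_injective (m m' : ℤ) : Function.Injective (polyMor m m') := by
  classical
  rw [injective_iff_map_eq_zero]
  intro p hp
  let v : (Unit → Bool) → ℚ := Pi.single (fun _ => true) 1
  have key : ∀ (t : ℚ) (ht : t ≠ 0) (q : Polynomial ℤ),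
      ((coblStateFunctor t ht).map (polyMor m m' q)).hom v (fun _ => true : Unit → Bool)
        = q.aeval t := by
    intro t ht q
    induction q using Polynomial.induction_on' with
    | add q q' h h' =>
      rw [map_add, Functor.map_add, map_add, ← h, ← h']
      rfl
    | monomial k a =>
      have h : a • (coblStateFunctor t ht).map (curtain m m' k).mor
          = stateMap _ _ (a • (curtain m m' k).matrix t) :=
        (congrArg (a • ·) (coblStateFunctor_mor t ht _)).trans
          (map_zsmul (stateMap (lineTangle m) (lineTangle m')) a _).symm
      rw [polyMor_monomial, Functor.map_zsmul, h, Polynomial.aeval_monomial,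
        ← matrix_curtain ht m m' k]
      exact (stateMap_single (a • (curtain m m' k).matrix t) _ _).trans (zsmul_eq_mul _ a)
  -- The value `t = 0` is not available, as the weights contain negative powers of `t`; the
  -- remaining rationals suffice.
  have h0 : ∀ t : ℚ, t ≠ 0 → (p.map (Int.castRingHom ℚ)).eval t = 0 := by
    intro t ht
    have h := key t ht p
    rw [hp, Functor.map_zero] at h
    rw [Polynomial.eval_map]
    exact h.symm
  have h1 : p.map (Int.castRingHom ℚ) = 0 := by
    refine Polynomial.eq_zero_of_infinite_isRoot _ ?_
    refine Set.Infinite.mono (s := {0}ᶜ) (fun t ht => h0 t ht) ?_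
    exact (Set.finite_singleton (0 : ℚ)).infinite_compl
  exact (Polynomial.map_eq_zero_iff (RingHom.injective_int _)).1 h1

/-! ### Trading closed components for handles on the curtain. -/

namespace Surface

variable {X Y Z : Tangle}

theorem mor_sphere (f : Surface X Y) : (f.addClosed 0).mor = 0 := by
  refine CategoryTheory.Quotient.sound localRel ?_
  have h := Negligible.sphere f
  rw [← sub_zero (f.addClosed 0).toFree] at h
  exact h

theorem mor_fourTube (f : Surface X Y) (k₁ k₂ k₃ k₄ : Fin f.n) :
    (f.tube k₁ k₂).mor + (f.tube k₃ k₄).mor = (f.tube k₁ k₃).mor + (f.tube k₂ k₄).mor :=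
  CategoryTheory.Quotient.sound localRel (Negligible.fourTube f k₁ k₂ k₃ k₄)

open scoped Classical in
/-- Recognition of surfaces with a tube attached. -/
theorem tube_of_homeo {K L : Type} [Fintype K] [Fintype L] {s : X.comps → K} {u : Y.comps → K}
    {h : s X.line = u Y.line} {g : K → ℕ} {s' : X.comps → L} {u' : Y.comps → L}
    {h' : s' X.line = u' Y.line} {g' : L → ℕ} (q : K → L) (i j : K)
    (hsurj : Function.Surjective q) (hij : q i = q j)
    (hq : ∀ a b, q a = q b → a = b ∨ (a = i ∧ b = j) ∨ (a = j ∧ b = i))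
    (hs : ∀ x, q (s x) = s' x) (hu : ∀ y, q (u y) = u' y)
    (hg : ∀ l, (g' l : ℤ) - 1 = push q (fun k => (g k : ℤ) - 1) l + if q i = l then 1 else 0) :
    Homeo ((of K s u h g).tube (Fintype.equivFin K i) (Fintype.equivFin K j))
      (of L s' u' h' g') := by
  let ε : K ≃ Fin (of K s u h g).n := Fintype.equivFin K
  let R : Fin (of K s u h g).n → Fin (of K s u h g).n → Prop := fun a b => a = ε i ∧ b = ε j
  let p : Quot R → L := Quot.lift (fun a => q (ε.symm a)) (by
    rintro a b ⟨rfl, rfl⟩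
    simp [hij])
  have hp : Function.Bijective p := by
    constructor
    · rintro ⟨a⟩ ⟨b⟩ hab
      rcases hq _ _ hab with h | ⟨h1, h2⟩ | ⟨h1, h2⟩
      · rw [ε.symm.injective h]
      · exact Quot.sound ⟨by rw [← h1, ε.apply_symm_apply], by rw [← h2, ε.apply_symm_apply]⟩
      · exact (Quot.sound ⟨by rw [← h2, ε.apply_symm_apply], by rw [← h1, ε.apply_symm_apply]⟩ :
          Quot.mk R b = Quot.mk R a).symm
    · intro l
      obtain ⟨k, rfl⟩ := hsurj l
      exact ⟨Quot.mk _ (ε k), congrArg q (ε.symm_apply_apply k)⟩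
  let e := Equiv.ofBijective p hp
  refine of_homeo e (fun x => ?_) (fun y => ?_) fun c => ?_
  · refine Eq.trans ?_ (hs x)
    exact congrArg q (ε.symm_apply_apply _)
  · refine Eq.trans ?_ (hu y)
    exact congrArg q (ε.symm_apply_apply _)
  · have h1 := tubeGenus_eq (of K s u h g) (ε i) (ε j) c
    have h2 := hg (e c)
    have h3 : push q (fun k => (g k : ℤ) - 1) (e c)
        = push (Quot.mk R) (fun k => ((of K s u h g).genus k : ℤ) - 1) c := by
      have h4 := push_equiv ε (e ∘ Quot.mk R) fun k => ((of K s u h g).genus k : ℤ) - 1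
      rw [← push_push] at h4
      rw [← push_injective e e.injective (push (Quot.mk R) _) c, ← h4]
      congr 1
      · funext k
        exact (congrArg q (ε.symm_apply_apply k)).symm
      · funext k
        exact congrArg (fun a => (g a : ℤ) - 1) (ε.symm_apply_apply k).symm
    have h5 : (if q i = e c then (1 : ℤ) else 0)
        = push (fun _ : Unit => Quot.mk R (ε i)) (fun _ => 1) c := by
      have h6 : e (Quot.mk R (ε i)) = q i := congrArg q (ε.symm_apply_apply i)
      rw [← h6]
      simp [push]
    rw [h3, h5] at h2
    have h7 := h2.trans h1.symm
    have h8 : g' (e c) = (of K s u h g).tubeGenus (ε i) (ε j) c := by omega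
    exact h8

/-- Add handles to the curtain. -/
def addGenus (f : Surface X Y) (j : ℕ) : Surface X Y :=
  { f with genus := fun k => f.genus k + if k = f.src X.line then j else 0 }

theorem sum_addGenus (f : Surface X Y) (j : ℕ) :
    ∑ k : Fin f.n, (((f.addGenus j).genus k : ℤ) - 1) = ∑ k, ((f.genus k : ℤ) - 1) + j := by
  have h : ∀ k : Fin f.n, (((f.addGenus j).genus k : ℤ) - 1)
      = ((f.genus k : ℤ) - 1) + if k = f.src X.line then (j : ℤ) else 0 := by
    intro k
    simp only [addGenus]
    push_cast
    split_ifs <;> ring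
  refine (Finset.sum_congr rfl fun k _ => h k).trans ?_
  rw [Finset.sum_add_distrib]
  simp

theorem addGenus_addGenus (f : Surface X Y) (i j : ℕ) :
    (f.addGenus i).addGenus j = f.addGenus (i + j) := by
  simp only [addGenus, mk.injEq, heq_eq_eq, true_and]
  funext k
  change f.genus k + (if k = f.src X.line then i else 0) + (if k = f.src X.line then j else 0)
    = f.genus k + if k = f.src X.line then i + j else 0
  split_ifs <;> omega

/-- 4TU with two discs on the closed component and two on the curtain: a tube within either one adds
a handle there, and a tube between them merges the closed component into the curtain, which thereby
gains its genus. -/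
theorem mor_addClosed_succ (f : Surface X Y) (g : ℕ) :
    (f.addClosed (g + 1)).mor + ((f.addGenus 1).addClosed g).mor
      = (f.addGenus g).mor + (f.addGenus g).mor := by
  classical
  let ε := Fintype.equivFin (Option (Fin f.n))
  let c : Option (Fin f.n) := some (f.src X.line)
  have h := mor_fourTube (f.addClosed g) (ε none) (ε none) (ε c) (ε c)
  have h1 : Homeo ((f.addClosed g).tube (ε none) (ε none)) (f.addClosed (g + 1)) := by
    refine tube_of_homeo id none none Function.surjective_id rfl (fun a b h => Or.inl h)
      (fun _ => rfl) (fun _ => rfl) fun l => ?_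
    have := push_injective id Function.injective_id (fun k : Option (Fin f.n) => ((k.elim g f.genus : ℕ) : ℤ) - 1) l
    rw [id] at this
    rw [this]
    cases l <;> simp
  have h2 : Homeo ((f.addClosed g).tube (ε c) (ε c)) ((f.addGenus 1).addClosed g) := by
    refine tube_of_homeo id c c Function.surjective_id rfl (fun a b h => Or.inl h)
      (fun _ => rfl) (fun _ => rfl) fun l => ?_
    have := push_injective id Function.injective_id (fun k : Option (Fin f.n) => ((k.elim g f.genus : ℕ) : ℤ) - 1) l
    rw [id] at this
    rw [this]
    cases l with
    | none => simp [c]; rfl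
    | some l =>
      simp only [Option.elim_some, addGenus, c, id, Option.some.injEq, eq_comm (a := f.src X.line)]
      split_ifs <;> simp
  have h3 : Homeo ((f.addClosed g).tube (ε none) (ε c)) (f.addGenus g) := by
    refine Homeo.trans ?_ (homeo_of _).symm
    refine tube_of_homeo (L := Fin f.n) (fun k => k.getD (f.src X.line)) none c (fun k => ⟨some k, rfl⟩) rfl ?_
      (fun _ => rfl) (fun _ => rfl) fun (l : Fin f.n) => ?_
    · rintro (_ | a) (_ | b) h
      · exact Or.inl rfl
      · exact Or.inr (Or.inl ⟨rfl, congrArg some h.symm⟩)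
      · exact Or.inr (Or.inr ⟨congrArg some h, rfl⟩)
      · exact Or.inl (congrArg some h)
    · simp only [push, Fintype.sum_option, Option.getD_none, Option.getD_some, Option.elim_none,
        Option.elim_some, addGenus, eq_comm (a := f.src X.line)]
      have h := Finset.sum_ite_eq' Finset.univ l fun k => (f.genus k : ℤ) - 1
      rw [if_pos (Finset.mem_univ _)] at h
      rw [h]
      split_ifs <;> push_cast <;> ring
  rw [mor_eq h1, mor_eq h2, mor_eq h3] at h
  exact h

/-- The coefficients satisfy `a₀ = 0`, by S, and `a₍g+1₎ = 2 - a₍g₎`, hence alternate between `0`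
and `2`; the value of the torus is thus a consequence of S and 4TU. The clause on `g = 0` guards
against the truncated subtraction in `g - 1`. -/
theorem exists_mor_addClosed (g : ℕ) (f : Surface X Y) :
    ∃ a : ℤ, (f.addClosed g).mor = a • (f.addGenus (g - 1)).mor ∧ (g = 0 → a = 0) := by
  induction g generalizing f with
  | zero => exact ⟨0, by rw [mor_sphere, zero_smul], fun _ => rfl⟩
  | succ g ih =>
    obtain ⟨a, ha, h0⟩ := ih (f.addGenus 1)
    have h := eq_sub_of_add_eq (mor_addClosed_succ f g)
    refine ⟨2 - a, ?_, fun h => absurd h (Nat.succ_ne_zero g)⟩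
    rw [h, ha, addGenus_addGenus, Nat.add_sub_cancel, sub_smul, two_smul]
    -- The handle counts `1 + (g - 1)` and `g` differ only for `g = 0`, where the coefficient `a`
    -- vanishes.
    rcases Nat.eq_zero_or_pos g with rfl | hg
    · rw [h0 rfl, zero_smul, zero_smul]
    · rw [Nat.add_sub_cancel' hg]

/-- The whole boundary lies on the curtain, so every other component is closed and can be traded for
handles. A closed component of genus `g ≥ 1` becomes `g - 1` handles, which preserves the total of
genus minus one; this gives the formula for `k`. Spheres would violate it, but they make the
coefficient zero. -/
theorem exists_mor_lineTangle {m m' : ℤ} (f : Surface (lineTangle m) (lineTangle m')) :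
    ∃ (a : ℤ) (k : ℕ), f.mor = a • (BarNatan.curtain m m' k).mor ∧
      (a ≠ 0 → (k : ℤ) = ∑ i, ((f.genus i : ℤ) - 1) + 1) := by
  obtain ⟨n, src, tgt, hc, genus⟩ := f
  induction n with
  | zero => exact (src ()).elim0
  | succ n ih =>
    by_cases hn : ∃ i, i ≠ src ()
    · obtain ⟨i, hi⟩ := hn
      obtain ⟨j, hj⟩ := Fin.exists_succAbove_eq hi.symm
      -- The surface without its closed component `i`; the index `j` is that of the curtain after
      -- this removal.
      let f' : Surface (lineTangle m) (lineTangle m') :=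
        ⟨n, fun _ => j, fun _ => j, rfl, fun k => genus (i.succAbove k)⟩
      have h1 : Homeo (⟨n + 1, src, tgt, hc, genus⟩ : Surface (lineTangle m) (lineTangle m'))
          (f'.addClosed (genus i)) := by
        refine (homeo_of _).trans ?_
        refine of_homeo (finSuccEquiv' i) (fun x => ?_) (fun y => ?_) fun k => ?_
        · exact (congrArg (finSuccEquiv' i) hj.symm).trans (finSuccEquiv'_succAbove i j)
        · have : tgt y = src () := hc.symm
          exact (congrArg (finSuccEquiv' i) this).trans <| (congrArg (finSuccEquiv' i) hj.symm).trans (finSuccEquiv'_succAbove i j)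
        · obtain ⟨o, rfl⟩ := (finSuccEquiv' i).symm.surjective k
          rw [Equiv.apply_symm_apply]
          cases o <;> simp [f']
      obtain ⟨a, ha, h0⟩ := exists_mor_addClosed (genus i) f'
      obtain ⟨b, k, hb, hk⟩ := ih (f'.addGenus (genus i - 1)).src (f'.addGenus (genus i - 1)).tgt
        (f'.addGenus (genus i - 1)).curtain (f'.addGenus (genus i - 1)).genus
      refine ⟨a * b, k, ?_, fun hab => ?_⟩
      · rw [mor_eq h1, ha, mul_smul]
        exact congrArg (a • ·) hb
      · have h2 := sum_addGenus f' (genus i - 1)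
        have h3 : genus i ≠ 0 := fun h => left_ne_zero_of_mul hab (h0 h)
        refine (hk (right_ne_zero_of_mul hab)).trans ?_
        refine (congrArg (· + 1) h2).trans ?_
        have h4 := Fin.sum_univ_succAbove (fun k => (genus k : ℤ) - 1) i
        refine (congrArg (· + 1) ?_).trans (congrArg (· + 1) h4.symm)
        rw [add_comm]
        congr 1
        omega
    · have hn' : ∀ i, ¬ i ≠ src () := fun i hi => hn ⟨i, hi⟩
      push Not at hn
      refine ⟨1, genus (src ()), ?_, fun _ => ?_⟩
      · rw [one_smul]
        refine mor_eq ((homeo_of _).trans (of_homeo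
          ⟨fun _ => (), fun _ => src (), fun k => (not_not.1 (hn' k)).symm, fun _ => rfl⟩
          (fun _ => rfl) (fun _ => rfl) fun k => ?_))
        rw [hn k]
      -- With all components equal to the curtain there is only one, so the total of genus minus one
      -- has a single term.
      · have h : n = 0 := by
          by_contra h
          have h1 := (hn 0).trans (hn (Fin.last n)).symm
          exact h (by simpa using (congrArg Fin.val h1).symm)
        subst h
        rw [show src () = 0 from (hn 0).symm]
        change _ = ∑ i : Fin 1, ((genus i : ℤ) - 1) + 1
        simp

end Surface

/-! ### Morphisms between special lines as polynomials in `H`. -/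

/-- Every morphism of `Cobl` is a combination of surfaces. -/
theorem closure_range_mor {A B : Cobl} (a : A ⟶ B) : a ∈ AddSubgroup.closure
    (Set.range fun f : Surface A.tangle B.tangle => (f.mor : A ⟶ B)) := by
  induction a using Quot.ind with
  | _ a =>
  let S : AddSubgroup (A ⟶ B) := AddSubgroup.closure
    (Set.range fun f : Surface A.tangle B.tangle => (f.mor : A ⟶ B))
  let φ : (A.as ⟶ B.as) →+ (A ⟶ B) :=
    ⟨⟨(CategoryTheory.Quotient.functor localRel).map, rfl⟩, fun _ _ => rfl⟩
  change φ a ∈ S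
  -- A morphism of the free category is a finitely supported integer function on homeomorphism
  -- classes of surfaces.
  induction a using Finsupp.induction_linear with
  | zero => exact zero_mem S
  | add a b ha hb => exact add_mem (S := AddSubgroup (A ⟶ B)) ha hb
  | single f n =>
    induction f using Quotient.ind with
    | _ f =>
    have h0 : φ f.toFree ∈ S := AddSubgroup.subset_closure (Set.mem_range_self f)
    have h1 : n • φ f.toFree ∈ S := S.zsmul_mem h0 n
    have h : φ (n • f.toFree) ∈ S := (map_zsmul φ n f.toFree).symm ▸ h1
    have h2 : n • f.toFree = (Finsupp.single (Quotient.mk _ f) n : _ →₀ ℤ) :=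
      Finsupp.smul_single_one _ _
    exact h2 ▸ h

theorem exists_polyMor {m m' : ℤ} (a : ob (lineTangle m) ⟶ ob (lineTangle m')) :
    ∃ p, polyMor m m' p = a := by
  have h := closure_range_mor a
  induction h using AddSubgroup.closure_induction with
  | mem a ha =>
    obtain ⟨f, rfl⟩ := ha
    obtain ⟨a, k, h, -⟩ := f.exists_mor_lineTangle
    exact ⟨Polynomial.monomial k a, (polyMor_monomial _ _ _ _).trans h.symm⟩
  | zero => exact ⟨0, map_zero _⟩
  | add a b _ _ ha hb =>
    obtain ⟨p, rfl⟩ := ha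
    obtain ⟨q, rfl⟩ := hb
    exact ⟨p + q, map_add _ _ _⟩
  | neg a _ ha =>
    obtain ⟨p, rfl⟩ := ha
    exact ⟨-p, map_neg _ _⟩

/-- A curtain with `k` handles from shift `m` to shift `m'` has degree `m' - m - 2k`. Degree zero
thus determines `k`, and adding homogeneous morphisms never mixes powers of `H`. A zero coefficient
leaves `k` undetermined, which is why it is treated apart. -/
theorem IsHomogeneous.exists_monomial {m m' : ℤ} {b : ob (lineTangle m) ⟶ ob (lineTangle m')}
    (hb : IsHomogeneous 0 b) : ∃ (a : ℤ) (k : ℕ), b = polyMor m m' (Polynomial.monomial k a) ∧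
      (a ≠ 0 → 2 * (k : ℤ) = m' - m) := by
  induction hb using AddSubgroup.closure_induction with
  | mem b hb =>
    obtain ⟨f, hf, rfl⟩ := hb
    obtain ⟨a, k, h, hk⟩ := f.exists_mor_lineTangle
    refine ⟨a, k, h.trans (polyMor_monomial _ _ _ _).symm, fun ha => ?_⟩
    have h1 := hk ha
    have h2 := f.degree_eq
    have h3 : Fintype.card (ob (lineTangle m)).tangle.comps = 1 := rfl
    have h4 : Fintype.card (ob (lineTangle m')).tangle.comps = 1 := rfl
    have h5 : (ob (lineTangle m)).tangle.shift = m := rfl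
    have h6 : (ob (lineTangle m')).tangle.shift = m' := rfl
    rw [hf, h3, h4, h5, h6] at h2
    have h7 : (k : ℤ) - 1 = ∑ i, ((f.genus i : ℤ) - 1) := by
      rw [h1]; exact add_sub_cancel_right _ _
    rw [← h7] at h2
    push_cast at h2
    linarith
  | zero => exact ⟨0, 0, by simp, fun h => absurd rfl h⟩
  | add b c _ _ hb hc =>
    obtain ⟨a, k, rfl, hk⟩ := hb
    obtain ⟨a', k', rfl, hk'⟩ := hc
    by_cases ha : a = 0
    · exact ⟨a', k', by simp [ha], hk'⟩
    by_cases ha' : a' = 0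
    · exact ⟨a, k, by simp [ha'], hk⟩
    have h : k = k' := by
      have h1 := hk ha
      have h2 := hk' ha'
      omega
    subst h
    exact ⟨a + a', k, by rw [← map_add, ← map_add], fun _ => hk ha⟩
  | neg b _ hb =>
    obtain ⟨a, k, rfl, hk⟩ := hb
    exact ⟨-a, k, by rw [← map_neg, ← map_neg], fun h => hk (by simpa using h)⟩

theorem FreeModule.exists_entry {M N : FreeModule} (p : M.ι → N.ι → Polynomial ℤ) :
    ∃ f : M ⟶ N, ∀ i j, FreeModule.entry f i j = p i j := by
  classical
  -- `entry` takes the source index first, so the matrix has to act on row vectors.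
  refine ⟨Matrix.vecMulLinear (Matrix.of p), fun i j => ?_⟩
  unfold FreeModule.entry
  refine Eq.trans ?_ (congrFun (Matrix.single_one_vecMul i (Matrix.of p)) j)
  congr!

theorem FreeModule.hom_ext {M N : FreeModule} {f g : M ⟶ N}
    (h : ∀ i j, FreeModule.entry f i j = FreeModule.entry g i j) : f = g := by
  classical
  refine LinearMap.pi_ext' fun i => LinearMap.ext_ring ?_
  funext j
  have h1 := h i j
  unfold FreeModule.entry at h1
  refine Eq.trans (Eq.trans ?_ h1) ?_ <;> simp

/-- Fullness and faithfulness are questions about single entries, settled by `exists_polyMor` and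
`polyMor_injective`. -/
instance : realize.Full where
  map_surjective {M N} a := by
    choose p hp using fun (i : M.ι) (j : N.ι) => exists_polyMor (a i j)
    obtain ⟨f, hf⟩ := FreeModule.exists_entry p
    refine ⟨f, ?_⟩
    funext i j
    exact (congrArg _ (hf i j)).trans (hp i j)

instance : realize.Faithful where
  map_injective h := FreeModule.hom_ext fun i j =>
    polyMor_injective _ _ (congrFun (congrFun h i) j)

/-! ### Composites of caps and cups, and neck cutting. -/

theorem push_neg_one_add {A B : Type} [Fintype A] (p : A → B) (b : B) :
    push p (fun _ => ((0 : ℕ) : ℤ) - 1) b + push p (fun _ => 1) b = 0 := by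
  -- A piece of genus zero weighs `-1` and a middle circle weighs `+1`; where they are matched,
  -- gluing leaves the genus alone.
  rw [← push_add]
  simp [push]

theorem push_id {A : Type} [Fintype A] (w : A → ℤ) (a : A) : push id w a = w a :=
  push_injective id Function.injective_id w a

section

variable (X : Tangle) (c : X.comps) (hc : c ≠ X.line)

theorem collapse_val (m m' : ℤ) (a : (erase X c hc m).comps) :
    collapse X c hc m' a.1 = a := dif_neg a.2

theorem collapse_self (m : ℤ) : collapse X c hc m c = (erase X c hc m).line := dif_pos rfl

open scoped Classical in
theorem collapse_coe (m : ℤ) (a : X.comps) :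
    (collapse X c hc m a).1 = if a = c then X.line else a := by
  by_cases h : a = c
  · rw [if_pos h, h, collapse_self]
    rfl
  · rw [if_neg h]
    exact congrArg Subtype.val (dif_neg h)

theorem sum_erase (m : ℤ) (w : X.comps → ℤ) :
    ∑ a : (erase X c hc m).comps, w a.1 = ∑ a, w a - w c := by
  classical
  rw [← Finset.sum_erase_eq_sub (Finset.mem_univ c)]
  symm
  refine Finset.sum_subtype _ (fun a => ?_) w
  simp

theorem card_erase (m : ℤ) :
    (Fintype.card (erase X c hc m).comps : ℤ) = Fintype.card X.comps - 1 := by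
  have h := sum_erase X c hc m fun _ => 1
  simpa using h

open scoped Classical in
theorem sum_fold (w : X.comps → ℤ) :
    ∑ a, w (if a = c then X.line else a) = ∑ a, w a - w c + w X.line := by
  have h : ∀ a, w (if a = c then X.line else a) = w a + if a = c then w X.line - w c else 0 := by
    intro a
    split_ifs with h
    · rw [h]; ring
    · ring
  rw [Finset.sum_congr rfl fun a _ => h a, Finset.sum_add_distrib, Finset.sum_ite_eq',
    if_pos (Finset.mem_univ _)]
  ring

-- The line has two preimages, itself and `c`; every other component has one.
open scoped Classical in
theorem push_collapse (m : ℤ) (k : (erase X c hc m).comps) :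
    push (collapse X c hc m) (fun _ => 1) k = 1 + if k = (erase X c hc m).line then 1 else 0 := by
  have h : push (collapse X c hc m) (fun _ => 1) k
      = ∑ a, if (if a = c then X.line else a) = k.1 then (1 : ℤ) else 0 := by
    refine Finset.sum_congr rfl fun a _ => ?_
    rw [← collapse_coe X c hc m]
    exact if_congr Subtype.ext_iff rfl rfl
  rw [h, sum_fold X c fun a => if a = k.1 then 1 else 0]
  have h1 : (if X.line = k.1 then (1 : ℤ) else 0)
      = if k = (erase X c hc m).line then (1 : ℤ) else 0 :=
    if_congr (eq_comm.trans (Subtype.ext_iff (a1 := k) (a2 := (erase X c hc m).line)).symm) rfl rfl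
  rw [h1, if_neg (Ne.symm k.2)]
  simp

open scoped Classical in
/-- The product cobordism on `X` without the circle `c`, with handles on the curtain and a change
of the shift. -/
noncomputable def erasedCylinder (m m' : ℤ) (g : ℕ) :
    Surface (erase X c hc m) (erase X c hc m') :=
  Surface.of (X := erase X c hc m) (Y := erase X c hc m') (erase X c hc m).comps id id rfl
    fun k => if k = (erase X c hc m).line then g else 0

theorem erasedCylinder_zero (m : ℤ) :
    (erasedCylinder X c hc m m 0).mor = 𝟙 (ob (erase X c hc m)) := by
  rw [← Surface.mor_cylinder, erasedCylinder, Surface.cylinder]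
  simp only [ite_self]

theorem erasedCylinder_handle (m m' : ℤ) :
    (erasedCylinder X c hc m m' 0).mor ≫ (handle (erase X c hc m')).mor
      = (erasedCylinder X c hc m m' 1).mor := by
  classical
  rw [Surface.mor_comp]
  refine Surface.mor_eq (Surface.of_comp_of (M := (erase X c hc m).comps) id id (fun _ => rfl)
    (fun k => Or.inl ⟨k, rfl⟩) (fun φ₁ φ₂ h => ⟨φ₁, fun _ => rfl, h⟩)
    (fun _ => rfl) (fun _ => rfl) fun k => ?_)
  have h1 := push_id (A := (erase X c hc m).comps) (fun _ => (1 : ℤ)) k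
  have h2 := push_id (A := (erase X c hc m).comps)
    (fun k => ((if k = (erase X c hc m).line then (1 : ℕ) else 0 : ℕ) : ℤ) - 1) k
  have h3 := push_id (A := (erase X c hc m).comps)
    (fun k => ((if k = (erase X c hc m).line then (0 : ℕ) else 0 : ℕ) : ℤ) - 1) k
  refine Eq.trans ?_ (congrArg₂ (· + ·) (congrArg₂ (· + ·) h3 h2) h1).symm
  simp

/-- The disc of the cap fills the hole which the dotted cup leaves in the curtain. The two shifts
are kept independent because the off-diagonal relations compare different rows. -/
theorem dottedCup_cap (m m' : ℤ) : (dottedCup X c hc m).mor ≫ (cap X c hc m').mor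
    = (erasedCylinder X c hc m m' 0).mor := by
  rw [Surface.mor_comp]
  refine Surface.mor_eq (Surface.of_comp_of (M := (erase X c hc m).comps) id (collapse X c hc m)
    (fun _ => rfl) (fun k => Or.inl ⟨k, rfl⟩) (fun φ₁ φ₂ h => ⟨φ₁, fun _ => rfl, h⟩)
    (fun _ => rfl) (fun a => collapse_val X c hc m' m a) fun k => ?_)
  have h1 := push_neg_one_add (collapse X c hc m) k
  have h2 := push_id (A := (erase X c hc m).comps) (fun _ => ((0 : ℕ) : ℤ) - 1) k
  rw [h2, add_assoc]
  refine Eq.trans ?_ (congrArg _ h1.symm)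
  simp

/-- The two curtains are glued along both the line and `c`; this closes one cycle, which is a
handle. -/
theorem dottedCup_dottedCap (m m' : ℤ) : (dottedCup X c hc m).mor ≫ (dottedCap X c hc m').mor
    = (erasedCylinder X c hc m m' 1).mor := by
  rw [Surface.mor_comp]
  refine Surface.mor_eq (Surface.of_comp_of (M := (erase X c hc m).comps) id id
    (fun _ => rfl) (fun k => Or.inl ⟨k, rfl⟩) (fun {T} φ₁ φ₂ h => ⟨φ₁, fun _ => rfl, fun b => ?_⟩)
    (fun _ => rfl) (fun a => rfl) fun k => ?_)
  · have := h b.1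
    rwa [collapse_val X c hc m' m, collapse_val X c hc m' m'] at this
  have h1 := push_collapse X c hc m k
  have h2 := push_id (A := (erase X c hc m).comps) (fun _ => ((0 : ℕ) : ℤ) - 1) k
  refine Eq.trans ?_ (congrArg₂ (· + ·) (congrArg₂ (· + ·) h2 h2) h1).symm
  push_cast
  ring

theorem cup_dottedCap (m m' : ℤ) : (cup X c hc m).mor ≫ (dottedCap X c hc m').mor
    = (erasedCylinder X c hc m m' 0).mor := by
  rw [Surface.mor_comp]
  refine Surface.mor_eq (Surface.of_comp_of (M := (erase X c hc m).comps) (collapse X c hc m) id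
    (fun _ => rfl) (fun k => Or.inr ⟨k, rfl⟩)
    (fun φ₁ φ₂ h => ⟨φ₂, fun a => (h a).symm, fun _ => rfl⟩)
    (fun a => collapse_val X c hc m m a) (fun _ => rfl) fun k => ?_)
  have h1 := push_neg_one_add (collapse X c hc m) k
  have h2 := push_id (A := (erase X c hc m).comps) (fun _ => ((0 : ℕ) : ℤ) - 1) k
  rw [add_right_comm]
  refine Eq.trans ?_ (congrArg₂ (· + ·) h1 h2).symm
  simp

/-- The two discs close up to a sphere beside a product cobordism, and S applies. -/
theorem cup_cap (m m' : ℤ) : (cup X c hc m).mor ≫ (cap X c hc m').mor = 0 := by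
  classical
  rw [Surface.mor_comp, ← Surface.mor_sphere (erasedCylinder X c hc m m' 0)]
  have h : Surface.Homeo (Surface.comp (cup X c hc m) (cap X c hc m'))
      (Surface.of (X := erase X c hc m) (Y := erase X c hc m') X.comps Subtype.val Subtype.val rfl
        fun _ => 0) := by
    refine Surface.of_comp_of id id (fun _ => rfl) (fun k => Or.inl ⟨k, rfl⟩)
      (fun φ₁ φ₂ h => ⟨φ₁, fun _ => rfl, h⟩) (fun _ => rfl) (fun _ => rfl) fun k => ?_
    have h1 := push_id (A := X.comps) (fun _ => (1 : ℤ)) k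
    have h2 := push_id (A := X.comps) (fun _ => ((0 : ℕ) : ℤ) - 1) k
    refine Eq.trans ?_ (congrArg₂ (· + ·) (congrArg₂ (· + ·) h2 h2) h1).symm
    simp
  -- The component of `c` is the sphere and corresponds to `none`; the others form the product.
  refine Surface.mor_eq (h.trans (Surface.of_homeo ((Equiv.optionSubtypeNe c).symm.trans
    (Fintype.equivFin (erase X c hc m).comps).optionCongr) (fun x => ?_) (fun x => ?_)
    fun k => ?_))
  · have h1 : (Equiv.optionSubtypeNe c).symm x.1 = some x := Equiv.optionSubtypeNe_symm_of_ne x.2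
    exact congrArg (Fintype.equivFin (erase X c hc m).comps).optionCongr h1
  · have h1 : (Equiv.optionSubtypeNe c).symm x.1 = some x := Equiv.optionSubtypeNe_symm_of_ne x.2
    exact congrArg (Fintype.equivFin (erase X c hc m).comps).optionCongr h1
  · obtain ⟨o, rfl⟩ := (Equiv.optionSubtypeNe c).surjective k
    have h1 : (Equiv.optionSubtypeNe c).symm (Equiv.optionSubtypeNe c o) = o :=
      Equiv.symm_apply_apply _ _
    refine (congrArg (fun o => ((Fintype.equivFin (erase X c hc m).comps).optionCongr o).elim 0
      (erasedCylinder X c hc m m' 0).genus) h1).trans ?_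
    cases o with
    | none => rfl
    | some a => exact ite_self _

open scoped Classical in
/-- The surface from `X` to itself in which the cylinder over `c` is replaced by two discs. -/
noncomputable def cutNeck (g : X.comps → ℕ) : Surface X X :=
  Surface.of (Option X.comps) some (fun a => if a = c then none else some a)
    (if_neg hc.symm).symm fun k => k.elim 0 g

-- The middle contains everything but `c`, so the two discs over `c` stay apart: `some c` bounds the
-- source circle and `none` the target circle.
open scoped Classical in
theorem cap_comp_cup (m : ℤ) (g : X.comps → ℕ) :
    (Surface.of (Y := erase X c hc m) X.comps id Subtype.val rfl g).mor ≫ (cup X c hc m).mor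
      = (cutNeck X c hc g).mor := by
  rw [Surface.mor_comp]
  have hv : ∀ y : (erase X c hc m).comps,
      (if y.1 = c then none else some y.1 : Option X.comps) = some y.1 := fun y => if_neg y.2
  refine Surface.mor_eq (Surface.of_comp_of some (fun a => if a = c then none else some a)
    (fun y => (hv y).symm) ?_ ?_ (fun _ => rfl) (fun _ => rfl) ?_)
  · rintro (_ | a)
    · exact Or.inr ⟨c, if_pos rfl⟩
    · exact Or.inl ⟨a, rfl⟩
  · intro T φ₁ φ₂ h
    refine ⟨fun o => o.elim (φ₂ c) φ₁, fun _ => rfl, fun b => ?_⟩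
    by_cases hb : b = c
    · simp [hb]
    · simp only [if_neg hb, Option.elim_some]
      exact h ⟨b, hb⟩
  · intro o
    -- The gluing circles are the components of `X` other than `c`, so the term of `c` is removed
    -- from the count.
    have h0 : push (fun y : (erase X c hc m).comps => some y.1) (fun _ => 1) o
        = push (some : X.comps → _) (fun _ => 1) o - if some c = o then 1 else 0 :=
      by
      have := sum_erase X c hc m fun a => if some a = o then 1 else 0
      unfold push
      convert! this
    refine Eq.trans ?_ (congrArg _ h0.symm)
    cases o with
    | none =>
      have h : ∀ a : X.comps, ((if a = c then none else some a : Option X.comps) = none) ↔ a = c := by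
        intro a; split_ifs with h <;> simp [h]
      simp [push, h]
    | some b =>
      have h1 := push_injective (some : X.comps → _) (Option.some_injective _)
        (fun a => ((g a : ℕ) : ℤ) - 1) b
      have h2 := push_injective (some : X.comps → _) (Option.some_injective _) (fun _ => 1) b
      have h : ∀ a : X.comps, ((if a = c then none else some a : Option X.comps) = some b)
          ↔ (a = b ∧ b ≠ c) := by
        intro a; split_ifs with h
        · simp only [false_iff, not_and, not_not]
          rintro rfl
          exact h
        · simp only [Option.some.injEq, iff_self_and]
          rintro rfl
          exact h
      have h3 : push (fun a : X.comps => (if a = c then none else some a : Option X.comps))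
          (fun _ => ((0 : ℕ) : ℤ) - 1) (some b) = if b = c then 0 else -1 := by
        by_cases hb : b = c <;> simp [push, h, hb]
      rw [h1, h2, h3]
      simp only [Option.elim_some, Option.some.injEq, eq_comm (a := c)]
      split_ifs <;> ring

open scoped Classical in
theorem cap_handle_cup (m : ℤ) :
    ((cap X c hc m).mor ≫ (handle (erase X c hc m)).mor) ≫ (cup X c hc m).mor
      = (cutNeck X c hc fun k => if k = X.line then 1 else 0).mor := by
  rw [← cap_comp_cup X c hc m, Surface.mor_comp]
  congr 1
  refine Surface.mor_eq (Surface.of_comp_of (M := X.comps) id Subtype.val (fun _ => rfl)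
    (fun k => Or.inl ⟨k, rfl⟩) (fun φ₁ φ₂ h => ⟨φ₁, fun _ => rfl, h⟩)
    (fun _ => rfl) (fun _ => rfl) fun k => ?_)
  have h1 := push_id (A := X.comps) (fun _ => ((0 : ℕ) : ℤ) - 1) k
  have h2 := push_add (fun a : (erase X c hc m).comps => a.1)
    (fun k => ((if k = (erase X c hc m).line then (1 : ℕ) else 0 : ℕ) : ℤ) - 1) (fun _ => 1) k
  have h3 : push (fun a : (erase X c hc m).comps => a.1)
      (fun k => ((if k = (erase X c hc m).line then (1 : ℕ) else 0 : ℕ) : ℤ) - 1 + 1) k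
      = if k = X.line then 1 else 0 := by
    unfold push
    rw [Finset.sum_eq_single (erase X c hc m).line]
    · have h4 : (if X.line = k then (1 : ℤ) else 0) = if k = X.line then 1 else 0 :=
        if_congr eq_comm rfl rfl
      refine Eq.trans ?_ h4
      simp
      rfl
    · intro b _ hb
      simp [hb]
    · intro h
      exact absurd (Finset.mem_univ _) h
  rw [h1, add_assoc]
  refine Eq.trans ?_ (congrArg _ (h3.symm.trans h2))
  push_cast
  ring

open scoped Classical in
theorem cap_dottedCup (m : ℤ) : (cap X c hc m).mor ≫ (dottedCup X c hc m).mor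
    = (Surface.of (X := X) (Y := X) X.comps id (fun a => if a = c then X.line else a)
        (if_neg hc.symm).symm fun _ => 0).mor := by
  rw [Surface.mor_comp]
  refine Surface.mor_eq (Surface.of_comp_of (M := X.comps) id Subtype.val (fun _ => rfl)
    (fun k => Or.inl ⟨k, rfl⟩) (fun φ₁ φ₂ h => ⟨φ₁, fun _ => rfl, h⟩)
    (fun _ => rfl) (fun a => collapse_coe X c hc m a) fun k => ?_)
  have h1 := push_neg_one_add (fun a : (erase X c hc m).comps => a.1) k
  have h2 := push_id (A := X.comps) (fun _ => ((0 : ℕ) : ℤ) - 1) k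
  rw [h2, add_assoc]
  refine Eq.trans ?_ (congrArg _ h1.symm)
  simp

open scoped Classical in
theorem dottedCap_cup (m : ℤ) : (dottedCap X c hc m).mor ≫ (cup X c hc m).mor
    = (Surface.of (X := X) (Y := X) X.comps (fun a => if a = c then X.line else a) id
        (if_neg hc.symm) fun _ => 0).mor := by
  rw [Surface.mor_comp]
  refine Surface.mor_eq (Surface.of_comp_of (M := X.comps) Subtype.val id (fun _ => rfl)
    (fun k => Or.inr ⟨k, rfl⟩) (fun φ₁ φ₂ h => ⟨φ₂, fun a => (h a).symm, fun _ => rfl⟩)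
    (fun a => collapse_coe X c hc m a) (fun _ => rfl) fun k => ?_)
  have h1 := push_neg_one_add (fun a : (erase X c hc m).comps => a.1) k
  have h2 := push_id (A := X.comps) (fun _ => ((0 : ℕ) : ℤ) - 1) k
  rw [add_right_comm]
  refine Eq.trans ?_ (congrArg₂ (· + ·) h1 h2).symm
  simp

/-- Neck cutting. -/
theorem neck_cutting (m m' : ℤ) : (cap X c hc m).mor ≫ (dottedCup X c hc m).mor
    + ((dottedCap X c hc m').mor - (cap X c hc m').mor ≫ (handle (erase X c hc m')).mor)
      ≫ (cup X c hc m').mor = 𝟙 (ob X) := by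
  classical
  let ε := Fintype.equivFin (Option X.comps)
  -- One disc on each half of the cut cylinder and two on the curtain. Below, `e1` and `e2` identify
  -- the tube which restores the cylinder and the one which adds a handle to the curtain; `e3` and
  -- `e4` identify the tubes which dot the cap and the cup.
  have h := Surface.mor_fourTube (cutNeck X c hc fun _ => 0) (ε (some c)) (ε none)
    (ε (some X.line)) (ε (some X.line))
  have e1 : Surface.Homeo ((cutNeck X c hc fun _ => 0).tube (ε (some c)) (ε none))
      (Surface.cylinder X) := by
    refine Surface.tube_of_homeo (fun o => o.getD c) (some c) none (fun k => ⟨some k, rfl⟩) rfl ?_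
      (fun _ => rfl) (fun a => ?_) fun l => ?_
    · rintro (_ | a) (_ | b) h
      · exact Or.inl rfl
      · exact Or.inr (Or.inr ⟨rfl, congrArg some h.symm⟩)
      · exact Or.inr (Or.inl ⟨congrArg some h, rfl⟩)
      · exact Or.inl (congrArg some h)
    · split_ifs with h
      · exact h.symm
      · rfl
    · simp [push, Fintype.sum_option]
      split_ifs <;> simp
  have e2 : Surface.Homeo
      ((cutNeck X c hc fun _ => 0).tube (ε (some X.line)) (ε (some X.line)))
      (cutNeck X c hc fun k => if k = X.line then 1 else 0) := by
    refine Surface.tube_of_homeo id _ _ Function.surjective_id rfl (fun a b h => Or.inl h)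
      (fun _ => rfl) (fun _ => rfl) fun l => ?_
    rw [push_id]
    cases l with
    | none => simp
    | some l =>
      simp only [Option.elim_some, id, Option.some.injEq, eq_comm (a := X.line)]
      split_ifs <;> simp
  have e3 : Surface.Homeo
      ((cutNeck X c hc fun _ => 0).tube (ε (some c)) (ε (some X.line)))
      (Surface.of (X := X) (Y := X) X.comps (fun a => if a = c then X.line else a) id
        (if_neg hc.symm) fun _ => 0) := by
    refine Surface.tube_of_homeo (fun o => o.elim c fun a => if a = c then X.line else a) _ _
      ?_ ?_ ?_ (fun _ => rfl) (fun a => ?_) fun l => ?_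
    · intro a
      by_cases h : a = c
      · exact ⟨none, h.symm⟩
      · exact ⟨some a, if_neg h⟩
    · simp
    · rintro (_ | a) (_ | b)
      · simp
      · simp only [Option.elim_none, Option.elim_some]
        split_ifs with h <;> intro h'
        · exact absurd h' hc
        · exact absurd h'.symm h
      · simp only [Option.elim_none, Option.elim_some]
        split_ifs with h <;> intro h'
        · exact absurd h'.symm hc
        · exact absurd h' h
      · simp only [Option.elim_some]
        split_ifs with h1 h2 h3 <;> intro h' <;> simp_all
    · split_ifs with h
      · exact h.symm
      · simp [h]
    · have h1 := sum_fold X c fun a => if a = l then (-1 : ℤ) else 0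
      simp only [push, Fintype.sum_option, Option.elim_none, Option.elim_some, Nat.cast_zero,
        zero_sub, h1, Finset.sum_ite_eq', Finset.mem_univ, if_true]
      split_ifs <;> ring1
  have e4 : Surface.Homeo
      ((cutNeck X c hc fun _ => 0).tube (ε none) (ε (some X.line)))
      (Surface.of (X := X) (Y := X) X.comps id (fun a => if a = c then X.line else a)
        (if_neg hc.symm).symm fun _ => 0) := by
    refine Surface.tube_of_homeo (fun o => o.getD X.line) none (some X.line)
      (fun k => ⟨some k, rfl⟩) rfl ?_ (fun _ => rfl) (fun a => ?_) fun l => ?_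
    · rintro (_ | a) (_ | b) h
      · exact Or.inl rfl
      · exact Or.inr (Or.inl ⟨rfl, congrArg some h.symm⟩)
      · exact Or.inr (Or.inr ⟨congrArg some h, rfl⟩)
      · exact Or.inl (congrArg some h)
    · split_ifs with h <;> rfl
    · simp [push, Fintype.sum_option]
      split_ifs <;> simp
  rw [Surface.mor_eq e1, Surface.mor_eq e2, Surface.mor_eq e3, Surface.mor_eq e4,
    Surface.mor_cylinder, ← cap_dottedCup X c hc m, ← dottedCap_cup X c hc m',
    ← cap_handle_cup X c hc m'] at h
  -- 4TU expresses the identity as dotted cap and cup, plus cap and dotted cup, minus cap, handle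
  -- and cup. The first and the last of these share the factor `cup`.
  rw [Preadditive.sub_comp, eq_sub_of_add_eq h]
  abel

end

section

variable (X : Tangle) (c : X.comps) (hc : c ≠ X.line) (m : ℤ)

theorem shift_erase : (erase X c hc m).shift = X.shift + m := rfl

/-- The degrees of cap, cup and their dotted versions, for any shift `m`, show why `-1` belongs to
the cap and the dotted cup, and `+1` to the dotted cap and the cup. -/
theorem degree_cap : (cap X c hc m).degree = 1 + m := by
  refine (Surface.degree_of ..).trans ?_
  rw [card_erase, shift_erase]
  simp
  ring

theorem degree_cup : (cup X c hc m).degree = 1 - m := by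
  refine (Surface.degree_of ..).trans ?_
  rw [card_erase, shift_erase]
  simp
  ring

theorem degree_dottedCap : (dottedCap X c hc m).degree = -1 + m := by
  rw [dottedCap, Surface.degree_of, Finset.sum_const, Finset.card_univ, nsmul_eq_mul, card_erase,
    shift_erase]
  simp
  ring

theorem degree_dottedCup : (dottedCup X c hc m).degree = -1 - m := by
  rw [dottedCup, Surface.degree_of, Finset.sum_const, Finset.card_univ, nsmul_eq_mul, card_erase,
    shift_erase]
  simp
  ring

theorem degree_handle : (handle X).degree = -2 := by
  classical
  rw [handle, Surface.degree_of]
  simp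
  ring

end

/-! ### Splittings of objects and block diagonal matrices. -/

/-- The maps `h i` and `v i` exhibit `A` as the direct sum of the objects `Y i`, homogeneously of
degree zero. -/
structure IsSplitting {A : Cobl} {I : Type} [Fintype I] {Y : I → Cobl} (h : ∀ i, A ⟶ Y i)
    (v : ∀ i, Y i ⟶ A) : Prop where
  sum : ∑ i, h i ≫ v i = 𝟙 A
  self : ∀ i, v i ≫ h i = 𝟙 (Y i)
  ne : ∀ i j, i ≠ j → v i ≫ h j = 0
  hom_degree : ∀ i, IsHomogeneous 0 (h i)
  inv_degree : ∀ i, IsHomogeneous 0 (v i)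

section

variable (X : Tangle) (c : X.comps) (hc : c ≠ X.line)

/-- The rows of the delooping map of the circle `c`. -/
noncomputable def circleHom : ∀ b : Bool, ob X ⟶ ob (erase X c hc (if b then 1 else -1))
  | false => (cap X c hc (-1)).mor
  | true => (dottedCap X c hc 1).mor - (cap X c hc 1).mor ≫ (handle (erase X c hc 1)).mor

/-- The columns of the inverse of the delooping map of the circle `c`. -/
noncomputable def circleInv : ∀ b : Bool, ob (erase X c hc (if b then 1 else -1)) ⟶ ob X
  | false => (dottedCup X c hc (-1)).mor
  | true => (cup X c hc 1).mor

/-- The correction by `H` does no harm on the cup, since there it contains a sphere. -/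
theorem cup_circleHom_true (m : ℤ) : (cup X c hc m).mor ≫ ((dottedCap X c hc m).mor
    - (cap X c hc m).mor ≫ (handle (erase X c hc m)).mor) = 𝟙 _ := by
  rw [Preadditive.comp_sub, ← Category.assoc, cup_cap, cup_dottedCap, Limits.zero_comp, sub_zero,
    erasedCylinder_zero]

/-- The purpose of the correction: the dotted cup followed by the dotted cap gives a handle, and so
does the dotted cup followed by the cap and `H`. -/
theorem dottedCup_circleHom_true (m m' : ℤ) : (dottedCup X c hc m).mor ≫ ((dottedCap X c hc m').mor
    - (cap X c hc m').mor ≫ (handle (erase X c hc m')).mor) = 0 := by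
  rw [Preadditive.comp_sub, ← Category.assoc, dottedCup_cap, dottedCup_dottedCap,
    erasedCylinder_handle, sub_self]

theorem circleHom_true_homogeneous (m : ℤ) : IsHomogeneous (-1 + m) ((dottedCap X c hc m).mor
    - (cap X c hc m).mor ≫ (handle (erase X c hc m)).mor) := by
  have h := IsHomogeneous.comp (IsHomogeneous.mor (degree_cap X c hc m))
    (IsHomogeneous.mor (degree_handle (erase X c hc m)))
  rw [show 1 + m + -2 = -1 + m by ring] at h
  exact (IsHomogeneous.mor (degree_dottedCap X c hc m)).sub h

theorem circle_isSplitting : IsSplitting (circleHom X c hc) (circleInv X c hc) where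
  sum := (Fintype.sum_bool _).trans ((add_comm _ _).trans (neck_cutting X c hc (-1) 1))
  self
    | false => (dottedCup_cap X c hc (-1) (-1)).trans (erasedCylinder_zero X c hc (-1))
    | true => cup_circleHom_true X c hc 1
  ne
    | false, false, h => absurd rfl h
    | false, true, _ => dottedCup_circleHom_true X c hc (-1) 1
    | true, false, _ => cup_cap X c hc 1 (-1)
    | true, true, h => absurd rfl h
  hom_degree
    | false => IsHomogeneous.mor (degree_cap X c hc (-1))
    | true => circleHom_true_homogeneous X c hc 1
  inv_degree
    | false => IsHomogeneous.mor (degree_dottedCup X c hc (-1))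
    | true => IsHomogeneous.mor (degree_cup X c hc 1)

end

/-- For a chosen circle, the maps of `Choice` agree with those of `circle_isSplitting` once the
Boolean row is known, hence the case distinctions. -/
theorem Choice.isSplitting {A : Cobl} : ∀ o : Choice A, IsSplitting o.hom o.inv
  | none =>
    { sum := (Fintype.sum_unique (fun _ : Unit => 𝟙 A ≫ 𝟙 A)).trans (Category.comp_id _)
      self := fun _ => Category.comp_id _
      ne := fun _ _ h => absurd rfl h
      hom_degree := fun _ => IsHomogeneous.id A
      inv_degree := fun _ => IsHomogeneous.id A }
  | some ⟨c, hc⟩ =>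
    have s := circle_isSplitting A.tangle c hc
    { sum := (Fintype.sum_bool _).trans ((Fintype.sum_bool _).symm.trans s.sum)
      self := fun | false => s.self false | true => s.self true
      ne := fun
        | false, false, h => absurd rfl h
        | false, true, _ => s.ne false true Bool.false_ne_true
        | true, false, _ => s.ne true false Bool.false_ne_true.symm
        | true, true, h => absurd rfl h
      hom_degree := fun | false => s.hom_degree false | true => s.hom_degree true
      inv_degree := fun | false => s.inv_degree false | true => s.inv_degree true }

/-- Splittings compose. -/
theorem IsSplitting.trans {A : Cobl} {ι B : Type} [Fintype ι] [Fintype B] (p : ι → B)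
    [∀ b, Fintype {i // p i = b}] {Y : B → Cobl} {Z : ι → Cobl} {h : ∀ b, A ⟶ Y b}
    {v : ∀ b, Y b ⟶ A} {h' : ∀ b (i : {i // p i = b}), Y b ⟶ Z i.1}
    {v' : ∀ b (i : {i // p i = b}), Z i.1 ⟶ Y b} (s : IsSplitting h v)
    (s' : ∀ b, IsSplitting (h' b) (v' b)) :
    IsSplitting (fun i => h (p i) ≫ h' (p i) ⟨i, rfl⟩)
      (fun i => v' (p i) ⟨i, rfl⟩ ≫ v (p i)) where
  sum := by
    classical
    -- Group the final summands by the intermediate summand `Y b` they come from; within a fibre the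
    -- inner splitting sums to the identity.
    rw [← s.sum, ← Fintype.sum_fiberwise p]
    refine Finset.sum_congr rfl fun b _ => ?_
    have e : ∀ i : {i // p i = b}, (h (p i.1) ≫ h' (p i.1) ⟨i.1, rfl⟩) ≫
        v' (p i.1) ⟨i.1, rfl⟩ ≫ v (p i.1) = h b ≫ (h' b i ≫ v' b i) ≫ v b := by
      rintro ⟨i, rfl⟩
      simp only [Category.assoc]
    refine (Finset.sum_congr (by congr!) fun i _ => e i).trans ?_
    rw [← Preadditive.comp_sum, ← Preadditive.sum_comp]
    have e2 : ∑ i, h' b i ≫ v' b i = 𝟙 _ := (s' b).sum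
    refine (congrArg (fun z => h b ≫ z ≫ v b) (Eq.trans ?_ e2)).trans
      (congrArg (h b ≫ ·) (Category.id_comp _))
    exact Finset.sum_congr (by congr!) fun _ _ => rfl
  self i := by
    rw [Category.assoc, ← Category.assoc (v (p i)), s.self, Category.id_comp, (s' (p i)).self]
  ne i j hij := by
    -- Independent indices `b` and `b'` make the equality `b = b'` substitutable, which an equality
    -- `p i = p j` would not be.
    have key : ∀ b b' (i : {i // p i = b}) (j : {i // p i = b'}), i.1 ≠ j.1 →
        (v' b i ≫ v b) ≫ h b' ≫ h' b' j = 0 := by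
      intro b b' i j hij
      rw [Category.assoc, ← Category.assoc (v b)]
      by_cases hb : b = b'
      · subst hb
        rw [s.self, Category.id_comp, (s' b).ne i j fun h => hij (congrArg Subtype.val h)]
      · rw [s.ne b b' hb, Limits.zero_comp, Limits.comp_zero]
    exact key _ _ ⟨i, rfl⟩ ⟨j, rfl⟩ hij
  hom_degree i := by
    have h1 := (s.hom_degree (p i)).comp ((s' (p i)).hom_degree ⟨i, rfl⟩)
    rwa [add_zero] at h1
  inv_degree i := by
    have h1 := ((s' (p i)).inv_degree ⟨i, rfl⟩).comp (s.inv_degree (p i))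
    rwa [add_zero] at h1

section Block

variable (M : Mat_ Cobl) {I : M.ι → Type} [∀ i, Fintype (I i)] (Y : ∀ i, I i → Cobl)

/-- The column in which each entry `M.X i` has been replaced by the objects `Y i k`. -/
def blockColumn : Mat_ Cobl where
  ι := Σ i, I i
  X j := Y j.1 j.2

variable {Y}

open scoped Classical in
/-- The block diagonal matrix of the maps `h i k`. -/
noncomputable def blockHom (h : ∀ i k, M.X i ⟶ Y i k) : M ⟶ blockColumn M Y := fun i j =>
  if e : i = j.1 then eqToHom (congrArg M.X e) ≫ h j.1 j.2 else 0

open scoped Classical in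
/-- The block diagonal matrix of the maps `v i k`. -/
noncomputable def blockInv (v : ∀ i k, Y i k ⟶ M.X i) : blockColumn M Y ⟶ M := fun j i =>
  if e : j.1 = i then v j.1 j.2 ≫ eqToHom (congrArg M.X e) else 0

variable (h : ∀ i k, M.X i ⟶ Y i k) (v : ∀ i k, Y i k ⟶ M.X i)

theorem blockHom_self (i : M.ι) (k : I i) : blockHom M h i ⟨i, k⟩ = h i k :=
  (dif_pos rfl).trans (Category.id_comp _)

theorem blockHom_ne {i a : M.ι} (e : i ≠ a) (k : I a) : blockHom M h i ⟨a, k⟩ = 0 := dif_neg e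

theorem blockInv_self (i : M.ι) (k : I i) : blockInv M v ⟨i, k⟩ i = v i k :=
  (dif_pos rfl).trans (Category.comp_id _)

theorem blockInv_ne {i a : M.ι} (e : a ≠ i) (k : I a) : blockInv M v ⟨a, k⟩ i = 0 := dif_neg e

variable {h v}

/-- Off-diagonal blocks vanish, and on the diagonal this is the relation `sum` of the splitting. The
opposite composite below uses the orthogonality relations `self` and `ne`. -/
theorem blockHom_blockInv (hs : ∀ i, IsSplitting (h i) (v i)) :
    blockHom M h ≫ blockInv M v = 𝟙 M := by
  classical
  funext i i'
  have e1 : (blockHom M h ≫ blockInv M v) i i'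
      = ∑ k, blockHom M h i ⟨i, k⟩ ≫ blockInv M v ⟨i, k⟩ i' := by
    refine (Fintype.sum_sigma _).trans (Finset.sum_eq_single i (fun a _ ha => ?_) fun h => ?_)
    · refine Finset.sum_eq_zero fun k _ => ?_
      rw [blockHom_ne M h ha.symm]
      exact Limits.zero_comp
    · exact absurd (Finset.mem_univ _) h
  rw [e1]
  by_cases e : i = i'
  · subst e
    rw [Mat_.id_apply_self, ← (hs i).sum]
    refine Finset.sum_congr rfl fun k _ => ?_
    rw [blockHom_self, blockInv_self]
    rfl
  · rw [Mat_.id_apply_of_ne _ _ _ e]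
    refine Finset.sum_eq_zero fun k _ => ?_
    rw [blockInv_ne M v e]
    exact Limits.comp_zero

theorem blockInv_blockHom (hs : ∀ i, IsSplitting (h i) (v i)) :
    blockInv M v ≫ blockHom M h = 𝟙 (blockColumn M Y) := by
  classical
  funext ⟨i, k⟩ ⟨i', k'⟩
  have e1 : (blockInv M v ≫ blockHom M h) ⟨i, k⟩ ⟨i', k'⟩
      = blockInv M v ⟨i, k⟩ i ≫ blockHom M h i ⟨i', k'⟩ := by
    refine Finset.sum_eq_single i (fun a _ ha => ?_) fun h => ?_
    · rw [blockInv_ne M v ha.symm]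
      exact Limits.zero_comp
    · exact absurd (Finset.mem_univ _) h
  rw [e1]
  by_cases e : i = i'
  · subst e
    rw [blockInv_self, blockHom_self]
    by_cases e : k = k'
    · subst e
      exact ((hs i).self k).trans (Mat_.id_apply_self (blockColumn M Y) ⟨i, k⟩).symm
    · exact ((hs i).ne k k' e).trans (Mat_.id_apply_of_ne (blockColumn M Y) ⟨i, k⟩ ⟨i, k'⟩
        fun h => e (eq_of_heq (Sigma.mk.inj h).2)).symm
  · rw [blockHom_ne M h e]
    exact Limits.comp_zero.trans (Mat_.id_apply_of_ne (blockColumn M Y) ⟨i, k⟩ ⟨i', k'⟩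
      fun h => e (congrArg Sigma.fst h)).symm

theorem blockHom_degreeZero (hs : ∀ i, IsSplitting (h i) (v i)) : DegreeZero (blockHom M h) := by
  rintro i ⟨a, k⟩
  by_cases e : i = a
  · subst e
    rw [blockHom_self]
    exact (hs i).hom_degree k
  · rw [blockHom_ne M h e]
    exact .zero

theorem blockInv_degreeZero (hs : ∀ i, IsSplitting (h i) (v i)) : DegreeZero (blockInv M v) := by
  rintro ⟨a, k⟩ i
  by_cases e : a = i
  · subst e
    rw [blockInv_self]
    exact (hs a).inv_degree k
  · rw [blockInv_ne M v e]
    exact .zero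

end Block

/-! ### Removal of all circles. -/

/-- The connected cobordism of genus zero between tangles which consist of the line only. -/
noncomputable def sheet (X Y : Tangle) : Surface X Y :=
  Surface.of Unit (fun _ => ()) (fun _ => ()) rfl fun _ => 0

/-- Removing circles ends in a tangle with one component whose carrier need not be `Unit`; the
sheets identify it with a `lineTangle`. Two sheets are glued along a single line, so no genus
arises. -/
theorem sheet_comp (X Y Z : Tangle) (hY : Fintype.card Y.comps = 1) :
    (sheet X Y).mor ≫ (sheet Y Z).mor = (sheet X Z).mor := by
  rw [Surface.mor_comp]
  refine Surface.mor_eq (Surface.of_comp_of id id (fun _ => rfl) (fun _ => Or.inl ⟨(), rfl⟩)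
    (fun φ₁ φ₂ h => ⟨φ₁, fun _ => rfl, fun _ => h Y.line⟩) (fun _ => rfl) (fun _ => rfl)
    fun m => ?_)
  simp [push, hY]

theorem sheet_self (X : Tangle) (hX : Fintype.card X.comps = 1) : (sheet X X).mor = 𝟙 (ob X) := by
  rw [← Surface.mor_cylinder]
  have h : ∀ a b : X.comps, a = b := Fintype.card_le_one_iff.1 hX.le
  exact Surface.mor_eq (Surface.of_homeo ⟨fun _ => X.line, fun _ => (), fun _ => rfl, fun _ => h _ _⟩
    (fun _ => h _ _) (fun _ => h _ _) fun _ => rfl)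

theorem degree_sheet (X Y : Tangle) (hX : Fintype.card X.comps = 1)
    (hY : Fintype.card Y.comps = 1) : (sheet X Y).degree = Y.shift - X.shift := by
  rw [sheet, Surface.degree_of, hX, hY]
  simp

/-- The circles of `X` are `c` and the circles of `X` without `c`. -/
noncomputable def circlesEquiv (X : Tangle) (c : X.comps) (hc : c ≠ X.line) (m : ℤ) :
    Option {a : (erase X c hc m).comps // a ≠ (erase X c hc m).line}
      ≃ {a : X.comps // a ≠ X.line} :=
  Equiv.ofBijective
    (fun o => o.elim ⟨c, hc⟩ fun a => ⟨a.1.1, fun h => a.2 (Subtype.ext h)⟩) (by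
      constructor
      · rintro (_ | a) (_ | b) h
        · rfl
        · exact absurd (congrArg Subtype.val h).symm b.1.2
        · exact absurd (congrArg Subtype.val h) a.1.2
        · have h' : a.1.1 = b.1.1 := congrArg (fun z : {a : X.comps // a ≠ X.line} => z.1) h
          exact congrArg some (Subtype.ext (Subtype.ext h'))
      · rintro ⟨a, ha⟩
        by_cases h : a = c
        · exact ⟨none, Subtype.ext h.symm⟩
        · exact ⟨some ⟨⟨a, h⟩, fun h' => ha (congrArg Subtype.val h')⟩, rfl⟩)

/-- Removing all circles: a flat tangle is the direct sum of special lines, one for each choice of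
a sign for every circle. -/
theorem exists_isSplitting_lines (n : ℕ) (X : Tangle) (hn : Fintype.card X.comps = n + 1)
    {ι : Type} [Fintype ι] [Fintype {c : X.comps // c ≠ X.line}]
    (φ : ι ≃ ({c : X.comps // c ≠ X.line} → Bool)) (σ : ι → ℤ)
    (hσ : ∀ i, σ i = X.shift + ∑ c, if φ i c then 1 else -1) :
    ∃ (h : ∀ i, ob X ⟶ ob (lineTangle (σ i))) (v : ∀ i, ob (lineTangle (σ i)) ⟶ ob X),
      IsSplitting h v := by
  classical
  -- With an arbitrary index type and shifts prescribed by `σ`, the induction hypothesis applies to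
  -- fibres of `ι` without changing the target lines.
  induction n generalizing X ι with
  | zero =>
    have hX : ∀ a b : X.comps, a = b := Fintype.card_le_one_iff.1 hn.le
    have hempty : IsEmpty {c : X.comps // c ≠ X.line} := ⟨fun c => c.2 (hX _ _)⟩
    have hι : ∀ i j : ι, i = j := fun i j => φ.injective (Subsingleton.elim _ _)
    have hL : ∀ m, Fintype.card (lineTangle m).comps = 1 := fun _ => rfl
    have hs : ∀ i, σ i = X.shift := fun i => by rw [hσ]; simp
    -- Without circles there is exactly one choice of signs and the sum over them is empty, so the
    -- only line has the shift of `X`.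
    refine ⟨fun i => (sheet _ _).mor, fun i => (sheet _ _).mor, ?_, fun i => ?_,
      fun i j h => absurd (hι i j) h, fun i => .mor ?_, fun i => .mor ?_⟩
    · have : Subsingleton ι := ⟨hι⟩
      let i := φ.symm fun _ => true
      rw [Fintype.sum_subsingleton _ i, sheet_comp _ _ _ (hL _), sheet_self _ hn]
    · rw [sheet_comp _ _ _ hn, sheet_self _ (hL _)]
    · rw [degree_sheet _ _ hn (hL _)]
      exact sub_eq_zero_of_eq (hs i)
    · rw [degree_sheet _ _ (hL _) hn]
      exact sub_eq_zero_of_eq (hs i).symm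
  | succ n ih =>
    obtain ⟨c, hc⟩ : ∃ c, c ≠ X.line := by
      by_contra! h
      have : Fintype.card X.comps ≤ 1 := Fintype.card_le_one_iff.2 fun a b => (h a).trans (h b).symm
      omega
    -- The choices with sign `b` at `c` correspond to the choices for the remaining circles, so each
    -- of the two summands of the delooping at `c` splits by induction.
    have key : ∀ b : Bool, ∃
        (h : ∀ i : {i // φ i ⟨c, hc⟩ = b},
          ob (erase X c hc (if b then 1 else -1)) ⟶ ob (lineTangle (σ i.1)))
        (v : ∀ i : {i // φ i ⟨c, hc⟩ = b},
          ob (lineTangle (σ i.1)) ⟶ ob (erase X c hc (if b then 1 else -1))),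
        IsSplitting h v := by
      intro b
      set m : ℤ := if b then 1 else -1 with hm
      let E := circlesEquiv X c hc m
      have hcard : Fintype.card (erase X c hc m).comps = n + 1 := by
        have := card_erase X c hc m
        omega
      let ψ : {i // φ i ⟨c, hc⟩ = b} →
          ({a : (erase X c hc m).comps // a ≠ (erase X c hc m).line} → Bool) :=
        fun i a => φ i.1 (E (some a))
      have hψ : Function.Bijective ψ := by
        constructor
        · intro i j hij
          refine Subtype.ext (φ.injective (funext fun a => ?_))
          obtain ⟨o, rfl⟩ := E.surjective a
          cases o with
          | none => exact i.2.trans j.2.symm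
          | some a => exact congrFun hij a
        · intro ε
          refine ⟨⟨φ.symm fun a => (E.symm a).elim b ε, ?_⟩, ?_⟩
          · rw [Equiv.apply_symm_apply]
            have : E.symm ⟨c, hc⟩ = none := E.symm_apply_eq.2 rfl
            rw [this]
            rfl
          · funext a
            simp only [ψ]
            rw [Equiv.apply_symm_apply, Equiv.symm_apply_apply]
            rfl
      refine ih (erase X c hc m) hcard (Equiv.ofBijective ψ hψ) (fun i => σ i.1) fun i => ?_
      -- The sign at `c` leaves the sum and becomes the additional shift of `erase`.
      rw [hσ, ← E.sum_comp, Fintype.sum_option, shift_erase, add_assoc]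
      have : φ i.1 (E none) = b := i.2
      rw [this]
      rfl
    choose h v hs using key
    exact ⟨_, _, (circle_isSplitting X c hc).trans (Z := fun i => ob (lineTangle (σ i)))
      (fun i => φ i ⟨c, hc⟩) hs⟩

/-! ### Conjugating the differentials of a complex by deloopings. -/

section Transport

variable {V : Type*} [Category V] [Limits.HasZeroMorphisms V] (K : CochainComplex V ℤ) {N : ℤ → V}
  {f : ∀ r, K.X r ⟶ N r} {g : ∀ r, N r ⟶ K.X r}

theorem transport_comp (h : ∀ r, f r ≫ g r = 𝟙 _) (r : ℤ) :
    (g r ≫ K.d r (r + 1) ≫ f (r + 1)) ≫ (g (r + 1) ≫ K.d (r + 1) (r + 1 + 1) ≫ f (r + 1 + 1)) = 0 := by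
  simp only [Category.assoc]
  rw [← Category.assoc (f (r + 1)), h, Category.id_comp, ← Category.assoc (K.d r (r + 1)),
    K.d_comp_d, Limits.zero_comp, Limits.comp_zero]

/-- A complex is isomorphic to the one obtained by conjugating its differentials by isomorphisms. -/
noncomputable def transportIso (h : ∀ r, f r ≫ g r = 𝟙 _) (h' : ∀ r, g r ≫ f r = 𝟙 _) :
    K ≅ CochainComplex.of N (fun r => g r ≫ K.d r (r + 1) ≫ f (r + 1)) (transport_comp K h) :=
  HomologicalComplex.Hom.isoOfComponents (fun r => ⟨f r, g r, h r, h' r⟩) (by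
    rintro r _ rfl
    refine (congrArg (f r ≫ ·)
      (CochainComplex.of_d N (fun r => g r ≫ K.d r (r + 1) ≫ f (r + 1)) r)).trans ?_
    change f r ≫ g r ≫ K.d r (r + 1) ≫ f (r + 1) = _
    rw [← Category.assoc, h, Category.id_comp])

end Transport

theorem exists_deloopAll_iso (M : Mat_ Cobl) :
    ∃ (f : M ⟶ deloopAll M) (g : deloopAll M ⟶ M), f ≫ g = 𝟙 M ∧ g ≫ f = 𝟙 _ ∧
      DegreeZero f ∧ DegreeZero g := by
  -- The instances repeat those inside `deloopAll`, so that the block column built here is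
  -- `deloopAll M` by definition.
  let _ (i : M.ι) : Fintype ({c : (M.X i).tangle.comps // c ≠ (M.X i).tangle.line} → Bool) :=
    Fintype.ofFinite _
  let _ (i : M.ι) : Fintype {c : (M.X i).tangle.comps // c ≠ (M.X i).tangle.line} :=
    Fintype.ofFinite _
  have key (i : M.ι) := exists_isSplitting_lines (Fintype.card (M.X i).tangle.comps - 1)
    (M.X i).tangle (Nat.sub_add_cancel (Fintype.card_pos_iff.2 ⟨(M.X i).tangle.line⟩)).symm
    (Equiv.refl _) (fun ε => (M.X i).tangle.shift + ∑ c, if ε c then 1 else -1) fun _ => rfl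
  choose h v hs using key
  exact ⟨blockHom M h, blockInv M v, blockHom_blockInv M hs, blockInv_blockHom M hs,
    blockHom_degreeZero M hs, blockInv_degreeZero M hs⟩

/-- `deloopHom` and `deloopInv` unfold to the block matrices of the splittings in
`Choice.isSplitting`. -/
theorem deloopHom_deloopInv (M : Mat_ Cobl) (o : ∀ i, Choice (M.X i)) :
    deloopHom M o ≫ deloopInv M o = 𝟙 M :=
  blockHom_blockInv M fun i => (o i).isSplitting

theorem deloopInv_deloopHom (M : Mat_ Cobl) (o : ∀ i, Choice (M.X i)) :
    deloopInv M o ≫ deloopHom M o = 𝟙 (deloop M o) :=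
  blockInv_blockHom M fun i => (o i).isSplitting

theorem deloopHom_degreeZero (M : Mat_ Cobl) (o : ∀ i, Choice (M.X i)) :
    DegreeZero (deloopHom M o) :=
  blockHom_degreeZero M fun i => (o i).isSplitting

theorem deloopInv_degreeZero (M : Mat_ Cobl) (o : ∀ i, Choice (M.X i)) :
    DegreeZero (deloopInv M o) :=
  blockInv_degreeZero M fun i => (o i).isSplitting

section

variable (K : CochainComplex (Mat_ Cobl) ℤ) (o : ∀ r i, Choice ((K.X r).X i))

theorem deloop_d_comp_d (r : ℤ) :
    (deloopInv (K.X r) (o r) ≫ K.d r (r + 1) ≫ deloopHom (K.X (r + 1)) (o (r + 1))) ≫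
      (deloopInv (K.X (r + 1)) (o (r + 1)) ≫ K.d (r + 1) (r + 1 + 1) ≫
        deloopHom (K.X (r + 1 + 1)) (o (r + 1 + 1))) = 0 :=
  transport_comp K (N := fun r => deloop (K.X r) (o r)) (f := fun r => deloopHom (K.X r) (o r))
    (g := fun r => deloopInv (K.X r) (o r)) (fun r => deloopHom_deloopInv (K.X r) (o r)) r

/-- Delooping of chosen circles in a complex. -/
noncomputable def deloopIso : K ≅ CochainComplex.of (fun r => deloop (K.X r) (o r))
    (fun r => deloopInv (K.X r) (o r) ≫ K.d r (r + 1) ≫ deloopHom (K.X (r + 1)) (o (r + 1)))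
    (deloop_d_comp_d K o) :=
  transportIso K (N := fun r => deloop (K.X r) (o r)) (f := fun r => deloopHom (K.X r) (o r))
    (g := fun r => deloopInv (K.X r) (o r)) (fun r => deloopHom_deloopInv (K.X r) (o r))
    (fun r => deloopInv_deloopHom (K.X r) (o r))

end

/-- The isomorphism which deloops the circle `c` of the object `X`. -/
noncomputable def circleIso (X : Tangle) (c : X.comps) (hc : c ≠ X.line) :
    (Mat_.embedding Cobl).obj (ob X) ≅ circleColumn X c hc where
  hom := fun _ b => circleHom X c hc b
  inv := fun b _ => circleInv X c hc b
  hom_inv_id := by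
    funext _ _
    exact (circle_isSplitting X c hc).sum.trans
      (Mat_.id_apply_self ((Mat_.embedding Cobl).obj (ob X)) ()).symm
  inv_hom_id := by
    funext b b'
    refine (Fintype.sum_unique (fun _ : Unit => circleInv X c hc b ≫ circleHom X c hc b')).trans ?_
    by_cases h : b = b'
    · subst h
      exact ((circle_isSplitting X c hc).self b).trans
        (Mat_.id_apply_self (circleColumn X c hc) b).symm
    · exact ((circle_isSplitting X c hc).ne b b' h).trans
        (Mat_.id_apply_of_ne (circleColumn X c hc) b b' h).symm

/-! ### The complex of a link diagram and its reduction to `ℤ[H]`. -/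

namespace LinkDiagram

variable (D : LinkDiagram) (p : D.Point)

/-- Planarity enters here: as the edge merges or splits, `sum_saddle` for the constant function one
says that twice the number of components of the saddle is one less than the number of components of
both smoothings together. All genera are zero, so `degree_of` gives `-1` before shifts. -/
theorem degree_saddle (s : D.State) (j : Fin D.n) (hj : s j = false) (m m' : ℤ) :
    (D.saddle p s (Function.update s j true) m m').degree = -1 + (m' - m) := by
  have h := D.sum_saddle s j hj _ rfl fun _ => 1
  simp only [Finset.sum_const, Finset.card_univ, nsmul_eq_mul, mul_one] at h
  refine (Surface.degree_of ..).trans ?_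
  have h1 : (Fintype.card (D.smoothing p s m).comps : ℤ) = Fintype.card (Quot (D.Adj s)) := rfl
  have h2 : (Fintype.card (D.smoothing p (Function.update s j true) m').comps : ℤ)
    = Fintype.card (Quot (D.Adj (Function.update s j true))) := rfl
  have h3 : (D.smoothing p (Function.update s j true) m').shift - (D.smoothing p s m).shift
    = m' - m := rfl
  rw [h1, h2, h3, Finset.sum_const, Finset.card_univ, nsmul_eq_mul]
  push_cast
  linarith

/-- The shift of the terms rises by one with `r`, which compensates the degree `-1` of a saddle. -/
theorem diff_degreeZero (r : ℤ) : DegreeZero (D.diff p r) := fun s s' => by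
  refine IsHomogeneous.sum fun j _ => ?_
  unfold cubeEdge
  split_ifs with h
  · obtain ⟨hj, hs⟩ := h
    have := D.degree_saddle p s.1 j hj (r + D.pos - D.neg) (r + 1 + D.pos - D.neg)
    rw [← hs] at this
    exact IsHomogeneous.zsmul _ (IsHomogeneous.mor (this.trans (by ring)))
  · exact .zero

theorem Kh_degreeZero (r : ℤ) : DegreeZero ((D.Kh p).d r (r + 1)) := by
  have h : (D.Kh p).d r (r + 1) = D.diff p r :=
    CochainComplex.of_d (D.chain p) (D.diff p) r
  rw [h]
  exact D.diff_degreeZero p r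

end LinkDiagram

/-- The based free module whose special lines are the entries of `deloopAll M`. -/
noncomputable def deloopModule (M : Mat_ Cobl) : FreeModule where
  ι := (deloopAll M).ι
  shift j := ((deloopAll M).X j).tangle.shift

/-- Injectivity of `polyMor` carries the monomial form of homogeneous morphisms back to the
polynomial entries. -/
theorem FreeModule.exists_entry_eq_monomial {L N : FreeModule} (a : L ⟶ N)
    (h : DegreeZero (realize.map a)) (i : L.ι) (j : N.ι) : ∃ (b : ℤ) (k : ℕ),
      FreeModule.entry a i j = Polynomial.monomial k b ∧
        (b ≠ 0 → 2 * (k : ℤ) = N.shift j - L.shift i) := by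
  obtain ⟨b, k, h1, h2⟩ := (h i j).exists_monomial
  exact ⟨b, k, polyMor_injective _ _ h1, h2⟩

/-- A complex whose differentials have degree zero is isomorphic to the image of a complex of free
modules, with monomial entries. -/
theorem exists_reduction (K : CochainComplex (Mat_ Cobl) ℤ)
    (hK : ∀ r, DegreeZero (K.d r (r + 1))) : ∃ (F : CochainComplex FreeModule ℤ)
      (e : K ≅ (realize.mapHomologicalComplex (ComplexShape.up ℤ)).obj F),
      (∀ r, DegreeZero (e.hom.f r) ∧ DegreeZero (e.inv.f r)) ∧
      ∀ (r : ℤ) (i : (F.X r).ι) (j : (F.X (r + 1)).ι), ∃ (a : ℤ) (k : ℕ),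
        FreeModule.entry (F.d r (r + 1)) i j = Polynomial.monomial k a ∧
        (a ≠ 0 → 2 * (k : ℤ) = (F.X (r + 1)).shift j - (F.X r).shift i) := by
  -- The image of `deloopModule M` under `realize` is `deloopAll M` by definition, as its entries
  -- are special lines with the recorded shifts.
  have key (r : ℤ) : ∃ (f : K.X r ⟶ realize.obj (deloopModule (K.X r)))
      (g : realize.obj (deloopModule (K.X r)) ⟶ K.X r), f ≫ g = 𝟙 _ ∧ g ≫ f = 𝟙 _ ∧
      DegreeZero f ∧ DegreeZero g := exists_deloopAll_iso (K.X r)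
  choose f g hfg hgf hf hg using key
  -- Fullness lifts the conjugated differential to a `ℤ[H]`-linear map.
  let d (r : ℤ) : deloopModule (K.X r) ⟶ deloopModule (K.X (r + 1)) :=
    realize.preimage (g r ≫ K.d r (r + 1) ≫ f (r + 1))
  have hd (r : ℤ) : realize.map (d r) = g r ≫ K.d r (r + 1) ≫ f (r + 1) := realize.map_preimage _
  have hd0 (r : ℤ) : DegreeZero (realize.map (d r)) := by
    rw [hd]
    exact (hg r).comp ((hK r).comp (hf (r + 1)))
  -- Faithfulness brings `d² = 0` back from the conjugated complex.
  let F : CochainComplex FreeModule ℤ := CochainComplex.of (fun r => deloopModule (K.X r)) d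
    fun r => realize.map_injective (by
      rw [realize.map_comp, hd, hd, transport_comp K hfg, realize.map_zero])
  have hF (r : ℤ) : F.d r (r + 1) = d r :=
    CochainComplex.of_d (fun r => deloopModule (K.X r)) d r
  refine ⟨F, HomologicalComplex.Hom.isoOfComponents (fun r => ⟨f r, g r, hfg r, hgf r⟩) ?_,
    fun r => ⟨hf r, hg r⟩, fun r i j => ?_⟩
  · rintro r _ rfl
    refine (congrArg (fun z => f r ≫ realize.map z) (hF r)).trans ?_
    refine (congrArg (f r ≫ ·) (hd r)).trans ?_
    rw [← Category.assoc, hfg, Category.id_comp]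
    rfl
  · rw [hF]
    exact FreeModule.exists_entry_eq_monomial (d r) (hd0 r) i j

end BarNatan

theorem mainTheorem3 :
    (∀ (X : Tangle) (c : X.comps) (hc : c ≠ X.line),
      ∃ e : (Mat_.embedding Cobl).obj (ob X) ≅ circleColumn X c hc,
        e.hom () false = (cap X c hc (-1)).mor ∧
        e.hom () true = (dottedCap X c hc 1).mor - (cap X c hc 1).mor ≫ (handle _).mor ∧
        e.inv false () = (dottedCup X c hc (-1)).mor ∧
        e.inv true () = (cup X c hc 1).mor ∧
        DegreeZero e.hom ∧ DegreeZero e.inv) ∧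
    (∀ (M : Mat_ Cobl) (o : ∀ i, Choice (M.X i)),
      deloopHom M o ≫ deloopInv M o = 𝟙 M ∧ deloopInv M o ≫ deloopHom M o = 𝟙 (deloop M o) ∧
        DegreeZero (deloopHom M o) ∧ DegreeZero (deloopInv M o)) ∧
    (∀ (K : CochainComplex (Mat_ Cobl) ℤ) (o : ∀ r i, Choice ((K.X r).X i)),
      ∃ (h : ∀ r, (deloopInv (K.X r) (o r) ≫ K.d r (r + 1) ≫ deloopHom (K.X (r + 1)) (o (r + 1))) ≫
          (deloopInv (K.X (r + 1)) (o (r + 1)) ≫ K.d (r + 1) (r + 1 + 1) ≫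
            deloopHom (K.X (r + 1 + 1)) (o (r + 1 + 1))) = 0)
        (e : K ≅ CochainComplex.of (fun r => deloop (K.X r) (o r))
          (fun r => deloopInv (K.X r) (o r) ≫ K.d r (r + 1) ≫
            deloopHom (K.X (r + 1)) (o (r + 1))) h),
        (∀ r, e.hom.f r = deloopHom (K.X r) (o r) ∧ e.inv.f r = deloopInv (K.X r) (o r)) ∧
        ((∀ r, DegreeZero (K.d r (r + 1))) → ∀ r, DegreeZero
          (deloopInv (K.X r) (o r) ≫ K.d r (r + 1) ≫ deloopHom (K.X (r + 1)) (o (r + 1))))) ∧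
    (∀ K : CochainComplex (Mat_ Cobl) ℤ,
      ∃ (d : ∀ r, deloopAll (K.X r) ⟶ deloopAll (K.X (r + 1))) (h : ∀ r, d r ≫ d (r + 1) = 0)
        (e : K ≅ CochainComplex.of (fun r => deloopAll (K.X r)) d h),
        (∀ r, DegreeZero (e.hom.f r) ∧ DegreeZero (e.inv.f r)) ∧
        ((∀ r, DegreeZero (K.d r (r + 1))) → ∀ r, DegreeZero (d r))) ∧
    (realize.Full ∧ realize.Faithful) ∧
    (∀ (D : LinkDiagram) (p : D.Point),
      (∀ r, DegreeZero ((D.Kh p).d r (r + 1))) ∧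
      ∃ (F : CochainComplex FreeModule ℤ)
        (e : D.Kh p ≅ (realize.mapHomologicalComplex (ComplexShape.up ℤ)).obj F),
        (∀ r, DegreeZero (e.hom.f r) ∧ DegreeZero (e.inv.f r)) ∧
        ∀ (r : ℤ) (i : (F.X r).ι) (j : (F.X (r + 1)).ι), ∃ (a : ℤ) (k : ℕ),
          FreeModule.entry (F.d r (r + 1)) i j = Polynomial.monomial k a ∧
          (a ≠ 0 → 2 * (k : ℤ) = (F.X (r + 1)).shift j - (F.X r).shift i)) := by
  refine ⟨fun X c hc => ⟨circleIso X c hc, rfl, rfl, rfl, rfl,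
      fun _ b => (circle_isSplitting X c hc).hom_degree b,
      fun b _ => (circle_isSplitting X c hc).inv_degree b⟩,
    fun M o => ⟨deloopHom_deloopInv M o, deloopInv_deloopHom M o, deloopHom_degreeZero M o,
      deloopInv_degreeZero M o⟩,
    fun K o => ?_, fun K => ?_, ⟨inferInstance, inferInstance⟩,
    fun D p => ⟨D.Kh_degreeZero p, exists_reduction (D.Kh p) (D.Kh_degreeZero p)⟩⟩
  · exact ⟨deloop_d_comp_d K o, deloopIso K o, fun r => ⟨rfl, rfl⟩, fun hK r =>
      (deloopInv_degreeZero _ _).comp ((hK r).comp (deloopHom_degreeZero _ _))⟩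
  · choose f g hfg hgf hf hg using fun r => exists_deloopAll_iso (K.X r)
    exact ⟨_, transport_comp K hfg, transportIso K hfg hgf, fun r => ⟨hf r, hg r⟩,
      fun hK r => (hg r).comp ((hK r).comp (hf (r + 1)))⟩
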